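/- **Theorem 2 (nine families of four-qubit states).** States are (not necessarily normalized) vectors $\psi=(\psi_{i_1i_2i_3i_4})$ of $(\mathbb C^2)^{\otimes 4}$. Let $$T=\frac1{\sqrt2}\begin{pmatrix}1&0&0&1\\0&i&i&0\\0&-1&1&0\\i&0&0&-i\end{pmatrix},$$ let $\tilde\psi$ be the $4\times4$ matrix with row index $(i_1,i_2)$ and column index $(i_3,i_4)$ obtained from $\psi$, and put $$R=T\tilde\psi T^\dagger,\qquad P=P(\psi)=\begin{pmatrix}0&R\\R^T&0\end{pmatrix}.$$ For every $\psi$ there are a permutation of the four qubits, carrying $\psi$ to $\psi'$, and $A_1,A_2,A_3,A_4\in SL(2,\mathbb C)$ such that $(A_1\otimes A_2\otimes A_3\otimes A_4)\psi'$ is one of the following states, with complex parameters $a,b,c,d$: $$\begin{aligned} G_{abcd}&=\tfrac{a+d}2(|0000\rangle+|1111\rangle)+\tfrac{a-d}2(|0011\rangle+|1100\rangle)+\tfrac{b+c}2(|0101\rangle+|1010\rangle)+\tfrac{b-c}2(|0110\rangle+|1001\rangle)\\ L_{abc_2}&=\tfrac{a+b}2(|0000\rangle+|1111\rangle)+\tfrac{a-b}2(|0011\rangle+|1100\rangle)+c(|0101\rangle+|1010\rangle)+|0110\rangle\\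 L_{a_2b_2}&=a(|0000\rangle+|1111\rangle)+b(|0101\rangle+|1010\rangle)+|0110\rangle+|0011\rangle\\ L_{ab_3}&=a(|0000\rangle+|1111\rangle)+\tfrac{a+b}2(|0101\rangle+|1010\rangle)+\tfrac{a-b}2(|0110\rangle+|1001\rangle)+\tfrac{i}{\sqrt2}(|0001\rangle+|0010\rangle-|0111\rangle-|1011\rangle)\\ L_{a_4}&=a(|0000\rangle+|0101\rangle+|1010\rangle+|1111\rangle)+(i|0001\rangle+|0110\rangle-i|1011\rangle)\\ L_{a_20_{3\oplus\bar1}}&=a(|0000\rangle+|1111\rangle)+(|0011\rangle+|0101\rangle+|0110\rangle)\\ L_{0_{5\oplus\bar3}}&=|0000\rangle+|0101\rangle+|1000\rangle+|1110\rangle\\ L_{0_{7\oplus\bar1}}&=|0000\rangle+|1011\rangle+|1101\rangle+|1110\rangle\\ L_{0_{3\oplus\bar1}0_{3\oplus\bar1}}&=|0000\rangle+|0111\rangle \end{aligned}$$ Moreover, $P(\psi')$ and $P$ of the family state have the Jordan block structure listed below, and the parameters (each repeated according to the size of its block in the list, with $0$ taken $\frac{p+q}2$ times for a degenerated pair $p\oplus\bar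 q$) form the unique multiset $\{\lambda_1,\dots,\lambda_4\}$ of numbers with non-negative real part such that the eigenvalues of $P(\psi')$, with multiplicity, are $\pm\lambda_1,\dots,\pm\lambda_4$. (Here, of two opposite purely imaginary numbers, only the one with positive imaginary part is admitted.) Write $[m;\lambda]$ for two $m\times m$ Jordan blocks of $P$ with eigenvalues $\lambda$ and $-\lambda$ whose invariant subspaces are exchanged by $(v_1,v_2)\mapsto(v_1,-v_2)$ on $\mathbb C^4\oplus\mathbb C^4$. Write $p\oplus\bar q$ for a degenerated pair: two Jordan blocks with eigenvalue $0$ and odd sizes $p$ and $q$, spanned by Jordan chains of vectors lying alternately in $\mathbb C^4\oplus0$ and $0\oplus\mathbb C^4$, the first chain starting in $\mathbb C^4\oplus 0$ and the second in $0\oplus\mathbb C^4$ (the other way round in the case of $5\oplus\bar3$). The structures are: $G_{abcd}$: $[1;a],[1;b],[1;c],[1;d]$; $L_{abc_2}$: $[1;a],[1;b],[2;c]$; $L_{a_2b_2}$: $[2;a],[2;b]$; $L_{ab_3}$: $[3;a],[1;b]$; $L_{a_4}$: $[4;a]$; $L_{a_20_{3\oplus\bar1}}$: $[2;a],3\oplus\bar1$;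 $L_{0_{5\oplus\bar3}}$: $5\oplus\bar3$; $L_{0_{7\oplus\bar1}}$: $7\oplus\bar1$; $L_{0_{3\oplus\bar1}0_{3\oplus\bar1}}$: $3\oplus\bar1,3\oplus\bar1$. For the family states themselves these structures hold for all complex values of the parameters, and the eigenvalue statement holds whenever the parameters lie in the half-plane described above. -/

import Mathlib

open scoped Matrix

noncomputable section

namespace FourQubits

/-! ### Four-qubit states and the operations on them -/

/-- A (not necessarily normalized) vector of `(ℂ²)^{⊗4}`, given by its coordinates
`ψ_{i₁ i₂ i₃ i₄}` in the computational basis. -/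
abbrev State : Type := (Fin 4 → Fin 2) → ℂ

/-- The computational basis vector `|i j k l⟩`. -/
def ket (i j k l : Fin 2) : State := Pi.single ![i, j, k, l] 1

/-- Permutation of the qubits. -/
def permuteQubits (σ : Equiv.Perm (Fin 4)) (ψ : State) : State := fun x => ψ (x ∘ σ)

/-- The determinant-one SLOCC operation `A₁ ⊗ A₂ ⊗ A₃ ⊗ A₄` applied to `ψ`. -/
def slocc (A : Fin 4 → Matrix.SpecialLinearGroup (Fin 2) ℂ) (ψ : State) : State :=
  fun x => ∑ y : Fin 4 → Fin 2, (∏ k : Fin 4, (A k).1 (x k) (y k)) * ψ y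

/-! ### The matrices `R` and `P` -/

/-- The unitary matrix `T` of the magic basis. -/
def magicT : Matrix (Fin 4) (Fin 4) ℂ :=
  ((1 / Real.sqrt 2 : ℝ) : ℂ) •
    !![1, 0, 0, 1;
       0, Complex.I, Complex.I, 0;
       0, -1, 1, 0;
       Complex.I, 0, 0, -Complex.I]

/-- The coordinates of `ψ` as a `4 × 4` matrix, with row index `(i₁, i₂)` and column index
`(i₃, i₄)`, both in lexicographic order. -/
def stateMatrix (ψ : State) : Matrix (Fin 4) (Fin 4) ℂ :=
  Matrix.reindex finProdFinEquiv finProdFinEquiv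
    (Matrix.of fun r c : Fin 2 × Fin 2 => ψ ![r.1, r.2, c.1, c.2])

/-- The state matrix in the magic basis, `R = T ψ̃ T†`. -/
def matR (ψ : State) : Matrix (Fin 4) (Fin 4) ℂ := magicT * stateMatrix ψ * magicTᴴ

/-- The symmetric matrix `P = [[0, R], [Rᵀ, 0]]`. -/
def matP (ψ : State) : Matrix (Fin 4 ⊕ Fin 4) (Fin 4 ⊕ Fin 4) ℂ :=
  Matrix.fromBlocks 0 (matR ψ) (matR ψ)ᵀ 0

/-! ### The eigenvalues of `P` with non-negative real part -/

/-- Non-negative real part; of the two opposite numbers on the imaginary axis, the one with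
non-negative imaginary part is chosen, so that of `z` and `-z` exactly one qualifies
if `z ≠ 0`. -/
def IsRight (z : ℂ) : Prop := 0 < z.re ∨ (z.re = 0 ∧ 0 ≤ z.im)

/-- The eigenvalues of `P`, with algebraic multiplicities, are the numbers `±z` for `z` in the
multiset `s`, and `s` lies in the right half-plane. -/
def IsRightSpectrum (P : Matrix (Fin 4 ⊕ Fin 4) (Fin 4 ⊕ Fin 4) ℂ) (s : Multiset ℂ) : Prop :=
  (∀ z ∈ s, IsRight z) ∧
    P.charpoly =
      (s.map fun z => (Polynomial.X - Polynomial.C z) * (Polynomial.X + Polynomial.C z)).prod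

/-! ### The Jordan block structure of `P` -/

/-- `v 0, v 1, …, v (m - 1)` is a Jordan chain of `P` with eigenvalue `z`:
`P v₀ = z v₀` and `P vₖ = z vₖ + vₖ₋₁` for `k ≥ 1` (linear independence is required elsewhere). -/
def IsJordanChain {n : Type} [Fintype n] (P : Matrix n n ℂ) (z : ℂ) {m : ℕ}
    (v : Fin m → n → ℂ) : Prop :=
  (∀ k : Fin m, (k : ℕ) = 0 → P *ᵥ v k = z • v k) ∧
    ∀ j k : Fin m, (k : ℕ) = j + 1 → P *ᵥ v k = z • v k + v j

/-- The map `[v₁; v₂] ↦ [v₁; -v₂]`. -/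
def mirror (v : Fin 4 ⊕ Fin 4 → ℂ) : Fin 4 ⊕ Fin 4 → ℂ :=
  Sum.elim (fun i => v (Sum.inl i)) (fun i => -v (Sum.inr i))

/-- `InHalf true v`: `v = [v₁; 0]`, and `InHalf false v`: `v = [0; v₂]`. -/
def InHalf : Bool → (Fin 4 ⊕ Fin 4 → ℂ) → Prop
  | true, v => ∀ i, v (Sum.inr i) = 0
  | false, v => ∀ i, v (Sum.inl i) = 0

/-- The constituents of the Jordan block structure of a matrix `P = [[0, R], [Rᵀ, 0]]`.

* `pair m z`: two `m × m` Jordan blocks, with eigenvalues `z` and `-z`, whose invariant subspaces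
  are exchanged by `[v₁; v₂] ↦ [v₁; -v₂]`.
* `degenerate h p q`: the degenerated pair `p ⊕ q̄`, two Jordan blocks with eigenvalue `0`, of
  dimensions `p` and `q`, each spanned by a Jordan chain of vectors that lie alternately in the
  two halves `[v₁; 0]` and `[0; v₂]`; the first chain starts in the half given by `h`, the second
  one in the other half. -/
inductive PBlock : Type
  | pair (m : ℕ) (z : ℂ) : PBlock
  | degenerate (h : Bool) (p q : ℕ) : PBlock

namespace PBlock

/-- Dimension of the first Jordan block. -/
def fstDim : PBlock → ℕ
  | pair m _ => m
  | degenerate _ p _ => p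

/-- Dimension of the second Jordan block. -/
def sndDim : PBlock → ℕ
  | pair m _ => m
  | degenerate _ _ q => q

/-- The vectors `u` and `w` realize the constituent `B` in `P`. For `pair m z`, the vectors
`w = mirror u` satisfy `P w₀ = -z w₀` and `P wₖ = -z wₖ - wₖ₋₁`. -/
def IsRealizedBy (P : Matrix (Fin 4 ⊕ Fin 4) (Fin 4 ⊕ Fin 4) ℂ) :
    (B : PBlock) → (Fin B.fstDim → Fin 4 ⊕ Fin 4 → ℂ) → (Fin B.sndDim → Fin 4 ⊕ Fin 4 → ℂ) → Prop
  | pair m z => fun (u : Fin m → Fin 4 ⊕ Fin 4 → ℂ) (w : Fin m → Fin 4 ⊕ Fin 4 → ℂ) =>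
      IsJordanChain P z u ∧ ∀ k, w k = mirror (u k)
  | degenerate h p q => fun (u : Fin p → Fin 4 ⊕ Fin 4 → ℂ) (w : Fin q → Fin 4 ⊕ Fin 4 → ℂ) =>
      IsJordanChain P 0 u ∧ IsJordanChain P 0 w ∧
        (∀ k : Fin p, InHalf (if Even (k : ℕ) then h else !h) (u k)) ∧
        (∀ k : Fin q, InHalf (if Even (k : ℕ) then !h else h) (w k))

end PBlock

/-- `P` has the Jordan block structure `L`: there are vectors realizing all members of the list
`L` which together form a basis of `ℂ⁸`. -/
def HasBlockStructure (P : Matrix (Fin 4 ⊕ Fin 4) (Fin 4 ⊕ Fin 4) ℂ) (L : List PBlock) : Prop :=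
  ∃ (u : (i : Fin L.length) → Fin (L.get i).fstDim → Fin 4 ⊕ Fin 4 → ℂ)
    (w : (i : Fin L.length) → Fin (L.get i).sndDim → Fin 4 ⊕ Fin 4 → ℂ),
    (∀ i, (L.get i).IsRealizedBy P (u i) (w i)) ∧
    LinearIndependent ℂ
      (fun x : (i : Fin L.length) × (Fin (L.get i).fstDim ⊕ Fin (L.get i).sndDim) =>
        Sum.elim (u x.1) (w x.1) x.2) ∧
    Submodule.span ℂ (Set.range
      (fun x : (i : Fin L.length) × (Fin (L.get i).fstDim ⊕ Fin (L.get i).sndDim) =>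
        Sum.elim (u x.1) (w x.1) x.2)) = ⊤

/-! ### The nine families -/

/-- The members of the nine families, with their complex parameters. -/
inductive Family : Type
  | Gabcd (a b c d : ℂ) : Family
  | Labc2 (a b c : ℂ) : Family
  | La2b2 (a b : ℂ) : Family
  | Lab3 (a b : ℂ) : Family
  | La4 (a : ℂ) : Family
  | La2031 (a : ℂ) : Family
  | L053 : Family
  | L071 : Family
  | L031031 : Family

namespace Family

/-- The representative states. -/
def state : Family → State
  | Gabcd a b c d =>
      ((a + d) / 2) • (ket 0 0 0 0 + ket 1 1 1 1) + ((a - d) / 2) • (ket 0 0 1 1 + ket 1 1 0 0)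
      + ((b + c) / 2) • (ket 0 1 0 1 + ket 1 0 1 0) + ((b - c) / 2) • (ket 0 1 1 0 + ket 1 0 0 1)
  | Labc2 a b c =>
      ((a + b) / 2) • (ket 0 0 0 0 + ket 1 1 1 1) + ((a - b) / 2) • (ket 0 0 1 1 + ket 1 1 0 0)
      + c • (ket 0 1 0 1 + ket 1 0 1 0) + ket 0 1 1 0
  | La2b2 a b =>
      a • (ket 0 0 0 0 + ket 1 1 1 1) + b • (ket 0 1 0 1 + ket 1 0 1 0)
      + ket 0 1 1 0 + ket 0 0 1 1
  | Lab3 a b =>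
      a • (ket 0 0 0 0 + ket 1 1 1 1) + ((a + b) / 2) • (ket 0 1 0 1 + ket 1 0 1 0)
      + ((a - b) / 2) • (ket 0 1 1 0 + ket 1 0 0 1)
      + (Complex.I / ((Real.sqrt 2 : ℝ) : ℂ)) •
          (ket 0 0 0 1 + ket 0 0 1 0 - ket 0 1 1 1 - ket 1 0 1 1)
  | La4 a =>
      a • (ket 0 0 0 0 + ket 0 1 0 1 + ket 1 0 1 0 + ket 1 1 1 1)
      + (Complex.I • ket 0 0 0 1 + ket 0 1 1 0 - Complex.I • ket 1 0 1 1)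
  | La2031 a =>
      a • (ket 0 0 0 0 + ket 1 1 1 1) + (ket 0 0 1 1 + ket 0 1 0 1 + ket 0 1 1 0)
  | L053 => ket 0 0 0 0 + ket 0 1 0 1 + ket 1 0 0 0 + ket 1 1 1 0
  | L071 => ket 0 0 0 0 + ket 1 0 1 1 + ket 1 1 0 1 + ket 1 1 1 0
  | L031031 => ket 0 0 0 0 + ket 0 1 1 1

/-- The Jordan block structure recorded by the index of the family. -/
def blocks : Family → List PBlock
  | Gabcd a b c d => [.pair 1 a, .pair 1 b, .pair 1 c, .pair 1 d]
  | Labc2 a b c => [.pair 1 a, .pair 1 b, .pair 2 c]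
  | La2b2 a b => [.pair 2 a, .pair 2 b]
  | Lab3 a b => [.pair 3 a, .pair 1 b]
  | La4 a => [.pair 4 a]
  | La2031 a => [.pair 2 a, .degenerate true 3 1]
  | L053 => [.degenerate false 5 3]
  | L071 => [.degenerate true 7 1]
  | L031031 => [.degenerate true 3 1, .degenerate true 3 1]

/-- The four eigenvalues attached to a member of a family: its parameters, each repeated
according to the dimension of its Jordan block, and `0` for the degenerated pairs. -/
def eigenvalues : Family → Multiset ℂ
  | Gabcd a b c d => {a, b, c, d}
  | Labc2 a b c => {a, b, c, c}
  | La2b2 a b => {a, a, b, b}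
  | Lab3 a b => {a, a, a, b}
  | La4 a => {a, a, a, a}
  | La2031 a => {a, a, 0, 0}
  | L053 => {0, 0, 0, 0}
  | L071 => {0, 0, 0, 0}
  | L031031 => {0, 0, 0, 0}

end Family

end FourQubits

end

open scoped Matrix

noncomputable section

namespace FourQubits

/-! Local operations act on the coordinate matrix by `M ↦ (A₁ ⊗ A₂) M (A₃ ⊗ A₄)ᵀ`. On `ℂ² ⊗ ℂ²`,
read as `2 × 2` matrices, they preserve the determinant form, whose isometries are exactly `X ↦ A X
Bᵀ` and `X ↦ A Xᵀ Bᵀ` with `A`, `B` in `SL(2, ℂ)`; the transposition is the exchange of two qubits.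
The magic basis turns this form into the dot product of `ℂ⁴`. Up to exchanges inside the two pairs
of qubits, local equivalence is therefore `R ↦ O₁ R O₂ᵀ` with complex orthogonal `O₁`, `O₂`, that
is, conjugation of the symmetric matrix `P` by an orthogonal matrix commuting with `J = diag(1,
-1)`.

Orthogonality comes for free. If an invertible `D` commutes with `J` and intertwines two such
matrices `P`, then `Dᵀ D` commutes with `J` and with the first of them, and it has a square root `Q`
that is a polynomial in `Dᵀ D`; the matrix `D Q⁻¹` is orthogonal and still intertwines
(`exists_orthogonal_of_intertwines`). Hence states with the same block structure are equivalent
(`equivalent_of_hasBlockStructure`), and it remains to find which block structures occur.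

`P` is self-adjoint for the dot product and anticommutes with `J`. In a nondegenerate stable
subspace there is a generalized eigenvector `v` with `(P - z)ᵏ⁺¹ v = 0` and `⟨v, (P - z)ᵏ v⟩ ≠ 0`.
Its chain and the mirror image of the chain span a nondegenerate summand, except when `z = 0` and
`k` is even; then `v` can be moved into one of the halves, and it generates a single string of odd
length (`IsStableNondeg.exists_split_atom`). As `J` has trace zero, equally many strings start in
either half. They are matched into degenerated pairs, or into ordinary pairs when the lengths agree
(`Decomp.exists_reduced`).

In dimension eight this leaves the nine listed structures and two more, up to an interchange of the
halves, which is achieved by exchanging the first two qubits with the last two. The extra structures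
`[1;x], [1;y], 3 ⊕ 1̄` and `[1;x], 5 ⊕ 1̄` are those of `La2b2` and `La4` after an exchange of the
middle qubits; this is where permutations across the pairs are needed. Explicit Jordan bases and
determinants give the blocks and spectra of the family states. -/

/-! ### Square roots of invertible matrices and the polar part of an intertwiner. -/

open Polynomial in
/-- Square roots modulo powers: Hensel lifting. -/
theorem exists_sq_sub_X_dvd (s : Finset ℂ) (h0 : (0 : ℂ) ∉ s) (k : ℕ) :
    ∃ f : ℂ[X], (∏ z ∈ s, (X - C z)) ^ (k + 1) ∣ f ^ 2 - X := by
  set r : ℂ[X] := ∏ z ∈ s, (X - C z) with hr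
  have hX : IsCoprime (X : ℂ[X]) r := by
    refine IsCoprime.prod_right fun z hz => ?_
    have := isCoprime_X_sub_C_of_isUnit_sub (R := ℂ) (a := 0) (b := z)
      (by simpa using ne_of_mem_of_not_mem hz h0)
    simpa only [C_0, sub_zero] using this
  induction k with
  | zero =>
    -- Modulo the squarefree product a square root only has to be right at each node, so square
    -- roots of the nodes are interpolated.
    refine ⟨Lagrange.interpolate s id (fun z => z ^ (1 / 2 : ℂ)), ?_⟩
    rw [zero_add, pow_one]
    refine Finset.prod_dvd_of_coprime (fun x _ y _ hxy => ?_) fun z hz => ?_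
    · exact isCoprime_X_sub_C_of_isUnit_sub (by simpa [sub_eq_zero] using hxy)
    · rw [dvd_iff_isRoot, IsRoot.def, eval_sub, eval_pow, eval_X]
      have := Lagrange.eval_interpolate_at_node (fun z : ℂ => z ^ (1 / 2 : ℂ))
        (Set.injOn_id (s : Set ℂ)) hz
      rw [id] at this
      rw [this, sub_eq_zero]
      simp
  | succ k ih =>
    obtain ⟨f, h, hf⟩ := ih
    have hf2 : IsCoprime (f ^ 2) r := by
      have : f ^ 2 = X + r * (r ^ k * h) := by
        rw [← sub_eq_iff_eq_add', hf]; ring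
      rw [this]
      exact hX.add_mul_left_left _
    have hf1 : IsCoprime (C 2 * f) r := by
      refine IsCoprime.mul_left ?_ (IsCoprime.pow_left_iff (by norm_num) |>.1 hf2)
      exact (isCoprime_one_left).of_isCoprime_of_dvd_left
        (isUnit_C.2 (by norm_num : IsUnit (2 : ℂ))).dvd
    obtain ⟨u, v, huv⟩ := hf1
    -- Newton's correction: `u` inverts `2 f` modulo `r`, so subtracting `u (f² - X)` gains one more
    -- power of `r`.
    refine ⟨f - r ^ (k + 1) * (h * u), h * v + r ^ k * (h * u) ^ 2, ?_⟩
    have h2 : (C 2 : ℂ[X]) = 2 := rfl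
    rw [h2] at huv
    linear_combination hf - r ^ (k + 1) * h * huv

-- By Cayley–Hamilton it suffices that the characteristic polynomial divides `f² - X`. It divides a
-- power of the product over its distinct roots, none of which is zero since `S` is invertible. A
-- root that is a polynomial in `S` is wanted because it inherits symmetry and commutation relations
-- from `S`.
open Polynomial in
theorem exists_aeval_sq_eq {n : Type*} [Fintype n] [DecidableEq n] (S : Matrix n n ℂ)
    (hS : IsUnit S) : ∃ f : ℂ[X], (aeval S f) ^ 2 = S := by
  set s := S.charpoly.roots.toFinset
  have h0 : (0 : ℂ) ∉ s := by
    intro h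
    have h1 : S.charpoly.IsRoot 0 := by
      exact isRoot_of_mem_roots (Multiset.mem_toFinset.1 h)
    have h2 := Matrix.det_eq_sign_charpoly_coeff S
    rw [coeff_zero_eq_eval_zero, h1] at h2
    have := (Matrix.isUnit_iff_isUnit_det _).1 hS
    rw [h2] at this
    simp at this
  obtain ⟨f, hf⟩ := exists_sq_sub_X_dvd s h0 S.charpoly.roots.card
  refine ⟨f, ?_⟩
  have hd : S.charpoly ∣ f ^ 2 - X := by
    refine dvd_trans ?_ (dvd_trans (pow_dvd_pow _ (Nat.le_succ _)) hf)
    have hsp := (IsAlgClosed.splits S.charpoly).eq_prod_roots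
    rw [(Matrix.charpoly_monic S).leadingCoeff, C_1, one_mul] at hsp
    conv_lhs => rw [hsp]
    have := Multiset.prod_dvd_prod_of_dvd (S := S.charpoly.roots) (fun z => X - C z)
      (fun _ => ∏ z ∈ s, (X - C z)) (fun z hz =>
        Finset.dvd_prod_of_mem (fun z => X - C z) (Multiset.mem_toFinset.2 hz))
    simpa using this
  obtain ⟨g, hg⟩ := hd
  have := congrArg (aeval S) hg
  rw [map_mul, Matrix.aeval_self_charpoly, zero_mul, map_sub, map_pow, aeval_X, sub_eq_zero] at this
  exact this

/-- An invertible matrix intertwining symmetric matrices can be replaced by its orthogonal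
"polar part". -/
theorem exists_orthogonal_of_intertwines {n : Type*} [Fintype n] [DecidableEq n]
    {P P' J D : Matrix n n ℂ} (hP : Pᵀ = P) (hP' : P'ᵀ = P') (hJ : Jᵀ = J) (hD : IsUnit D)
    (h1 : D * P = P' * D) (h2 : D * J = J * D) :
    ∃ O : Matrix n n ℂ, Oᵀ * O = 1 ∧ O * P = P' * O ∧ O * J = J * O := by
  -- Transposing `D X = X' D` gives `X Dᵀ = Dᵀ X'`; together the two relations let `X` pass through
  -- `Dᵀ D`.
  have key : ∀ {X X' : Matrix n n ℂ}, Xᵀ = X → X'ᵀ = X' → D * X = X' * D →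
      Commute (Dᵀ * D) X := by
    intro X X' hX hX' h
    have h' : X * Dᵀ = Dᵀ * X' := by
      have := congrArg Matrix.transpose h
      rwa [Matrix.transpose_mul, Matrix.transpose_mul, hX, hX'] at this
    change Dᵀ * D * X = X * (Dᵀ * D)
    rw [Matrix.mul_assoc, h, ← Matrix.mul_assoc, ← h', Matrix.mul_assoc]
  have hDt : IsUnit Dᵀ := (Matrix.isUnit_transpose D).2 hD
  obtain ⟨f, hf⟩ := exists_aeval_sq_eq (Dᵀ * D) (hDt.mul hD)
  set Q := Polynomial.aeval (Dᵀ * D) f with hQ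
  have hcomm : ∀ {X : Matrix n n ℂ}, Commute (Dᵀ * D) X → Commute Q X := by
    intro X hX
    suffices h : ∀ p : Polynomial ℂ, Commute (Polynomial.aeval (Dᵀ * D) p) X from h f
    intro p
    induction p using Polynomial.induction_on' with
    | add p q hp hq => rw [map_add]; exact hp.add_left hq
    | monomial k c =>
      rw [Polynomial.aeval_monomial]
      exact (Algebra.commute_algebraMap_left c X).mul_left (hX.pow_left k)
  have hQt : Qᵀ = Q := by
    have hS : (Dᵀ * D)ᵀ = Dᵀ * D := by
      rw [Matrix.transpose_mul, Matrix.transpose_transpose]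
    rw [hQ, Polynomial.aeval_eq_sum_range, Matrix.transpose_sum]
    refine Finset.sum_congr rfl fun k _ => ?_
    rw [Matrix.transpose_smul, Matrix.transpose_pow, hS]
  have hQu : IsUnit Q := by
    have : IsUnit (Q ^ 2) := hf ▸ hDt.mul hD
    exact (isUnit_pow_iff two_ne_zero).1 this
  have hQd : IsUnit Q.det := (Matrix.isUnit_iff_isUnit_det _).1 hQu
  have hint : ∀ {X X' : Matrix n n ℂ}, Commute Q X → D * X = X' * D →
      D * Q⁻¹ * X = X' * (D * Q⁻¹) := by
    intro X X' hX h
    have : Q⁻¹ * X = X * Q⁻¹ := by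
      calc Q⁻¹ * X = Q⁻¹ * (X * Q) * Q⁻¹ := by
            rw [Matrix.mul_assoc, Matrix.mul_assoc, Matrix.mul_nonsing_inv _ hQd, Matrix.mul_one]
        _ = X * Q⁻¹ := by
            rw [← hX.eq, ← Matrix.mul_assoc, Matrix.nonsing_inv_mul _ hQd, Matrix.one_mul]
    rw [Matrix.mul_assoc, this, ← Matrix.mul_assoc, h, Matrix.mul_assoc]
  -- With `Q` symmetric and `Q² = Dᵀ D`, one gets `(D Q⁻¹)ᵀ (D Q⁻¹) = Q⁻¹ Q² Q⁻¹ = 1`.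
  refine ⟨D * Q⁻¹, ?_, hint (hcomm (key hP hP' h1)) h1, hint (hcomm (key hJ hJ h2)) h2⟩
  rw [Matrix.transpose_mul, Matrix.transpose_nonsing_inv, hQt, Matrix.mul_assoc,
    ← Matrix.mul_assoc Dᵀ, ← hf, pow_two, Matrix.mul_assoc Q, Matrix.mul_nonsing_inv _ hQd,
    Matrix.mul_one, Matrix.nonsing_inv_mul _ hQd]

/-! ### The reflection of the two halves and the transport of Jordan chains. -/

/-- The matrix of `mirror`. -/
def matJ : Matrix (Fin 4 ⊕ Fin 4) (Fin 4 ⊕ Fin 4) ℂ := Matrix.fromBlocks 1 0 0 (-1)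

theorem matJ_mulVec (v : Fin 4 ⊕ Fin 4 → ℂ) : matJ *ᵥ v = mirror v := by
  rw [matJ, Matrix.fromBlocks_mulVec]
  ext i
  cases i <;> simp [mirror, Matrix.neg_mulVec]

theorem matJ_transpose : matJᵀ = matJ := by
  simp [matJ, Matrix.fromBlocks_transpose]

theorem mirror_mirror (v : Fin 4 ⊕ Fin 4 → ℂ) : mirror (mirror v) = v := by
  ext i; cases i <;> simp [mirror]

theorem mirror_of_inHalf_true {v : Fin 4 ⊕ Fin 4 → ℂ} (h : InHalf true v) : mirror v = v := by
  ext i; cases i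
  · simp [mirror]
  · rename_i i; simp [mirror, h i]

theorem mirror_of_inHalf_false {v : Fin 4 ⊕ Fin 4 → ℂ} (h : InHalf false v) : mirror v = -v := by
  ext i; cases i
  · rename_i i; simp [mirror, h i]
  · simp [mirror]

theorem mirror_of_inHalf {h : Bool} {v : Fin 4 ⊕ Fin 4 → ℂ} (hv : InHalf h v) :
    mirror v = (if h then (1 : ℂ) else -1) • v := by
  cases h
  · simp [mirror_of_inHalf_false hv]
  · simp [mirror_of_inHalf_true hv]

theorem matP_transpose (ψ : State) : (matP ψ)ᵀ = matP ψ := by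
  simp [matP, Matrix.fromBlocks_transpose]

theorem matP_mul_matJ (ψ : State) : matP ψ * matJ = -(matJ * matP ψ) := by
  simp [matP, matJ, Matrix.fromBlocks_multiply, Matrix.fromBlocks_neg]

theorem matP_mulVec_mirror (ψ : State) (v : Fin 4 ⊕ Fin 4 → ℂ) :
    matP ψ *ᵥ mirror v = -mirror (matP ψ *ᵥ v) := by
  rw [← matJ_mulVec, ← matJ_mulVec, Matrix.mulVec_mulVec, matP_mul_matJ, Matrix.neg_mulVec,
    Matrix.mulVec_mulVec]

/-- A linear map carrying one Jordan chain to another with the same eigenvalue intertwines the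
two matrices on the chain. -/
theorem IsJordanChain.map_mulVec {n : Type} [Fintype n] {P P' : Matrix n n ℂ} {z : ℂ} {m : ℕ}
    {v v' : Fin m → n → ℂ} (h : IsJordanChain P z v) (h' : IsJordanChain P' z v')
    (f : (n → ℂ) →ₗ[ℂ] (n → ℂ)) (hf : ∀ k, f (v k) = v' k) (k : Fin m) :
    f (P *ᵥ v k) = P' *ᵥ v' k := by
  obtain ⟨k, hk⟩ := k
  cases k with
  | zero => rw [h.1 _ rfl, h'.1 _ rfl, map_smul, hf]
  | succ k =>
    rw [h.2 ⟨k, by omega⟩ _ rfl, h'.2 ⟨k, by omega⟩ _ rfl, map_add, map_smul, hf, hf]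

theorem mirror_add (v w : Fin 4 ⊕ Fin 4 → ℂ) : mirror (v + w) = mirror v + mirror w := by
  simp only [← matJ_mulVec, Matrix.mulVec_add]

theorem mirror_smul (c : ℂ) (v : Fin 4 ⊕ Fin 4 → ℂ) : mirror (c • v) = c • mirror v := by
  simp only [← matJ_mulVec, Matrix.mulVec_smul]

/-- States with the same block structure are orthogonally equivalent. -/
theorem exists_orthogonal_of_hasBlockStructure {ψ φ : State} {L : List PBlock}
    (h : HasBlockStructure (matP ψ) L) (h' : HasBlockStructure (matP φ) L) :
    ∃ O : Matrix (Fin 4 ⊕ Fin 4) (Fin 4 ⊕ Fin 4) ℂ,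
      Oᵀ * O = 1 ∧ O * matP ψ = matP φ * O ∧ O * matJ = matJ * O := by
  obtain ⟨u, w, hr, hli, hsp⟩ := h
  obtain ⟨u', w', hr', hli', hsp'⟩ := h'
  let e := Module.Basis.mk hli hsp.ge
  let e' := Module.Basis.mk hli' hsp'.ge
  let F := e.equiv e' (Equiv.refl _)
  have hF : ∀ x, F (e x) = e' x := fun x => by simp [F]
  have hu : ∀ i k, F (u i k) = u' i k := fun i k => by
    simpa [e, e'] using hF ⟨i, Sum.inl k⟩
  have hw : ∀ i k, F (w i k) = w' i k := fun i k => by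
    simpa [e, e'] using hF ⟨i, Sum.inr k⟩
  have key : ∀ i, (∀ k, F (matP ψ *ᵥ u i k) = matP φ *ᵥ u' i k ∧
        F (matJ *ᵥ u i k) = matJ *ᵥ u' i k) ∧
      (∀ k, F (matP ψ *ᵥ w i k) = matP φ *ᵥ w' i k ∧
        F (matJ *ᵥ w i k) = matJ *ᵥ w' i k) := by
    intro i
    have h1 := hr i
    have h2 := hr' i
    have hu1 := hu i
    have hw1 := hw i
    generalize u i = a at h1 hu1 ⊢
    generalize w i = b at h1 hw1 ⊢
    generalize u' i = a' at h2 hu1 ⊢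
    generalize w' i = b' at h2 hw1 ⊢
    generalize L.get i = B at *
    cases B with
    | pair m z =>
      change Fin m → Fin 4 ⊕ Fin 4 → ℂ at a b a' b'
      change ∀ k : Fin m, _ at hu1 hw1
      change (∀ k : Fin m, _) ∧ (∀ k : Fin m, _)
      obtain ⟨h1, h1'⟩ := h1
      obtain ⟨h2, h2'⟩ := h2
      have hP := fun k => h1.map_mulVec h2 F.toLinearMap hu1 k
      refine ⟨fun k => ⟨hP k, ?_⟩, fun k => ⟨?_, ?_⟩⟩
      · rw [matJ_mulVec, matJ_mulVec, ← h1', ← h2', hw1]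
      · rw [h1', h2', matP_mulVec_mirror, matP_mulVec_mirror]
        -- On the mirrored chain `F` is handled through its conjugate by the reflection, which
        -- carries the original chain `a` to `a'`.
        have hf : ∀ k, (Matrix.toLin' matJ ∘ₗ F.toLinearMap ∘ₗ Matrix.toLin' matJ) (a k) =
            a' k := by
          intro k
          simp only [LinearMap.comp_apply, Matrix.toLin'_apply, matJ_mulVec, LinearEquiv.coe_coe]
          rw [← h1', hw1, h2', mirror_mirror]
        have h3 := h1.map_mulVec h2 _ hf k
        simp only [LinearMap.comp_apply, Matrix.toLin'_apply, matJ_mulVec,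
            LinearEquiv.coe_coe] at h3
        rw [← h3, mirror_mirror, map_neg]
      · rw [matJ_mulVec, matJ_mulVec, h1', h2', mirror_mirror, mirror_mirror]
        exact hu1 k
    | degenerate h p q =>
      obtain ⟨h1, h1', h1a, h1b⟩ := h1
      obtain ⟨h2, h2', h2a, h2b⟩ := h2
      refine ⟨fun k => ⟨h1.map_mulVec h2 F.toLinearMap hu1 k, ?_⟩,
        fun k => ⟨h1'.map_mulVec h2' F.toLinearMap hw1 k, ?_⟩⟩
      · rw [matJ_mulVec, matJ_mulVec, mirror_of_inHalf (h1a k), mirror_of_inHalf (h2a k), map_smul,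
          hu1]
      · rw [matJ_mulVec, matJ_mulVec, mirror_of_inHalf (h1b k), mirror_of_inHalf (h2b k), map_smul,
          hw1]
  have toMat : ∀ {X X' : Matrix (Fin 4 ⊕ Fin 4) (Fin 4 ⊕ Fin 4) ℂ},
      (∀ x, F (X *ᵥ e x) = X' *ᵥ e' x) →
      LinearMap.toMatrix' F.toLinearMap * X = X' * LinearMap.toMatrix' F.toLinearMap := by
    intro X X' hX
    apply (Matrix.toLin' (R := ℂ)).injective
    rw [Matrix.toLin'_mul, Matrix.toLin'_mul, Matrix.toLin'_toMatrix']
    refine e.ext fun x => ?_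
    simp only [LinearMap.comp_apply, Matrix.toLin'_apply, LinearEquiv.coe_coe, hF]
    exact hX x
  refine exists_orthogonal_of_intertwines (D := LinearMap.toMatrix' F.toLinearMap)
    (matP_transpose ψ) (matP_transpose φ) matJ_transpose ?_ (toMat ?_) (toMat ?_)
  · rw [LinearMap.isUnit_toMatrix'_iff, Module.End.isUnit_iff]
    exact F.bijective
  · rintro ⟨i, k | k⟩
    · simpa [e, e'] using ((key i).1 k).1
    · simpa [e, e'] using ((key i).2 k).1
  · rintro ⟨i, k | k⟩
    · simpa [e, e'] using ((key i).1 k).2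
    · simpa [e, e'] using ((key i).2 k).2

/-! ### Isometries of the determinant form on `2 × 2` matrices -/

/-- The polarization of the determinant of `2 × 2` matrices. -/
def detForm (X Y : Matrix (Fin 2) (Fin 2) ℂ) : ℂ :=
  X 0 0 * Y 1 1 - X 0 1 * Y 1 0 - X 1 0 * Y 0 1 + X 1 1 * Y 0 0

theorem detForm_mul_mul (A B : Matrix.SpecialLinearGroup (Fin 2) ℂ)
    (X Y : Matrix (Fin 2) (Fin 2) ℂ) :
    detForm (A.1 * X * B.1ᵀ) (A.1 * Y * B.1ᵀ) = detForm X Y := by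
  have hA := A.2
  have hB := B.2
  rw [Matrix.det_fin_two] at hA hB
  have : detForm (A.1 * X * B.1ᵀ) (A.1 * Y * B.1ᵀ) =
      (A.1 0 0 * A.1 1 1 - A.1 0 1 * A.1 1 0) * (B.1 0 0 * B.1 1 1 - B.1 0 1 * B.1 1 0) *
        detForm X Y := by
    simp only [detForm, Matrix.mul_apply, Fin.sum_univ_two, Matrix.transpose_apply]
    ring
  rw [this, hA, hB, one_mul, one_mul]

/-- Every nonzero vector of `ℂ²` is moved to the first basis vector by `SL(2, ℂ)`. -/
theorem exists_SL_mul_eq (x y : ℂ) (h : x ≠ 0 ∨ y ≠ 0) :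
    ∃ A : Matrix.SpecialLinearGroup (Fin 2) ℂ,
      A.1 0 0 * x + A.1 0 1 * y = 1 ∧ A.1 1 0 * x + A.1 1 1 * y = 0 := by
  by_cases hx : x = 0
  · have hy : y ≠ 0 := h.resolve_left (by simpa using hx)
    refine ⟨⟨!![0, 1 / y; -y, 0], by simp [Matrix.det_fin_two, hy]⟩, ?_, ?_⟩ <;> simp [hx, hy]
  · refine ⟨⟨!![1 / x, 0; -y, x], by simp [Matrix.det_fin_two, hx]⟩, ?_, ?_⟩
    · simp [hx]
    · simp; ring

theorem exists_rank_one_factors {X : Matrix (Fin 2) (Fin 2) ℂ} (h : X.det = 0) :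
    ∃ p q : Fin 2 → ℂ, X = Matrix.vecMulVec p q := by
  rw [Matrix.det_fin_two] at h
  by_cases h0 : X 0 0 = 0
  · by_cases h1 : X 0 1 = 0
    · refine ⟨![0, 1], X 1, ?_⟩
      ext i j; fin_cases i <;> fin_cases j <;> simp [Matrix.vecMulVec_apply, h0, h1]
    · refine ⟨![X 0 1, X 1 1], ![X 0 0 / X 0 1, 1], ?_⟩
      have : X 1 0 = 0 := by simpa [h0, h1] using h
      ext i j; fin_cases i <;> fin_cases j <;> simp [Matrix.vecMulVec_apply, h0, this]
  · refine ⟨![X 0 0, X 1 0], ![1, X 0 1 / X 0 0], ?_⟩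
    ext i j; fin_cases i <;> fin_cases j <;> simp [Matrix.vecMulVec_apply]
    · field_simp
    · field_simp; linear_combination h

theorem exists_SL_mul_mul_eq_single {X : Matrix (Fin 2) (Fin 2) ℂ} (hX : X ≠ 0)
    (h : X.det = 0) : ∃ A B : Matrix.SpecialLinearGroup (Fin 2) ℂ,
      A.1 * X * B.1ᵀ = Matrix.single 0 0 1 := by
  obtain ⟨p, q, rfl⟩ := exists_rank_one_factors h
  have hp : p 0 ≠ 0 ∨ p 1 ≠ 0 := by
    by_contra! hp
    exact hX (by ext i j; fin_cases i <;> simp [Matrix.vecMulVec_apply, hp])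
  have hq : q 0 ≠ 0 ∨ q 1 ≠ 0 := by
    by_contra! hq
    exact hX (by ext i j; fin_cases j <;> simp [Matrix.vecMulVec_apply, hq])
  obtain ⟨A, hA0, hA1⟩ := exists_SL_mul_eq _ _ hp
  obtain ⟨B, hB0, hB1⟩ := exists_SL_mul_eq _ _ hq
  refine ⟨A, B, ?_⟩
  have : ∀ i j, (A.1 * Matrix.vecMulVec p q * B.1ᵀ) i j =
      (A.1 i 0 * p 0 + A.1 i 1 * p 1) * (B.1 j 0 * q 0 + B.1 j 1 * q 1) := by
    intro i j
    simp only [Matrix.mul_apply, Fin.sum_univ_two, Matrix.transpose_apply, Matrix.vecMulVec_apply]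
    ring
  ext i j
  rw [this]
  fin_cases i <;> fin_cases j <;> simp [hA0, hA1, hB0, hB1]

/-- The images of the matrix units under an isometry of the determinant form. -/
structure IsUnitsIsometric (C : Fin 2 → Fin 2 → Matrix (Fin 2) (Fin 2) ℂ) : Prop where
  form : ∀ i j k l, detForm (C i j) (C k l) =
    detForm (Matrix.single i j 1) (Matrix.single k l 1)

/-- The tuple `C` consists of the images of the matrix units under `X ↦ A X Bᵀ` or
`X ↦ A Xᵀ Bᵀ`, up to inversion of `A` and `B`. -/
def IsStandardizable (C : Fin 2 → Fin 2 → Matrix (Fin 2) (Fin 2) ℂ) : Prop :=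
  ∃ A B : Matrix.SpecialLinearGroup (Fin 2) ℂ,
    (∀ i j, A.1 * C i j * B.1ᵀ = Matrix.single i j 1) ∨
    (∀ i j, A.1 * C i j * B.1ᵀ = Matrix.single j i 1)

theorem IsUnitsIsometric.mul_mul {C : Fin 2 → Fin 2 → Matrix (Fin 2) (Fin 2) ℂ}
    (h : IsUnitsIsometric C) (A B : Matrix.SpecialLinearGroup (Fin 2) ℂ) :
    IsUnitsIsometric (fun i j => A.1 * C i j * B.1ᵀ) :=
  ⟨fun i j k l => by rw [detForm_mul_mul, h.form]⟩

theorem IsStandardizable.of_mul_mul {C : Fin 2 → Fin 2 → Matrix (Fin 2) (Fin 2) ℂ}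
    (A B : Matrix.SpecialLinearGroup (Fin 2) ℂ)
    (h : IsStandardizable (fun i j => A.1 * C i j * B.1ᵀ)) : IsStandardizable C := by
  obtain ⟨A', B', h⟩ := h
  have : ∀ X, (A' * A).1 * X * (B' * B).1ᵀ = A'.1 * (A.1 * X * B.1ᵀ) * B'.1ᵀ := by
    intro X
    simp only [Matrix.SpecialLinearGroup.coe_mul, Matrix.transpose_mul, Matrix.mul_assoc]
  exact ⟨A' * A, B' * B, by simpa only [this] using h⟩

theorem detForm_single (i j k l : Fin 2) :
    detForm (Matrix.single i j 1) (Matrix.single k l 1) =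
      if i ≠ k ∧ j ≠ l then (if i = j then 1 else -1) else 0 := by
  fin_cases i <;> fin_cases j <;> fin_cases k <;> fin_cases l <;> simp [detForm]

/-- The orthogonal complement of the two diagonal units consists of the off-diagonal matrices, a
hyperbolic plane with only two isotropic lines. The other two images lie on these lines, in one
order or the other, with reciprocal coefficients. The order decides whether a transposition occurs,
and the diagonal torus absorbs the coefficients. -/
theorem IsUnitsIsometric.isStandardizable_of_diagonal
    {C : Fin 2 → Fin 2 → Matrix (Fin 2) (Fin 2) ℂ} (h : IsUnitsIsometric C)
    (h0 : C 0 0 = Matrix.single 0 0 1) (h1 : C 1 1 = Matrix.single 1 1 1) :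
    IsStandardizable C := by
  have H : ∀ i j k l, detForm (C i j) (C k l) = _ :=
    fun i j k l => (h.form i j k l).trans (detForm_single i j k l)
  have e1 := H 0 1 0 0
  have e2 := H 0 1 1 1
  have e3 := H 1 0 0 0
  have e4 := H 1 0 1 1
  have e5 := H 0 1 0 1
  have e6 := H 1 0 1 0
  have e7 := H 0 1 1 0
  simp [detForm, h0, h1] at e1 e2 e3 e4 e5 e6 e7
  simp [e1, e2, e3, e4] at e5 e6 e7
  have scale : ∀ b : ℂ, b ≠ 0 → ∃ t : ℂ, t ≠ 0 ∧ t * t = b := fun b hb => by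
    obtain ⟨t, rfl⟩ := IsAlgClosed.exists_eq_mul_self b
    exact ⟨t, left_ne_zero_of_mul hb, rfl⟩
  rcases eq_or_ne (C 0 1 1 0) 0 with hc | hc
  · have e8 : C 0 1 0 1 * C 1 0 1 0 = 1 := by
      rw [hc] at e7; linear_combination -e7
    have hb := left_ne_zero_of_mul_eq_one e8
    have hb' := right_ne_zero_of_mul_eq_one e8
    have e9 : C 1 0 0 1 = 0 := by
      have : C 1 0 0 1 * C 1 0 1 0 = 0 := by linear_combination -e6 / 2
      exact (mul_eq_zero.1 this).resolve_right hb'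
    -- Multiplication by `diag(t, t⁻¹)` on the left and `diag(t⁻¹, t)` on the right fixes both
    -- diagonal units and rescales the off-diagonal ones by `t²` and `t⁻²`.
    obtain ⟨t, ht, htt⟩ := scale _ hb'
    refine ⟨⟨!![t, 0; 0, t⁻¹], by simp [Matrix.det_fin_two, ht]⟩,
      ⟨!![t⁻¹, 0; 0, t], by simp [Matrix.det_fin_two, ht]⟩, Or.inl fun i j => ?_⟩
    ext k l
    simp only [Matrix.mul_apply, Fin.sum_univ_two, Matrix.transpose_apply]
    fin_cases i <;> fin_cases j <;> fin_cases k <;> fin_cases l <;>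
      simp [h0, h1, e1, e2, e3, e4, e9, hc, ht]
    · rw [mul_right_comm, htt, mul_comm]; exact e8
    · rw [← htt]; field_simp
  · have hb : C 0 1 0 1 = 0 := by
      have : C 0 1 0 1 * C 0 1 1 0 = 0 := by linear_combination -e5 / 2
      exact (mul_eq_zero.1 this).resolve_right hc
    have e8 : C 0 1 1 0 * C 1 0 0 1 = 1 := by
      rw [hb] at e7; linear_combination -e7
    have e9 : C 1 0 1 0 = 0 := by
      have : C 1 0 0 1 * C 1 0 1 0 = 0 := by linear_combination -e6 / 2
      exact (mul_eq_zero.1 this).resolve_left (right_ne_zero_of_mul_eq_one e8)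
    obtain ⟨t, ht, htt⟩ := scale _ hc
    refine ⟨⟨!![t, 0; 0, t⁻¹], by simp [Matrix.det_fin_two, ht]⟩,
      ⟨!![t⁻¹, 0; 0, t], by simp [Matrix.det_fin_two, ht]⟩, Or.inr fun i j => ?_⟩
    ext k l
    simp only [Matrix.mul_apply, Fin.sum_univ_two, Matrix.transpose_apply]
    fin_cases i <;> fin_cases j <;> fin_cases k <;> fin_cases l <;>
      simp [h0, h1, e1, e2, e3, e4, e9, hb, ht]
    · rw [← htt]; field_simp
    · rw [mul_right_comm, htt]; exact e8

/-- The image of the first unit is nonzero and isotropic, hence of rank one, and can be moved to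
that unit. The image of the last unit then has lower right entry `1` and determinant `0`, so upper
unitriangular factors, which keep the first unit, clear its remaining entries. This reduces to the
case of fixed diagonal units. -/
theorem IsUnitsIsometric.isStandardizable {C : Fin 2 → Fin 2 → Matrix (Fin 2) (Fin 2) ℂ}
    (h : IsUnitsIsometric C) : IsStandardizable C := by
  have H : ∀ {C : Fin 2 → Fin 2 → Matrix (Fin 2) (Fin 2) ℂ}, IsUnitsIsometric C →
      ∀ i j k l, detForm (C i j) (C k l) = _ :=
    fun h i j k l => (h.form i j k l).trans (detForm_single i j k l)
  have hne : C 0 0 ≠ 0 := by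
    intro h0
    have := H h 0 0 1 1
    simp [h0, detForm] at this
  have hdet : (C 0 0).det = 0 := by
    have := H h 0 0 0 0
    simp [detForm] at this
    rw [Matrix.det_fin_two]
    linear_combination this / 2
  obtain ⟨A, B, hAB⟩ := exists_SL_mul_mul_eq_single hne hdet
  apply IsStandardizable.of_mul_mul A B
  replace h := h.mul_mul A B
  generalize hD : (fun i j => A.1 * C i j * B.1ᵀ) = D at h ⊢
  have hD0 : D 0 0 = Matrix.single 0 0 1 := by rw [← hD]; exact hAB
  have e1 := H h 0 0 1 1
  have e2 := H h 1 1 1 1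
  simp [detForm, hD0] at e1 e2
  rw [e1] at e2
  refine IsStandardizable.of_mul_mul ⟨!![1, -D 1 1 0 1; 0, 1], by simp [Matrix.det_fin_two]⟩
    ⟨!![1, -D 1 1 1 0; 0, 1], by simp [Matrix.det_fin_two]⟩
    ((h.mul_mul _ _).isStandardizable_of_diagonal ?_ ?_)
  · ext i j
    simp only [Matrix.mul_apply, Fin.sum_univ_two, Matrix.transpose_apply]
    fin_cases i <;> fin_cases j <;> simp [hD0]
  · ext i j
    simp only [Matrix.mul_apply, Fin.sum_univ_two, Matrix.transpose_apply]
    fin_cases i <;> fin_cases j <;> simp [e1]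
    linear_combination e2 / 2

/-! ### The magic basis -/

/-- The spin flip `ε ⊗ ε`, the Gram matrix of the determinant form. -/
def spinFlip : Matrix (Fin 4) (Fin 4) ℂ :=
  !![0, 0, 0, 1; 0, 0, -1, 0; 0, -1, 0, 0; 1, 0, 0, 0]

theorem spinFlip_mul_spinFlip : spinFlip * spinFlip = 1 := by
  ext i j
  fin_cases i <;> fin_cases j <;> simp [spinFlip, Matrix.mul_apply, Fin.sum_univ_four]

theorem spinFlip_transpose : spinFlipᵀ = spinFlip := by
  ext i j
  fin_cases i <;> fin_cases j <;> simp [spinFlip]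

theorem inv_sqrt_two_mul_self :
    ((1 / Real.sqrt 2 : ℝ) : ℂ) * ((1 / Real.sqrt 2 : ℝ) : ℂ) = 1 / 2 := by
  rw [← Complex.ofReal_mul, div_mul_div_comm, Real.mul_self_sqrt (by norm_num)]
  norm_num

/-- The point of the magic basis: it identifies the spin flip form with the dot product, so
conjugation by `magicT` identifies the isometries of the two. -/
theorem magicT_transpose_mul : magicTᵀ * magicT = spinFlip := by
  rw [magicT, Matrix.transpose_smul, Matrix.smul_mul, Matrix.mul_smul, smul_smul,
    inv_sqrt_two_mul_self]
  ext i j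
  fin_cases i <;> fin_cases j <;>
    simp [spinFlip, Matrix.mul_apply, Fin.sum_univ_four] <;> norm_num

theorem magicT_conjTranspose_transpose : (magicTᴴ)ᵀ = magicT * spinFlip := by
  rw [magicT, Matrix.conjTranspose_smul, Matrix.transpose_smul, Matrix.smul_mul, Complex.star_def,
    Complex.conj_ofReal]
  congr 1
  ext i j
  fin_cases i <;> fin_cases j <;> simp [spinFlip, Matrix.mul_apply, Fin.sum_univ_four]

theorem magicT_mul_spinFlip_mul : magicT * spinFlip * magicTᵀ = 1 := by
  rw [Matrix.mul_assoc, mul_eq_one_comm, Matrix.mul_assoc, magicT_transpose_mul,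
    spinFlip_mul_spinFlip]

theorem magicT_conjTranspose : magicTᴴ = spinFlip * magicTᵀ := by
  rw [← Matrix.transpose_transpose magicTᴴ, magicT_conjTranspose_transpose, Matrix.transpose_mul,
    spinFlip_transpose]

theorem magicT_mul_conjTranspose : magicT * magicTᴴ = 1 := by
  rw [magicT_conjTranspose, ← Matrix.mul_assoc, magicT_mul_spinFlip_mul]

theorem conjTranspose_mul_magicT : magicTᴴ * magicT = 1 :=
  mul_eq_one_comm.1 magicT_mul_conjTranspose

/-! ### Graded similarity -/

/-- Similarity through a matrix that preserves both halves of `ℂ⁴ ⊕ ℂ⁴`. -/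
def GradedSimilar (P P' : Matrix (Fin 4 ⊕ Fin 4) (Fin 4 ⊕ Fin 4) ℂ) : Prop :=
  ∃ D : Matrix (Fin 4 ⊕ Fin 4) (Fin 4 ⊕ Fin 4) ℂ, IsUnit D ∧ D * P = P' * D ∧ D * matJ = matJ * D

theorem GradedSimilar.symm {P P' : Matrix (Fin 4 ⊕ Fin 4) (Fin 4 ⊕ Fin 4) ℂ}
    (h : GradedSimilar P P') : GradedSimilar P' P := by
  obtain ⟨D, hD, h1, h2⟩ := h
  have hd : IsUnit D.det := (Matrix.isUnit_iff_isUnit_det _).1 hD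
  have key : ∀ {X X' : Matrix (Fin 4 ⊕ Fin 4) (Fin 4 ⊕ Fin 4) ℂ}, D * X = X' * D →
      D⁻¹ * X' = X * D⁻¹ := by
    intro X X' h
    calc D⁻¹ * X' = D⁻¹ * (X' * D) * D⁻¹ := by
          rw [Matrix.mul_assoc, Matrix.mul_assoc, Matrix.mul_nonsing_inv _ hd, Matrix.mul_one]
      _ = X * D⁻¹ := by
          rw [← h, ← Matrix.mul_assoc, Matrix.nonsing_inv_mul _ hd, Matrix.one_mul]
  exact ⟨D⁻¹, (Matrix.isUnit_nonsing_inv_iff).2 hD, key h1, key h2⟩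

theorem GradedSimilar.trans {P P' P'' : Matrix (Fin 4 ⊕ Fin 4) (Fin 4 ⊕ Fin 4) ℂ}
    (h : GradedSimilar P P') (h' : GradedSimilar P' P'') : GradedSimilar P P'' := by
  obtain ⟨D, hD, h1, h2⟩ := h
  obtain ⟨D', hD', h1', h2'⟩ := h'
  refine ⟨D' * D, hD'.mul hD, ?_, ?_⟩
  · rw [Matrix.mul_assoc, h1, ← Matrix.mul_assoc, h1', Matrix.mul_assoc]
  · rw [Matrix.mul_assoc, h2, ← Matrix.mul_assoc, h2', Matrix.mul_assoc]

theorem GradedSimilar.charpoly_eq {P P' : Matrix (Fin 4 ⊕ Fin 4) (Fin 4 ⊕ Fin 4) ℂ}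
    (h : GradedSimilar P P') : P.charpoly = P'.charpoly := by
  obtain ⟨D, ⟨U, rfl⟩, h1, -⟩ := h
  have : P' = U * P * (U⁻¹ : (Matrix (Fin 4 ⊕ Fin 4) (Fin 4 ⊕ Fin 4) ℂ)ˣ) := by
    rw [h1, Matrix.mul_assoc, Units.mul_inv, Matrix.mul_one]
  rw [this, Matrix.coe_units_inv, Matrix.charpoly_units_conj]

/-- The block matrix `[[0, M], [M', 0]]` with `M'` the adjoint of `M` for the determinant form. -/
def flipP (M : Matrix (Fin 4) (Fin 4) ℂ) : Matrix (Fin 4 ⊕ Fin 4) (Fin 4 ⊕ Fin 4) ℂ :=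
  Matrix.fromBlocks 0 M (spinFlip * Mᵀ * spinFlip) 0

theorem isUnit_fromBlocks_diagonal {X Y X' Y' : Matrix (Fin 4) (Fin 4) ℂ} (hX : X * X' = 1)
    (hY : Y * Y' = 1) : IsUnit (Matrix.fromBlocks X 0 0 Y) := by
  refine IsUnit.of_mul_eq_one (Matrix.fromBlocks X' 0 0 Y') ?_
  simp [Matrix.fromBlocks_multiply, hX, hY]

theorem fromBlocks_diagonal_mul_matJ (X Y : Matrix (Fin 4) (Fin 4) ℂ) :
    Matrix.fromBlocks X 0 0 Y * matJ = matJ * Matrix.fromBlocks X 0 0 Y := by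
  simp [matJ, Matrix.fromBlocks_multiply]

/-- Thanks to this similarity, explicit block structures and spectra can be computed in the
computational basis, without the entries of `magicT`. -/
theorem gradedSimilar_flipP_matP (ψ : State) : GradedSimilar (flipP (stateMatrix ψ)) (matP ψ) := by
  refine ⟨Matrix.fromBlocks magicT 0 0 magicT, isUnit_fromBlocks_diagonal magicT_mul_conjTranspose
    magicT_mul_conjTranspose, ?_, fromBlocks_diagonal_mul_matJ _ _⟩
  have h1 : matR ψ * magicT = magicT * stateMatrix ψ := by
    rw [matR, Matrix.mul_assoc, conjTranspose_mul_magicT, Matrix.mul_one]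
  have h2 : (matR ψ)ᵀ * magicT = magicT * (spinFlip * (stateMatrix ψ)ᵀ * spinFlip) := by
    rw [matR, Matrix.transpose_mul, Matrix.transpose_mul, magicT_conjTranspose_transpose]
    simp only [Matrix.mul_assoc, magicT_transpose_mul]
  rw [flipP, matP, Matrix.fromBlocks_multiply, Matrix.fromBlocks_multiply]
  simp [h1, h2]

/-! ### Local operations as matrices -/

/-- The Kronecker product of two `2 × 2` matrices, in lexicographic order. -/
def kron (A B : Matrix (Fin 2) (Fin 2) ℂ) : Matrix (Fin 4) (Fin 4) ℂ :=
  Matrix.reindex finProdFinEquiv finProdFinEquiv (Matrix.kroneckerMap (· * ·) A B)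

theorem kron_apply (A B : Matrix (Fin 2) (Fin 2) ℂ) (i j k l : Fin 2) :
    kron A B (finProdFinEquiv (i, j)) (finProdFinEquiv (k, l)) = A i k * B j l := by
  simp [kron]

theorem stateMatrix_apply (ψ : State) (i j k l : Fin 2) :
    stateMatrix ψ (finProdFinEquiv (i, j)) (finProdFinEquiv (k, l)) = ψ ![i, j, k, l] := by
  simp [stateMatrix]

theorem sum_fin_four_eq (f : Fin 4 → ℂ) :
    ∑ i, f i = ∑ a : Fin 2, ∑ b : Fin 2, f (finProdFinEquiv (a, b)) :=
  (Equiv.sum_comp (finProdFinEquiv (m := 2) (n := 2)) f).symm.trans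
    (Fintype.sum_prod_type _)

theorem matrix_fin_four_ext {M N : Matrix (Fin 4) (Fin 4) ℂ}
    (h : ∀ i j k l : Fin 2, M (finProdFinEquiv (i, j)) (finProdFinEquiv (k, l)) =
      N (finProdFinEquiv (i, j)) (finProdFinEquiv (k, l))) : M = N := by
  ext r c
  obtain ⟨⟨i, j⟩, rfl⟩ := (finProdFinEquiv (m := 2) (n := 2)).surjective r
  obtain ⟨⟨k, l⟩, rfl⟩ := (finProdFinEquiv (m := 2) (n := 2)).surjective c
  exact h i j k l

theorem eq_vec_four (x : Fin 4 → Fin 2) : x = ![x 0, x 1, x 2, x 3] := by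
  ext i; fin_cases i <;> rfl

theorem stateMatrix_injective : Function.Injective stateMatrix := by
  intro ψ φ h
  funext x
  rw [eq_vec_four x, ← stateMatrix_apply ψ, h, stateMatrix_apply]

theorem sum_qubits_eq (f : (Fin 4 → Fin 2) → ℂ) :
    ∑ y, f y = ∑ a : Fin 2, ∑ b : Fin 2, ∑ c : Fin 2, ∑ d : Fin 2, f ![a, b, c, d] := by
  let e : Fin 2 × Fin 2 × Fin 2 × Fin 2 ≃ (Fin 4 → Fin 2) :=
    { toFun := fun p => ![p.1, p.2.1, p.2.2.1, p.2.2.2]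
      invFun := fun y => (y 0, y 1, y 2, y 3)
      left_inv := fun _ => rfl
      right_inv := fun y => (eq_vec_four y).symm }
  rw [← Equiv.sum_comp e f]
  simp only [Fintype.sum_prod_type]
  rfl

theorem stateMatrix_slocc (A : Fin 4 → Matrix.SpecialLinearGroup (Fin 2) ℂ) (ψ : State) :
    stateMatrix (slocc A ψ) = kron (A 0).1 (A 1).1 * stateMatrix ψ * (kron (A 2).1 (A 3).1)ᵀ := by
  refine matrix_fin_four_ext fun i j k l => ?_
  rw [stateMatrix_apply, slocc, sum_qubits_eq]
  simp only [Matrix.mul_apply, sum_fin_four_eq, Matrix.transpose_apply, kron_apply,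
    stateMatrix_apply, Fin.prod_univ_four, Fin.sum_univ_two]
  simp
  ring

/-- The spin flip is `ε ⊗ ε` for the area form `ε` of `ℂ²`, and `Aᵀ ε A = det A • ε`. -/
theorem kron_transpose_mul_spinFlip_mul (A B : Matrix.SpecialLinearGroup (Fin 2) ℂ) :
    (kron A.1 B.1)ᵀ * spinFlip * kron A.1 B.1 = spinFlip := by
  have hA := A.2
  have hB := B.2
  rw [Matrix.det_fin_two] at hA hB
  have hdet : ∀ C : Matrix (Fin 2) (Fin 2) ℂ, C 0 0 * C 1 1 - C 0 1 * C 1 0 = 1 → ∀ i k,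
      C 0 i * C 1 k - C 1 i * C 0 k = !![0, 1; -1, 0] i k := by
    intro C hC i k
    fin_cases i <;> fin_cases k <;> simp
    · ring
    · linear_combination hC
    · linear_combination -hC
    · ring
  refine matrix_fin_four_ext fun i j k l => ?_
  trans (A.1 0 i * A.1 1 k - A.1 1 i * A.1 0 k) * (B.1 0 j * B.1 1 l - B.1 1 j * B.1 0 l)
  · simp only [Matrix.mul_apply, sum_fin_four_eq, Matrix.transpose_apply, kron_apply,
      Fin.sum_univ_two]
    simp [spinFlip, finProdFinEquiv]
    ring
  · rw [hdet _ hA, hdet _ hB]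
    fin_cases i <;> fin_cases j <;> fin_cases k <;> fin_cases l <;> simp [spinFlip, finProdFinEquiv]

/-! ### Equivalence of states -/

/-- Equivalence under qubit permutations and determinant-one SLOCC operations. -/
def Equivalent (ψ φ : State) : Prop :=
  ∃ (σ : Equiv.Perm (Fin 4)) (A : Fin 4 → Matrix.SpecialLinearGroup (Fin 2) ℂ),
    slocc A (permuteQubits σ ψ) = φ

theorem slocc_one (ψ : State) : slocc 1 ψ = ψ := by
  funext x
  rw [slocc, Finset.sum_eq_single x]
  · simp
  · intro y _ hy
    obtain ⟨k, hk⟩ := Function.ne_iff.1 hy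
    rw [Finset.prod_eq_zero (Finset.mem_univ k), zero_mul]
    simp [hk.symm]
  · simp

theorem slocc_slocc (A B : Fin 4 → Matrix.SpecialLinearGroup (Fin 2) ℂ) (ψ : State) :
    slocc A (slocc B ψ) = slocc (A * B) ψ := by
  funext x
  simp only [slocc, Finset.mul_sum]
  rw [Finset.sum_comm]
  refine Finset.sum_congr rfl fun z _ => ?_
  simp only [← mul_assoc, ← Finset.sum_mul, ← Finset.prod_mul_distrib]
  congr 1
  simp only [Pi.mul_apply, Matrix.SpecialLinearGroup.coe_mul, Matrix.mul_apply]
  rw [Finset.prod_univ_sum]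
  simp [Fintype.piFinset_univ]

theorem permuteQubits_permuteQubits (σ τ : Equiv.Perm (Fin 4)) (ψ : State) :
    permuteQubits σ (permuteQubits τ ψ) = permuteQubits (σ * τ) ψ := rfl

/-- Permutations normalize the group of local operations by relabelling its factors; this makes
`Equivalent` symmetric and transitive. -/
theorem permuteQubits_slocc (σ : Equiv.Perm (Fin 4))
    (A : Fin 4 → Matrix.SpecialLinearGroup (Fin 2) ℂ) (ψ : State) :
    permuteQubits σ (slocc A ψ) = slocc (A ∘ σ.symm) (permuteQubits σ ψ) := by
  funext x
  simp only [permuteQubits, slocc]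
  refine Fintype.sum_equiv (Equiv.arrowCongr σ (Equiv.refl _)) _ _ fun y => ?_
  congr 1
  · refine Fintype.prod_equiv σ _ _ fun k => ?_
    simp [Equiv.arrowCongr]
  · congr 1
    funext k
    simp [Equiv.arrowCongr]

theorem Equivalent.refl (ψ : State) : Equivalent ψ ψ := ⟨1, 1, slocc_one _⟩

theorem equivalent_permuteQubits (σ : Equiv.Perm (Fin 4)) (ψ : State) :
    Equivalent ψ (permuteQubits σ ψ) := ⟨σ, 1, slocc_one _⟩

theorem Equivalent.trans {ψ φ χ : State} (h : Equivalent ψ φ) (h' : Equivalent φ χ) :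
    Equivalent ψ χ := by
  obtain ⟨σ, A, rfl⟩ := h
  obtain ⟨τ, B, rfl⟩ := h'
  exact ⟨τ * σ, B * (A ∘ τ.symm), by
    rw [permuteQubits_slocc, slocc_slocc, permuteQubits_permuteQubits]⟩

theorem Equivalent.symm {ψ φ : State} (h : Equivalent ψ φ) : Equivalent φ ψ := by
  obtain ⟨σ, A, rfl⟩ := h
  refine ⟨σ⁻¹, A⁻¹ ∘ σ, ?_⟩
  rw [permuteQubits_slocc, slocc_slocc, permuteQubits_permuteQubits, inv_mul_cancel]
  have : (A⁻¹ ∘ σ) * (A ∘ (σ⁻¹).symm) = 1 := by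
    funext k
    simp [Equiv.Perm.inv_def]
  rw [this, slocc_one]
  rfl

/-! ### Isometries of the spin flip form -/

/-- The matrix exchanging the two qubits of a pair. -/
def swapMatrix : Matrix (Fin 4) (Fin 4) ℂ :=
  Matrix.reindex finProdFinEquiv finProdFinEquiv
    (Matrix.of fun r c : Fin 2 × Fin 2 => if r.1 = c.2 ∧ r.2 = c.1 then 1 else 0)

theorem swapMatrix_apply (i j k l : Fin 2) :
    swapMatrix (finProdFinEquiv (i, j)) (finProdFinEquiv (k, l)) =
      if i = l ∧ j = k then 1 else 0 := by
  simp [swapMatrix]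

theorem spinFlip_apply (i j k l : Fin 2) :
    spinFlip (finProdFinEquiv (i, j)) (finProdFinEquiv (k, l)) =
      detForm (Matrix.single i j 1) (Matrix.single k l 1) := by
  rw [detForm_single]
  fin_cases i <;> fin_cases j <;> fin_cases k <;> fin_cases l <;> simp [spinFlip, finProdFinEquiv]

/-- The orthogonal group in dimension four comes from local operations and the exchange of two
qubits. -/
theorem exists_eq_kron_or_kron_mul_swapMatrix {m : Matrix (Fin 4) (Fin 4) ℂ}
    (h : mᵀ * spinFlip * m = spinFlip) : ∃ A B : Matrix.SpecialLinearGroup (Fin 2) ℂ,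
      m = kron A.1 B.1 ∨ m = kron A.1 B.1 * swapMatrix := by
  -- The columns of `m`, read as `2 × 2` matrices, are the images of the matrix units under the
  -- isometry.
  have hC : IsUnitsIsometric (fun i j => Matrix.of fun p q =>
      m (finProdFinEquiv (p, q)) (finProdFinEquiv (i, j))) := by
    refine ⟨fun i j k l => ?_⟩
    rw [← spinFlip_apply, ← h]
    simp only [Matrix.mul_apply, sum_fin_four_eq, Matrix.transpose_apply, Fin.sum_univ_two, detForm,
      Matrix.of_apply]
    simp [spinFlip, finProdFinEquiv]
    ring
  obtain ⟨A, B, hAB⟩ := hC.isStandardizable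
  have hinv : ∀ X Y : Matrix (Fin 2) (Fin 2) ℂ, A.1 * X * B.1ᵀ = Y →
      X = (A⁻¹).1 * Y * (B⁻¹).1ᵀ := by
    rintro X Y rfl
    have hA : (A⁻¹).1 * A.1 = 1 := by
      rw [← Matrix.SpecialLinearGroup.coe_mul, inv_mul_cancel, Matrix.SpecialLinearGroup.coe_one]
    have hB : B.1ᵀ * (B⁻¹).1ᵀ = 1 := by
      rw [← Matrix.transpose_mul, ← Matrix.SpecialLinearGroup.coe_mul, inv_mul_cancel,
        Matrix.SpecialLinearGroup.coe_one, Matrix.transpose_one]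
    rw [Matrix.mul_assoc, Matrix.mul_assoc, Matrix.mul_assoc, hB, Matrix.mul_one,
        ← Matrix.mul_assoc,
      hA, Matrix.one_mul]
  generalize A⁻¹ = A' at hinv
  generalize B⁻¹ = B' at hinv
  refine ⟨A', B', hAB.imp (fun hAB => ?_) (fun hAB => ?_)⟩ <;>
    refine matrix_fin_four_ext fun i j k l => ?_
  · have := congrFun (congrFun (hinv _ _ (hAB k l)) i) j
    beta_reduce at this
    rw [Matrix.of_apply] at this
    rw [this, kron_apply]
    simp [Matrix.mul_apply, Matrix.single_apply, ite_and]
  · have := congrFun (congrFun (hinv _ _ (hAB k l)) i) j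
    beta_reduce at this
    rw [Matrix.of_apply] at this
    rw [this]
    simp only [Matrix.mul_apply, sum_fin_four_eq, kron_apply, swapMatrix_apply]
    simp [Matrix.single_apply, ite_and]

theorem swapMatrix_mul_stateMatrix (ψ : State) :
    swapMatrix * stateMatrix ψ = stateMatrix (permuteQubits (Equiv.swap 0 1) ψ) := by
  refine matrix_fin_four_ext fun i j k l => ?_
  simp only [Matrix.mul_apply, sum_fin_four_eq, swapMatrix_apply, stateMatrix_apply, permuteQubits]
  simp [ite_and]

theorem stateMatrix_mul_swapMatrix_transpose (ψ : State) :
    stateMatrix ψ * swapMatrixᵀ = stateMatrix (permuteQubits (Equiv.swap 2 3) ψ) := by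
  refine matrix_fin_four_ext fun i j k l => ?_
  simp only [Matrix.mul_apply, sum_fin_four_eq, swapMatrix_apply, stateMatrix_apply, permuteQubits,
    Matrix.transpose_apply]
  simp [ite_and]
  congr 1
  funext x
  fin_cases x <;> rfl

/-- An isometry on either side is a local operation, possibly after a qubit exchange within its
pair; the exchange acts on the state as the transposition of qubits 0 and 1 on the left, of 2 and 3
on the right. -/
theorem equivalent_of_stateMatrix_eq {ψ φ : State} {m n : Matrix (Fin 4) (Fin 4) ℂ}
    (hm : mᵀ * spinFlip * m = spinFlip) (hn : nᵀ * spinFlip * n = spinFlip)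
    (h : stateMatrix φ = m * stateMatrix ψ * nᵀ) : Equivalent ψ φ := by
  obtain ⟨A, B, hAB⟩ := exists_eq_kron_or_kron_mul_swapMatrix hm
  obtain ⟨C, D, hCD⟩ := exists_eq_kron_or_kron_mul_swapMatrix hn
  have key : ∀ χ, stateMatrix φ = kron A.1 B.1 * stateMatrix χ * (kron C.1 D.1)ᵀ →
      Equivalent χ φ := by
    intro χ hχ
    refine ⟨1, ![A, B, C, D], stateMatrix_injective ?_⟩
    rw [stateMatrix_slocc, hχ]
    rfl
  rcases hAB with rfl | rfl <;> rcases hCD with rfl | rfl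
  · exact key ψ h
  · refine (equivalent_permuteQubits (Equiv.swap 2 3) ψ).trans (key _ ?_)
    rw [h, ← stateMatrix_mul_swapMatrix_transpose, Matrix.transpose_mul]
    simp only [Matrix.mul_assoc]
  · refine (equivalent_permuteQubits (Equiv.swap 0 1) ψ).trans (key _ ?_)
    rw [h, ← swapMatrix_mul_stateMatrix]
    simp only [Matrix.mul_assoc]
  · refine ((equivalent_permuteQubits (Equiv.swap 0 1) ψ).trans
      (equivalent_permuteQubits (Equiv.swap 2 3) _)).trans (key _ ?_)
    rw [h, ← stateMatrix_mul_swapMatrix_transpose, ← swapMatrix_mul_stateMatrix,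
      Matrix.transpose_mul]
    simp only [Matrix.mul_assoc]

/-- States with the same block structure are equivalent. -/
theorem equivalent_of_hasBlockStructure {ψ φ : State} {L : List PBlock}
    (h : HasBlockStructure (matP ψ) L) (h' : HasBlockStructure (matP φ) L) : Equivalent ψ φ := by
  obtain ⟨O, hO, hP, hJ⟩ := exists_orthogonal_of_hasBlockStructure h h'
  -- Commuting with `matJ` makes the off-diagonal blocks their own negatives, so only two orthogonal
  -- diagonal blocks remain.
  obtain ⟨O₁, X, Y, O₂, rfl⟩ : ∃ a b c d, O = Matrix.fromBlocks a b c d :=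
    ⟨_, _, _, _, (Matrix.fromBlocks_toBlocks O).symm⟩
  simp only [matJ, Matrix.fromBlocks_multiply, Matrix.mul_one, Matrix.mul_zero, add_zero, zero_add,
    Matrix.one_mul, Matrix.zero_mul, Matrix.mul_neg, Matrix.neg_mul, Matrix.fromBlocks_inj] at hJ
  obtain ⟨-, hX, hY, -⟩ := hJ
  have hX0 : X = 0 := by
    ext i j
    have := congrFun (congrFun hX i) j
    simp only [Matrix.neg_apply] at this
    exact self_eq_neg.1 this.symm
  have hY0 : Y = 0 := by
    ext i j
    have := congrFun (congrFun hY i) j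
    simp only [Matrix.neg_apply] at this
    exact self_eq_neg.1 this
  subst hX0 hY0
  rw [← Matrix.fromBlocks_one] at hO
  simp only [matP, Matrix.fromBlocks_transpose, Matrix.fromBlocks_multiply, Matrix.mul_zero,
    add_zero, zero_add, Matrix.zero_mul, Matrix.transpose_zero, Matrix.fromBlocks_inj] at hO hP
  obtain ⟨h1, -, -, h2⟩ := hO
  obtain ⟨-, h3, -, -⟩ := hP
  have h2' : O₂ * O₂ᵀ = 1 := mul_eq_one_comm.1 h2
  -- Undoing the magic basis in `R' = O₁ R O₂ᵀ` dictates both factors: `nᵀ` has to be `T† O₂ᵀ T`.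
  refine equivalent_of_stateMatrix_eq (m := magicTᴴ * O₁ * magicT)
    (n := magicTᵀ * O₂ * (magicTᴴ)ᵀ) ?_ ?_ ?_
  · simp only [Matrix.transpose_mul, magicT_conjTranspose, Matrix.transpose_transpose,
      spinFlip_transpose]
    calc _ = magicTᵀ * O₁ᵀ * (magicT * (spinFlip * spinFlip) * spinFlip * magicTᵀ) * O₁ * magicT := by
          simp only [Matrix.mul_assoc]
      _ = magicTᵀ * (O₁ᵀ * O₁) * magicT := by
          rw [spinFlip_mul_spinFlip, Matrix.mul_one, magicT_mul_spinFlip_mul, Matrix.mul_one]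
          simp only [Matrix.mul_assoc]
      _ = spinFlip := by rw [h1, Matrix.mul_one, magicT_transpose_mul]
  · simp only [Matrix.transpose_mul, magicT_conjTranspose_transpose, Matrix.transpose_transpose,
      spinFlip_transpose]
    calc _ = spinFlip * magicTᵀ * O₂ᵀ * (magicT * spinFlip * magicTᵀ) * O₂ * magicT * spinFlip := by
          simp only [Matrix.mul_assoc]
      _ = spinFlip * magicTᵀ * (O₂ᵀ * O₂) * magicT * spinFlip := by
          rw [magicT_mul_spinFlip_mul, Matrix.mul_one]
          simp only [Matrix.mul_assoc]
      _ = spinFlip := by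
          rw [h2, Matrix.mul_one, Matrix.mul_assoc spinFlip, magicT_transpose_mul,
            spinFlip_mul_spinFlip, Matrix.one_mul]
  · have hφ : matR φ = O₁ * matR ψ * O₂ᵀ := by
      rw [h3, Matrix.mul_assoc, h2', Matrix.mul_one]
    calc stateMatrix φ = magicTᴴ * matR φ * magicT := by
          rw [matR]
          simp only [← Matrix.mul_assoc, conjTranspose_mul_magicT, Matrix.one_mul]
          rw [Matrix.mul_assoc, conjTranspose_mul_magicT, Matrix.mul_one]
      _ = _ := by
          rw [hφ, matR]
          simp only [Matrix.transpose_mul, Matrix.transpose_transpose, Matrix.mul_assoc]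

/-! ### Invariance of `P` and of its block structure under local operations. -/

/-- The converse direction: the spectrum and the blocks found for a family state are also those of
the permuted state that local operations bring to it. -/
theorem gradedSimilar_slocc (A : Fin 4 → Matrix.SpecialLinearGroup (Fin 2) ℂ) (ψ : State) :
    GradedSimilar (matP ψ) (matP (slocc A ψ)) := by
  refine ((gradedSimilar_flipP_matP ψ).symm.trans ?_).trans (gradedSimilar_flipP_matP _)
  set m := kron (A 0).1 (A 1).1
  set n := kron (A 2).1 (A 3).1
  have hm : mᵀ * spinFlip * m = spinFlip := kron_transpose_mul_spinFlip_mul _ _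
  have hn : nᵀ * spinFlip * n = spinFlip := kron_transpose_mul_spinFlip_mul _ _
  have inv : ∀ {k : Matrix (Fin 4) (Fin 4) ℂ}, kᵀ * spinFlip * k = spinFlip →
      k * (spinFlip * kᵀ * spinFlip) = 1 := by
    intro k hk
    rw [mul_eq_one_comm]
    simp only [Matrix.mul_assoc] at hk ⊢
    rw [hk, spinFlip_mul_spinFlip]
  -- The coordinate matrix becomes `m M nᵀ`, so the second half must be transformed by the inverse
  -- of `nᵀ`, which is `spinFlip * n * spinFlip`.
  refine ⟨Matrix.fromBlocks m 0 0 (spinFlip * n * spinFlip),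
    isUnit_fromBlocks_diagonal (inv hm) (Y' := nᵀ) ?_, ?_, fromBlocks_diagonal_mul_matJ _ _⟩
  · have := inv hn
    calc _ = spinFlip * (n * (spinFlip * nᵀ * spinFlip)) * spinFlip := by
          simp only [Matrix.mul_assoc, spinFlip_mul_spinFlip, Matrix.mul_one]
      _ = 1 := by rw [this, Matrix.mul_one, spinFlip_mul_spinFlip]
  · rw [flipP, flipP, stateMatrix_slocc, Matrix.fromBlocks_multiply, Matrix.fromBlocks_multiply]
    simp only [Matrix.mul_zero, add_zero, zero_add, Matrix.zero_mul, Matrix.transpose_mul,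
      Matrix.transpose_transpose]
    congr 1
    · have : nᵀ * (spinFlip * n * spinFlip) = 1 := by
        rw [← Matrix.mul_assoc, ← Matrix.mul_assoc, hn, spinFlip_mul_spinFlip]
      rw [Matrix.mul_assoc, this, Matrix.mul_one]
    · calc _ = spinFlip * n * (spinFlip * spinFlip) * (stateMatrix ψ)ᵀ * spinFlip := by
            simp only [Matrix.mul_assoc]
        _ = spinFlip * n * (stateMatrix ψ)ᵀ * (mᵀ * spinFlip * m) := by
            rw [spinFlip_mul_spinFlip, Matrix.mul_one, hm]
        _ = _ := by simp only [Matrix.mul_assoc]; rfl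

theorem GradedSimilar.hasBlockStructure {P P' : Matrix (Fin 4 ⊕ Fin 4) (Fin 4 ⊕ Fin 4) ℂ}
    {L : List PBlock} (h : GradedSimilar P P') (hL : HasBlockStructure P L) :
    HasBlockStructure P' L := by
  obtain ⟨D, hD, h1, h2⟩ := h
  obtain ⟨u, w, hr, hli, hsp⟩ := hL
  have hP : ∀ v, P' *ᵥ (D *ᵥ v) = D *ᵥ (P *ᵥ v) := fun v => by
    rw [Matrix.mulVec_mulVec, ← h1, Matrix.mulVec_mulVec]
  have hJ : ∀ v, mirror (D *ᵥ v) = D *ᵥ mirror v := fun v => by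
    rw [← matJ_mulVec, Matrix.mulVec_mulVec, ← h2, ← Matrix.mulVec_mulVec, matJ_mulVec]
  have chain : ∀ {z : ℂ} {m : ℕ} {v : Fin m → Fin 4 ⊕ Fin 4 → ℂ}, IsJordanChain P z v →
      IsJordanChain P' z (fun k => D *ᵥ v k) := by
    intro z m v hv
    refine ⟨fun k hk => ?_, fun j k hk => ?_⟩
    · rw [hP, hv.1 k hk, Matrix.mulVec_smul]
    · rw [hP, hv.2 j k hk, Matrix.mulVec_add, Matrix.mulVec_smul]
  have half : ∀ {h : Bool} {v}, InHalf h v → InHalf h (D *ᵥ v) := by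
    intro h v hv
    have h1 := mirror_of_inHalf hv
    have h2 := hJ v
    rw [h1, Matrix.mulVec_smul] at h2
    cases h
    · intro i
      have := congrFun h2 (Sum.inl i)
      simp [mirror] at this
      exact self_eq_neg.1 this
    · intro i
      have := congrFun h2 (Sum.inr i)
      simp [mirror] at this
      exact self_eq_neg.1 this.symm
  have hD1 : Function.Injective (Matrix.toLin' D) := by
    rw [Matrix.toLin'_apply']
    exact Matrix.mulVec_injective_iff_isUnit.2 hD
  have hfam : (fun x : (i : Fin L.length) × (Fin (L.get i).fstDim ⊕ Fin (L.get i).sndDim) =>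
        Sum.elim (fun k => D *ᵥ u x.1 k) (fun k => D *ᵥ w x.1 k) x.2) =
      Matrix.toLin' D ∘ fun x => Sum.elim (u x.1) (w x.1) x.2 := by
    funext x
    obtain ⟨i, k | k⟩ := x <;> simp
  refine ⟨fun i k => D *ᵥ u i k, fun i k => D *ᵥ w i k, fun i => ?_, ?_, ?_⟩
  · have := hr i
    change PBlock.IsRealizedBy P' (L.get i) (fun k => D *ᵥ u i k) (fun k => D *ᵥ w i k)
    generalize u i = a at this ⊢
    generalize w i = b at this ⊢
    generalize L.get i = B at *
    cases B with
    | pair m z => exact ⟨chain this.1, fun k => by rw [hJ, ← this.2 k]⟩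
    | degenerate h p q =>
      exact ⟨chain this.1, chain this.2.1, fun k => half (this.2.2.1 k),
        fun k => half (this.2.2.2 k)⟩
  · rw [hfam]
    exact hli.map' _ (LinearMap.ker_eq_bot.2 hD1)
  · rw [hfam, Set.range_comp, ← Submodule.map_span, hsp, Submodule.map_top, LinearMap.range_eq_top]
    exact LinearMap.injective_iff_surjective.1 hD1

section

/-! ### Decompositions of submodules into blocks -/

/-- The submodule `W` is the sum of the spans of vectors realizing the members of `L`. -/
def Decomp (P : Matrix (Fin 4 ⊕ Fin 4) (Fin 4 ⊕ Fin 4) ℂ) :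
    List PBlock → Submodule ℂ (Fin 4 ⊕ Fin 4 → ℂ) → Prop
  | [], W => W = ⊥
  | B :: L, W => ∃ u w, B.IsRealizedBy P u w ∧ ∃ W', Decomp P L W' ∧
      W = Submodule.span ℂ (Set.range u ∪ Set.range w) ⊔ W'

/-- Number of vectors in a realization of a list of blocks. -/
def totalDim (L : List PBlock) : ℕ := (L.map fun B => B.fstDim + B.sndDim).sum

variable {P P' : Matrix (Fin 4 ⊕ Fin 4) (Fin 4 ⊕ Fin 4) ℂ}

theorem Decomp.exists_families {L : List PBlock} {W : Submodule ℂ (Fin 4 ⊕ Fin 4 → ℂ)}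
    (h : Decomp P L W) :
    ∃ (u : (i : Fin L.length) → Fin (L.get i).fstDim → Fin 4 ⊕ Fin 4 → ℂ)
      (w : (i : Fin L.length) → Fin (L.get i).sndDim → Fin 4 ⊕ Fin 4 → ℂ),
      (∀ i, (L.get i).IsRealizedBy P (u i) (w i)) ∧
      Submodule.span ℂ (Set.range
        (fun x : (i : Fin L.length) × (Fin (L.get i).fstDim ⊕ Fin (L.get i).sndDim) =>
          Sum.elim (u x.1) (w x.1) x.2)) = W := by
  induction L generalizing W with
  | nil =>
    refine ⟨fun i => i.elim0, fun i => i.elim0, fun i => i.elim0, ?_⟩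
    rw [show W = ⊥ from h, Submodule.span_eq_bot]
    rintro _ ⟨⟨i, _⟩, -⟩
    exact i.elim0
  | cons B L ih =>
    obtain ⟨u, w, hr, W', hW', rfl⟩ := h
    obtain ⟨u', w', hr', rfl⟩ := ih hW'
    refine ⟨Fin.cons (α := fun i => Fin ((B :: L).get i).fstDim → Fin 4 ⊕ Fin 4 → ℂ) u u',
      Fin.cons (α := fun i => Fin ((B :: L).get i).sndDim → Fin 4 ⊕ Fin 4 → ℂ) w w', ?_, ?_⟩
    · intro i
      refine Fin.cases ?_ (fun i => ?_) i
      · exact hr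
      · exact hr' i
    · rw [← Submodule.span_union]
      congr 1
      ext x
      constructor
      · rintro ⟨⟨i, k⟩, rfl⟩
        revert k
        refine Fin.cases ?_ (fun i => ?_) i
        · rintro (k | k)
          · exact Or.inl (Or.inl ⟨k, rfl⟩)
          · exact Or.inl (Or.inr ⟨k, rfl⟩)
        · exact fun k => Or.inr ⟨⟨i, k⟩, rfl⟩
      · rintro ((⟨k, rfl⟩ | ⟨k, rfl⟩) | ⟨⟨i, k⟩, rfl⟩)
        · exact ⟨⟨0, Sum.inl k⟩, rfl⟩
        · exact ⟨⟨0, Sum.inr k⟩, rfl⟩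
        · exact ⟨⟨i.succ, k⟩, rfl⟩

theorem card_block_index (L : List PBlock) :
    Fintype.card ((i : Fin L.length) × (Fin (L.get i).fstDim ⊕ Fin (L.get i).sndDim)) =
      totalDim L := by
  simp only [Fintype.card_sigma, Fintype.card_sum, Fintype.card_fin, totalDim]
  rw [← Fin.sum_univ_fun_getElem]
  rfl

/-- Independence need not be tracked in `Decomp`: eight vectors spanning an eight-dimensional space
form a basis. -/
theorem Decomp.hasBlockStructure {L : List PBlock} (h : Decomp P L ⊤) (hd : totalDim L = 8) :
    HasBlockStructure P L := by
  obtain ⟨u, w, hr, hsp⟩ := h.exists_families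
  refine ⟨u, w, hr, linearIndependent_of_top_le_span_of_card_eq_finrank hsp.ge ?_, hsp⟩
  rw [card_block_index, hd]
  simp

theorem Decomp.perm {L L' : List PBlock} (hL : L.Perm L')
    {W : Submodule ℂ (Fin 4 ⊕ Fin 4 → ℂ)} (h : Decomp P L W) : Decomp P L' W := by
  induction hL generalizing W with
  | nil => exact h
  | cons B _ ih =>
    obtain ⟨u, w, hr, W', hW', rfl⟩ := h
    exact ⟨u, w, hr, W', ih hW', rfl⟩
  | swap B C L =>
    obtain ⟨u, w, hr, W', ⟨u', w', hr', W'', hW'', rfl⟩, rfl⟩ := h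
    exact ⟨u', w', hr', _, ⟨u, w, hr, W'', hW'', rfl⟩, sup_left_comm _ _ _⟩
  | trans _ _ ih ih' => exact ih' (ih h)

theorem totalDim_perm {L L' : List PBlock} (hL : L.Perm L') : totalDim L = totalDim L' :=
  (hL.map _).sum_eq

/-- The sign of the eigenvalue of a pair is immaterial. -/
theorem Decomp.pair_neg (hP : ∀ v, P *ᵥ mirror v = -mirror (P *ᵥ v)) {m : ℕ} {z : ℂ}
    {L : List PBlock} {W : Submodule ℂ (Fin 4 ⊕ Fin 4 → ℂ)} (h : Decomp P (.pair m z :: L) W) :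
    Decomp P (.pair m (-z) :: L) W := by
  obtain ⟨u, w, hr, W', hW', rfl⟩ := h
  change Fin m → Fin 4 ⊕ Fin 4 → ℂ at u w
  obtain ⟨hu, hw⟩ := hr
  change ∀ k : Fin m, w k = mirror (u k) at hw
  -- The reflected chain satisfies `P x = -z x - (previous)`; alternating signs turn this into a
  -- Jordan chain for `-z`.
  let u' : Fin m → Fin 4 ⊕ Fin 4 → ℂ := fun k => (-1 : ℂ) ^ (k : ℕ) • mirror (u k)
  let w' : Fin m → Fin 4 ⊕ Fin 4 → ℂ := fun k => (-1 : ℂ) ^ (k : ℕ) • u k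
  refine ⟨u', w', ⟨⟨fun k hk => ?_, fun j k hk => ?_⟩, fun k => ?_⟩, W', hW', ?_⟩
  · simp only [u', Matrix.mulVec_smul, hP, hu.1 k hk, mirror_smul]
    module
  · simp only [u', Matrix.mulVec_smul, hP, hu.2 j k hk, mirror_smul, mirror_add, hk, pow_succ]
    module
  · simp only [u', w', mirror_smul, mirror_mirror]
  · congr 1
    have key : ∀ (a b : Fin m → Fin 4 ⊕ Fin 4 → ℂ), (∀ k, ∃ c : ℂ, a k = c • b k) →
        Submodule.span ℂ (Set.range a) ≤ Submodule.span ℂ (Set.range b) := by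
      intro a b hab
      rw [Submodule.span_le]
      rintro _ ⟨k, rfl⟩
      obtain ⟨c, hc⟩ := hab k
      rw [hc]
      exact Submodule.smul_mem _ _ (Submodule.subset_span ⟨k, rfl⟩)
    have hsq : ∀ k : ℕ, (-1 : ℂ) ^ k * (-1) ^ k = 1 := fun k => by rw [← mul_pow]; simp
    rw [Submodule.span_union, Submodule.span_union, sup_comm]
    refine le_antisymm (sup_le_sup (key _ _ fun k => ⟨(-1) ^ (k : ℕ), ?_⟩)
      (key _ _ fun k => ⟨(-1) ^ (k : ℕ), ?_⟩)) (sup_le_sup (key _ _ fun k => ⟨(-1) ^ (k : ℕ), ?_⟩)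
      (key _ _ fun k => ⟨(-1) ^ (k : ℕ), ?_⟩))
    · simp [u', hw, smul_smul, hsq]
    · simp [w', smul_smul, hsq]
    · simp [u', hw]
    · simp [w']

/-- A degenerated pair with second length `0` encodes a lone string. Two lone strings starting in
opposite halves are together a degenerated pair. -/
theorem Decomp.merge_strings {h : Bool} {p q : ℕ} {L : List PBlock}
    {W : Submodule ℂ (Fin 4 ⊕ Fin 4 → ℂ)}
    (hW : Decomp P (.degenerate h p 0 :: .degenerate (!h) q 0 :: L) W) :
    Decomp P (.degenerate h p q :: L) W := by
  obtain ⟨u, u0, ⟨hu, -, hu', -⟩, W', ⟨w, w0, ⟨hw, -, hw', -⟩, W'', hW'', rfl⟩, rfl⟩ := hW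
  refine ⟨u, w, ⟨hu, hw, hu', ?_⟩, W'', hW'', ?_⟩
  · simpa using hw'
  · have h1 : Set.range u0 = ∅ := Set.range_eq_empty_iff.2 (inferInstanceAs (IsEmpty (Fin 0)))
    have h2 : Set.range w0 = ∅ := Set.range_eq_empty_iff.2 (inferInstanceAs (IsEmpty (Fin 0)))
    rw [h1, h2, Set.union_empty, Set.union_empty, Submodule.span_union, sup_assoc]
    rfl

/-- For equal lengths the sums `x k + y k` form a chain. The reflection acts on `x k` and `y k` by
opposite signs, so the sums and their mirror images recover both strings. -/
theorem Decomp.merge_strings_pair {h : Bool} {p : ℕ} {L : List PBlock}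
    {W : Submodule ℂ (Fin 4 ⊕ Fin 4 → ℂ)}
    (hW : Decomp P (.degenerate h p 0 :: .degenerate (!h) p 0 :: L) W) :
    Decomp P (.pair p 0 :: L) W := by
  obtain ⟨x, y, ⟨hx, hy, hx', hy'⟩, W'', hW'', rfl⟩ := hW.merge_strings
  change Fin p → Fin 4 ⊕ Fin 4 → ℂ at x y
  change ∀ k : Fin p, _ at hx' hy'
  have hmx : ∀ k : Fin p, ∃ e : ℂ, e * e = 1 ∧ mirror (x k) = e • x k ∧ mirror (y k) =
      -e • y k := by
    intro k
    have h1 := mirror_of_inHalf (hx' k)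
    have h2 := mirror_of_inHalf (hy' k)
    refine ⟨_, ?_, h1, h2.trans ?_⟩
    · split_ifs <;> simp
    · congr 1
      cases h <;> by_cases hk : Even (k : ℕ) <;> simp [hk]
  choose e he hex hey using hmx
  refine ⟨fun k : Fin p => x k + y k, fun k : Fin p => mirror (x k + y k),
    ⟨⟨fun k hk => ?_, fun j k hk => ?_⟩, fun k => rfl⟩, W'', hW'', ?_⟩
  · rw [Matrix.mulVec_add, hx.1 k hk, hy.1 k hk, smul_add]
  · rw [Matrix.mulVec_add, hx.2 j k hk, hy.2 j k hk, smul_add, add_add_add_comm]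
  · congr 1
    simp only [mirror_add, hex, hey]
    apply le_antisymm <;> rw [Submodule.span_le]
    · rintro _ (⟨k, rfl⟩ | ⟨k, rfl⟩) <;> change Fin p at k
      · have : x k = (1 / 2 : ℂ) • ((x k + y k) + e k • (e k • x k + -e k • y k)) := by
          rw [smul_add (e k), smul_smul, smul_smul, mul_neg, he]; module
        rw [SetLike.mem_coe, this]
        exact Submodule.smul_mem _ _ (Submodule.add_mem _ (Submodule.subset_span (Or.inl ⟨k, rfl⟩))
          (Submodule.smul_mem _ _ (Submodule.subset_span (Or.inr ⟨k, rfl⟩))))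
      · have : y k = (1 / 2 : ℂ) • ((x k + y k) - e k • (e k • x k + -e k • y k)) := by
          rw [smul_add (e k), smul_smul, smul_smul, mul_neg, he]; module
        rw [SetLike.mem_coe, this]
        exact Submodule.smul_mem _ _ (Submodule.sub_mem _ (Submodule.subset_span (Or.inl ⟨k, rfl⟩))
          (Submodule.smul_mem _ _ (Submodule.subset_span (Or.inr ⟨k, rfl⟩))))
    · have hX : ∀ k, x k ∈ Submodule.span ℂ (Set.range x ∪ Set.range y) :=
        fun k => Submodule.subset_span (Or.inl ⟨k, rfl⟩)
      have hY : ∀ k, y k ∈ Submodule.span ℂ (Set.range x ∪ Set.range y) :=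
        fun k => Submodule.subset_span (Or.inr ⟨k, rfl⟩)
      rintro _ (⟨k, rfl⟩ | ⟨k, rfl⟩)
      · exact Submodule.add_mem _ (hX k) (hY k)
      · exact Submodule.add_mem _ (Submodule.smul_mem _ _ (hX k)) (Submodule.smul_mem _ _ (hY k))

/-- The block obtained by exchanging the two halves. -/
def PBlock.flip : PBlock → PBlock
  | .pair m z => .pair m z
  | .degenerate h p q => .degenerate (!h) p q

/-- A map anticommuting with the reflection interchanges the halves. Ordinary pairs keep their type,
while the strings of degenerated pairs start in the other half. -/
theorem Decomp.map_flip {D : Matrix (Fin 4 ⊕ Fin 4) (Fin 4 ⊕ Fin 4) ℂ} (hDP : D * P = P' * D)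
    (hDJ : D * matJ = -(matJ * D)) {L : List PBlock} {W : Submodule ℂ (Fin 4 ⊕ Fin 4 → ℂ)}
    (h : Decomp P L W) : Decomp P' (L.map PBlock.flip) (W.map (Matrix.toLin' D)) := by
  have hP : ∀ v, P' *ᵥ (D *ᵥ v) = D *ᵥ (P *ᵥ v) := fun v => by
    rw [Matrix.mulVec_mulVec, ← hDP, Matrix.mulVec_mulVec]
  have hJ : ∀ v, mirror (D *ᵥ v) = -(D *ᵥ mirror v) := fun v => by
    rw [← matJ_mulVec, ← matJ_mulVec, Matrix.mulVec_mulVec, Matrix.mulVec_mulVec, hDJ,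
      Matrix.neg_mulVec, neg_neg]
  have chain : ∀ {z : ℂ} {m : ℕ} {v : Fin m → Fin 4 ⊕ Fin 4 → ℂ}, IsJordanChain P z v →
      IsJordanChain P' z (fun k => D *ᵥ v k) := by
    intro z m v hv
    refine ⟨fun k hk => ?_, fun j k hk => ?_⟩
    · rw [hP, hv.1 k hk, Matrix.mulVec_smul]
    · rw [hP, hv.2 j k hk, Matrix.mulVec_add, Matrix.mulVec_smul]
  have half : ∀ {h : Bool} {v}, InHalf h v → InHalf (!h) (D *ᵥ v) := by
    intro h v hv
    have h1 := mirror_of_inHalf hv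
    have h2 := hJ v
    rw [h1, Matrix.mulVec_smul] at h2
    cases h
    · intro i
      have := congrFun h2 (Sum.inr i)
      simp [mirror] at this
      exact self_eq_neg.1 this.symm
    · intro i
      have := congrFun h2 (Sum.inl i)
      simp [mirror] at this
      exact self_eq_neg.1 this
  have hspan : ∀ {p q : ℕ} (u : Fin p → Fin 4 ⊕ Fin 4 → ℂ) (w : Fin q → Fin 4 ⊕ Fin 4 → ℂ),
      (Submodule.span ℂ (Set.range u ∪ Set.range w)).map (Matrix.toLin' D) =
      Submodule.span ℂ (Set.range (fun k => D *ᵥ u k) ∪ Set.range (fun k => D *ᵥ w k)) := by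
    intro p q u w
    rw [Submodule.map_span, Set.image_union, ← Set.range_comp, ← Set.range_comp]
    rfl
  induction L generalizing W with
  | nil =>
    rw [show W = ⊥ from h]
    exact Submodule.map_bot _
  | cons B L ih =>
    obtain ⟨u, w, hr, W', hW', rfl⟩ := h
    rw [List.map_cons, Submodule.map_sup]
    cases B with
    | pair m z =>
      change Fin m → Fin 4 ⊕ Fin 4 → ℂ at u w
      obtain ⟨hu, hw⟩ := hr
      change ∀ k : Fin m, w k = mirror (u k) at hw
      refine ⟨fun k : Fin m => D *ᵥ u k, fun k : Fin m => mirror (D *ᵥ u k),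
        ⟨chain hu, fun k => rfl⟩, _, ih hW', ?_⟩
      congr 1
      refine (hspan u w).trans ?_
      rw [Submodule.span_union, Submodule.span_union]
      congr 1
      have : (fun k => mirror (D *ᵥ u k)) = fun k => -(D *ᵥ w k) := by
        funext k; rw [hJ, hw]
      rw [this, ← Submodule.span_neg]
      congr 1
      ext x
      simp only [Set.mem_neg, Set.mem_range]
      refine exists_congr fun k => ?_
      rw [neg_eq_iff_eq_neg]
    | degenerate h p q =>
      obtain ⟨h1, h2, h3, h4⟩ := hr
      refine ⟨fun k => D *ᵥ u k, fun k => D *ᵥ w k, ⟨chain h1, chain h2, fun k => ?_, fun k => ?_⟩,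
        _, ih hW', ?_⟩
      · have := half (h3 k)
        split_ifs at this ⊢ <;> simpa using this
      · have := half (h4 k)
        split_ifs at this ⊢ <;> simpa using this
      · congr 1
        exact hspan _ _

end

section

/-! ### Existence of block decompositions -/

theorem mirror_dotProduct (x y : Fin 4 ⊕ Fin 4 → ℂ) : mirror x ⬝ᵥ y = x ⬝ᵥ mirror y := by
  rw [← matJ_mulVec, ← matJ_mulVec, Matrix.dotProduct_mulVec, ← Matrix.mulVec_transpose,
    matJ_transpose]

/-- `P` is symmetric and anticommutes with `mirror`. -/
structure IsSymmOdd (P : Matrix (Fin 4 ⊕ Fin 4) (Fin 4 ⊕ Fin 4) ℂ) : Prop where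
  symm : ∀ x y, (P *ᵥ x) ⬝ᵥ y = x ⬝ᵥ (P *ᵥ y)
  odd : ∀ x, P *ᵥ mirror x = -mirror (P *ᵥ x)

theorem isSymmOdd_matP (ψ : State) : IsSymmOdd (matP ψ) where
  symm x y := by
    rw [Matrix.dotProduct_mulVec, ← Matrix.mulVec_transpose, matP_transpose]
  odd := matP_mulVec_mirror ψ

/-- A nondegenerate submodule that is stable under `P` and `mirror`. -/
structure IsStableNondeg (P : Matrix (Fin 4 ⊕ Fin 4) (Fin 4 ⊕ Fin 4) ℂ)
    (W : Submodule ℂ (Fin 4 ⊕ Fin 4 → ℂ)) : Prop where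
  mulVec_mem : ∀ x ∈ W, P *ᵥ x ∈ W
  mirror_mem : ∀ x ∈ W, mirror x ∈ W
  nondeg : ∀ x ∈ W, (∀ y ∈ W, x ⬝ᵥ y = 0) → x = 0

theorem isStableNondeg_top (P : Matrix (Fin 4 ⊕ Fin 4) (Fin 4 ⊕ Fin 4) ℂ) :
    IsStableNondeg P ⊤ where
  mulVec_mem _ _ := trivial
  mirror_mem _ _ := trivial
  nondeg x _ h := dotProduct_eq_zero x fun y => h y trivial

variable {P : Matrix (Fin 4 ⊕ Fin 4) (Fin 4 ⊕ Fin 4) ℂ} {W : Submodule ℂ (Fin 4 ⊕ Fin 4 → ℂ)}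

theorem sum_smul_dotProduct {ι : Type*} [Fintype ι] (c : ι → ℂ) (e : ι → Fin 4 ⊕ Fin 4 → ℂ)
    (y : Fin 4 ⊕ Fin 4 → ℂ) : (∑ i, c i • e i) ⬝ᵥ y = ∑ i, c i * (e i ⬝ᵥ y) := by
  simp only [sum_dotProduct, smul_dotProduct, smul_eq_mul]

/-- Vectors with an antitriangular Gram matrix split off an orthogonal summand. -/
theorem IsStableNondeg.exists_split (hP : IsSymmOdd P) (hW : IsStableNondeg P W)
    {ι : Type} [Fintype ι] (e : ι → Fin 4 ⊕ Fin 4 → ℂ) (he : ∀ i, e i ∈ W)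
    (hPe : ∀ i, P *ᵥ e i ∈ Submodule.span ℂ (Set.range e))
    (hJe : ∀ i, mirror (e i) ∈ Submodule.span ℂ (Set.range e))
    (σ : ι → ι) (l : ι → ℕ) (hne : ∀ i, e i ⬝ᵥ e (σ i) ≠ 0)
    (hzero : ∀ i k, k ≠ i → l k ≤ l i → e k ⬝ᵥ e (σ i) = 0) :
    ∃ W' : Submodule ℂ (Fin 4 ⊕ Fin 4 → ℂ), IsStableNondeg P W' ∧
      W = Submodule.span ℂ (Set.range e) ⊔ W' ∧
      Module.finrank ℂ W = Fintype.card ι + Module.finrank ℂ W' := by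
  classical
  -- The Gram matrix is nonsingular: for a nonzero coefficient of maximal level `l i`, pairing with
  -- `e (σ i)` leaves that single term.
  have hgram : ∀ c : ι → ℂ, (∀ j, (∑ i, c i • e i) ⬝ᵥ e j = 0) → c = 0 := by
    intro c hc
    by_contra hne0
    obtain ⟨i0, hi0⟩ := Function.ne_iff.1 hne0
    obtain ⟨i, hi, hmax⟩ := Finset.exists_max_image (Finset.univ.filter fun i => c i ≠ 0) l
      ⟨i0, by simpa using hi0⟩
    have h1 := hc (σ i)
    rw [sum_smul_dotProduct, Finset.sum_eq_single i] at h1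
    · exact (mul_ne_zero (Finset.mem_filter.1 hi).2 (hne i)) h1
    · intro k _ hk
      by_cases hck : c k = 0
      · rw [hck, zero_mul]
      · rw [hzero i k hk (hmax k (by simpa using hck)), mul_zero]
    · simp
  set A := Submodule.span ℂ (Set.range e) with hA
  have hAW : A ≤ W := Submodule.span_le.2 (by rintro _ ⟨i, rfl⟩; exact he i)
  have hli : LinearIndependent ℂ e := by
    rw [Fintype.linearIndependent_iff]
    intro c hc i
    exact congrFun (hgram c fun j => by rw [hc, zero_dotProduct]) i
  have hcardA : Module.finrank ℂ A = Fintype.card ι := finrank_span_eq_card hli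
  let W' : Submodule ℂ (Fin 4 ⊕ Fin 4 → ℂ) :=
    { carrier := {x | x ∈ W ∧ ∀ i, x ⬝ᵥ e i = 0}
      add_mem' := fun {a b} ha hb => ⟨W.add_mem ha.1 hb.1, fun i => by
        rw [add_dotProduct, ha.2, hb.2, add_zero]⟩
      zero_mem' := ⟨W.zero_mem, fun i => zero_dotProduct _⟩
      smul_mem' := fun c x hx => ⟨W.smul_mem c hx.1, fun i => by
        rw [smul_dotProduct, hx.2, smul_zero]⟩ }
  have hmem : ∀ x, x ∈ W' ↔ x ∈ W ∧ ∀ i, x ⬝ᵥ e i = 0 := fun x => Iff.rfl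
  have horth : ∀ x, (∀ i, x ⬝ᵥ e i = 0) → ∀ a ∈ A, x ⬝ᵥ a = 0 := by
    intro x hx a ha
    induction ha using Submodule.span_induction with
    | mem y hy => obtain ⟨i, rfl⟩ := hy; exact hx i
    | zero => exact dotProduct_zero _
    | add y z _ _ hy hz => rw [dotProduct_add, hy, hz, add_zero]
    | smul c y _ hy => rw [dotProduct_smul, hy, smul_zero]
  have hsup : W = A ⊔ W' := by
    refine le_antisymm (fun x hx => ?_) (sup_le hAW fun x hx => hx.1)
    -- Nonsingularity makes the Gram map surjective, so each vector has an orthogonal projection to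
    -- the span.
    let G : (ι → ℂ) →ₗ[ℂ] (ι → ℂ) :=
      { toFun := fun c j => (∑ i, c i • e i) ⬝ᵥ e j
        map_add' := fun c d => by
          funext j
          simp only [Pi.add_apply, add_smul, Finset.sum_add_distrib, add_dotProduct]
        map_smul' := fun r c => by
          funext j
          simp only [Pi.smul_apply, smul_assoc, ← Finset.smul_sum, smul_dotProduct,
            RingHom.id_apply] }
    have hG : Function.Injective G := by
      rw [injective_iff_map_eq_zero]
      exact fun c hc => hgram c fun j => congrFun hc j
    obtain ⟨c, hc⟩ := LinearMap.injective_iff_surjective.1 hG (fun j => x ⬝ᵥ e j)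
    have ha : ∑ i, c i • e i ∈ A :=
      Submodule.sum_mem _ fun i _ => Submodule.smul_mem _ _ (Submodule.subset_span ⟨i, rfl⟩)
    rw [← add_sub_cancel (∑ i, c i • e i) x]
    refine Submodule.add_mem_sup ha ⟨W.sub_mem hx (hAW ha), fun j => ?_⟩
    rw [sub_dotProduct, sub_eq_zero]
    exact (congrFun hc j).symm
  have hinf : A ⊓ W' = ⊥ := by
    rw [eq_bot_iff]
    rintro x ⟨hxA, -, hx⟩
    obtain ⟨c, rfl⟩ := (Submodule.mem_span_range_iff_exists_fun ℂ).1 hxA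
    have := hgram c hx
    simp [this]
  refine ⟨W', ⟨fun x hx => ?_, fun x hx => ?_, fun x hx h => ?_⟩, hsup, ?_⟩
  · refine ⟨hW.mulVec_mem x hx.1, fun i => ?_⟩
    rw [hP.symm]
    exact horth x hx.2 _ (hPe i)
  · refine ⟨hW.mirror_mem x hx.1, fun i => ?_⟩
    rw [mirror_dotProduct]
    exact horth x hx.2 _ (hJe i)
  · refine hW.nondeg x hx.1 fun y hy => ?_
    rw [hsup] at hy
    obtain ⟨a, ha, b, hb, rfl⟩ := Submodule.mem_sup.1 hy
    rw [dotProduct_add, horth x hx.2 a ha, h b hb, add_zero]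
  · have := Submodule.finrank_sup_add_finrank_inf_eq A W'
    rw [hinf, finrank_bot, add_zero, ← hsup, hcardA] at this
    exact this

/-- The map `P - z`. -/
def shift (P : Matrix (Fin 4 ⊕ Fin 4) (Fin 4 ⊕ Fin 4) ℂ) (z : ℂ) :
    Module.End ℂ (Fin 4 ⊕ Fin 4 → ℂ) := Matrix.toLin' P - z • 1

theorem shift_apply (z : ℂ) (x : Fin 4 ⊕ Fin 4 → ℂ) : shift P z x = P *ᵥ x - z • x := by
  simp [shift]

theorem mulVec_eq_shift (z : ℂ) (x : Fin 4 ⊕ Fin 4 → ℂ) : P *ᵥ x = z • x + shift P z x := by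
  rw [shift_apply]; abel

theorem IsSymmOdd.shift_pow_dotProduct (hP : IsSymmOdd P) (z : ℂ) (k : ℕ)
    (x y : Fin 4 ⊕ Fin 4 → ℂ) : (shift P z ^ k) x ⬝ᵥ y = x ⬝ᵥ (shift P z ^ k) y := by
  induction k generalizing x y with
  | zero => simp
  | succ k ih =>
    rw [pow_succ, Module.End.mul_apply, ih, ← pow_succ, pow_succ',
      Module.End.mul_apply, shift_apply, shift_apply, sub_dotProduct, dotProduct_sub, hP.symm,
      smul_dotProduct, dotProduct_smul]

theorem IsSymmOdd.shift_pow_dotProduct_shift_pow (hP : IsSymmOdd P) (z : ℂ) (i j : ℕ)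
    (x y : Fin 4 ⊕ Fin 4 → ℂ) :
    (shift P z ^ i) x ⬝ᵥ (shift P z ^ j) y = x ⬝ᵥ (shift P z ^ (i + j)) y := by
  rw [hP.shift_pow_dotProduct, ← Module.End.mul_apply, ← pow_add]

theorem IsStableNondeg.shift_pow_mem (hW : IsStableNondeg P W) (z : ℂ) (k : ℕ)
    {x : Fin 4 ⊕ Fin 4 → ℂ} (hx : x ∈ W) : (shift P z ^ k) x ∈ W := by
  induction k with
  | zero => simpa
  | succ k ih =>
    rw [pow_succ', Module.End.mul_apply, shift_apply]
    exact W.sub_mem (hW.mulVec_mem _ ih) (W.smul_mem _ ih)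

theorem isRight_or_isRight_neg (z : ℂ) : IsRight z ∨ IsRight (-z) := by
  unfold IsRight
  rcases lt_trichotomy z.re 0 with h | h | h
  · right; left; simpa using h
  · rcases le_total 0 z.im with h' | h'
    · exact Or.inl (Or.inr ⟨h, h'⟩)
    · exact Or.inr (Or.inr ⟨by simp [h], by simpa using h'⟩)
  · exact Or.inl (Or.inl h)

/-- The reflection sends eigenvectors for `z` to eigenvectors for `-z`, so the eigenvalue can be
taken in the right half-plane. -/
theorem IsStableNondeg.exists_eigenvector (hP : IsSymmOdd P) (hW : IsStableNondeg P W)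
    (hne : W ≠ ⊥) : ∃ z, IsRight z ∧ ∃ x ∈ W, x ≠ 0 ∧ P *ᵥ x = z • x := by
  have : Nontrivial W := Submodule.nontrivial_iff_ne_bot.2 hne
  let f : Module.End ℂ W := (Matrix.toLin' P).restrict (fun x hx => hW.mulVec_mem x hx)
  obtain ⟨z, hz⟩ := Module.End.exists_eigenvalue f
  obtain ⟨x, hx⟩ := hz.exists_hasEigenvector
  have hx1 : P *ᵥ x.1 = z • x.1 :=
    congrArg Subtype.val hx.apply_eq_smul
  have hx0 : x.1 ≠ 0 := fun h => hx.2 (Subtype.ext h)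
  rcases isRight_or_isRight_neg z with h | h
  · exact ⟨z, h, x.1, x.2, hx0, hx1⟩
  · refine ⟨-z, h, mirror x.1, hW.mirror_mem _ x.2, fun h0 => hx0 ?_, ?_⟩
    · rw [← mirror_mirror x.1, h0]
      ext i; cases i <;> simp [mirror]
    · rw [hP.odd, hx1, mirror_smul, neg_smul]

/-- A generalized eigenvector `v` of maximal order that is not isotropic for the form
`⟨x, (P - z)ᵏ y⟩`. -/
theorem IsStableNondeg.exists_generator (hP : IsSymmOdd P) (hW : IsStableNondeg P W)
    (hne : W ≠ ⊥) : ∃ z, IsRight z ∧ ∃ (k : ℕ) (v : Fin 4 ⊕ Fin 4 → ℂ), v ∈ W ∧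
      (shift P z ^ (k + 1)) v = 0 ∧ v ⬝ᵥ (shift P z ^ k) v ≠ 0 := by
  obtain ⟨z, hz, x₀, hx₀W, hx₀, hx₀z⟩ := hW.exists_eigenvector hP hne
  refine ⟨z, hz, ?_⟩
  set q := shift P z with hq
  have hqW : ∀ x ∈ W, q x ∈ W := fun x hx => by simpa using hW.shift_pow_mem z 1 hx
  let f : Module.End ℂ W := q.restrict hqW
  have hf : ∀ (k : ℕ) (x : W), ((f ^ k) x).1 = (q ^ k) x.1 := by
    intro k x
    rw [Module.End.pow_restrict]
    rfl
  -- Fitting decomposition of `W`: for large `n` it is the direct sum of the generalized eigenspace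
  -- and the range of `q ^ n`.
  obtain ⟨N, hN⟩ := (f.eventually_isCompl_ker_pow_range_pow).exists_forall_of_atTop
  set n := N + 1
  have hcompl := hN n (Nat.le_succ N)
  -- As `q` is self-adjoint, the kernel of `q ^ n` is orthogonal to its range; so the dot product
  -- stays nondegenerate on the generalized eigenspace.
  have hE : ∀ x ∈ W, (q ^ n) x = 0 → (∀ y ∈ W, (q ^ n) y = 0 → x ⬝ᵥ y = 0) → x = 0 := by
    intro x hx hx0 h
    refine hW.nondeg x hx fun y hy => ?_
    have : (⟨y, hy⟩ : W) ∈ LinearMap.ker (f ^ n) ⊔ LinearMap.range (f ^ n) := by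
      rw [hcompl.sup_eq_top]; trivial
    obtain ⟨a, ha, _, ⟨b, rfl⟩, hab⟩ := Submodule.mem_sup.1 this
    have hab' : y = a.1 + (q ^ n) b.1 := by rw [← hf, ← Submodule.coe_add, hab]
    have ha0 : (q ^ n) a.1 = 0 := by rw [← hf, LinearMap.mem_ker.1 ha]; rfl
    rw [hab', dotProduct_add, h a.1 a.2 ha0, ← hP.shift_pow_dotProduct, ← hq, hx0, zero_dotProduct,
      add_zero]
  -- The least power of `q` killing the generalized eigenspace is `k + 1`; then `⟨x, qᵏ y⟩` is a
  -- nonzero symmetric form on that space.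
  have hex : ∃ m, ∀ x ∈ W, (q ^ n) x = 0 → (q ^ m) x = 0 := ⟨n, fun x _ h => h⟩
  classical
  have hm0 : Nat.find hex ≠ 0 := by
    intro h0
    have := Nat.find_spec hex x₀ hx₀W (by
      rw [pow_succ, Module.End.mul_apply, hq, shift_apply, hx₀z, sub_self, map_zero])
    rw [h0] at this
    exact hx₀ (by simpa using this)
  obtain ⟨k, hk⟩ := Nat.exists_eq_succ_of_ne_zero hm0
  have hmin := Nat.find_min hex (m := k) (by omega)
  have hspec := Nat.find_spec hex
  rw [hk] at hspec
  push Not at hmin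
  obtain ⟨y, hyW, hy0, hyk⟩ := hmin
  have : ∃ x ∈ W, (q ^ n) x = 0 ∧ (q ^ k) y ⬝ᵥ x ≠ 0 := by
    by_contra! hcon
    refine hyk (hE _ (hW.shift_pow_mem z k hyW) ?_ hcon)
    rw [← Module.End.mul_apply, (Commute.pow_pow_self q n k).eq, Module.End.mul_apply, hy0,
        map_zero]
  obtain ⟨x, hxW, hx0, hxy⟩ := this
  have hxk : x ⬝ᵥ (q ^ k) y ≠ 0 := by rwa [dotProduct_comm]
  have hyx : y ⬝ᵥ (q ^ k) x = x ⬝ᵥ (q ^ k) y := by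
    rw [← hP.shift_pow_dotProduct, dotProduct_comm]
  -- Polarization: if `x`, `y` and `x + y` were all isotropic for the form `⟨·, qᵏ ·⟩`, the product
  -- of `x` and `y` would vanish.
  by_contra! hcon
  have h1 := hcon k x hxW (hspec x hxW hx0)
  have h2 := hcon k y hyW (hspec y hyW hy0)
  have h3 := hcon k (x + y) (W.add_mem hxW hyW) (hspec _ (W.add_mem hxW hyW) (by
    rw [map_add, hx0, hy0, add_zero]))
  rw [map_add, dotProduct_add, add_dotProduct, add_dotProduct, h1, h2, hyx] at h3
  exact hxk (by linear_combination h3 / 2)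

/-- Chains are indexed from the eigenvector upwards, so the generator `v` sits at the top index `k`
and the exponents run backwards. -/
theorem isJordanChain_shift_pow {z : ℂ} {k : ℕ} {v : Fin 4 ⊕ Fin 4 → ℂ}
    (hv : (shift P z ^ (k + 1)) v = 0) :
    IsJordanChain P z (fun i : Fin (k + 1) => (shift P z ^ (k - i)) v) := by
  refine ⟨fun i hi => ?_, fun i j hij => ?_⟩
  · rw [mulVec_eq_shift z, ← Module.End.mul_apply, ← pow_succ', hi, Nat.sub_zero, hv, add_zero]
  · rw [mulVec_eq_shift z, ← Module.End.mul_apply, ← pow_succ']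
    congr 3
    have := j.2
    omega

theorem IsJordanChain.mulVec_mem_span {z : ℂ} {m : ℕ} {v : Fin m → Fin 4 ⊕ Fin 4 → ℂ}
    (h : IsJordanChain P z v) (k : Fin m) : P *ᵥ v k ∈ Submodule.span ℂ (Set.range v) := by
  obtain ⟨k, hk⟩ := k
  cases k with
  | zero =>
    rw [h.1 _ rfl]
    exact Submodule.smul_mem _ _ (Submodule.subset_span ⟨_, rfl⟩)
  | succ k =>
    rw [h.2 ⟨k, by omega⟩ _ rfl]
    exact Submodule.add_mem _ (Submodule.smul_mem _ _ (Submodule.subset_span ⟨_, rfl⟩))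
      (Submodule.subset_span ⟨_, rfl⟩)

end

/-! ### Splitting off mirrored pairs and single strings. -/

section

variable {P : Matrix (Fin 4 ⊕ Fin 4) (Fin 4 ⊕ Fin 4) ℂ} {W : Submodule ℂ (Fin 4 ⊕ Fin 4 → ℂ)}

/-- Constituents obtained by splitting off Jordan chains: pairs with right eigenvalue and single
odd strings. -/
def PBlock.IsAtom : PBlock → Prop
  | .pair m z => m ≠ 0 ∧ IsRight z
  | .degenerate _ p q => Odd p ∧ q = 0

theorem IsSymmOdd.shift_zero_pow_mirror (hP : IsSymmOdd P) (k : ℕ) (x : Fin 4 ⊕ Fin 4 → ℂ) :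
    (shift P 0 ^ k) (mirror x) = (-1 : ℂ) ^ k • mirror ((shift P 0 ^ k) x) := by
  induction k with
  | zero => simp
  | succ k ih =>
    rw [pow_succ', Module.End.mul_apply, ih, map_smul, shift_apply, zero_smul, sub_zero, hP.odd,
      Module.End.mul_apply, shift_apply, zero_smul, sub_zero, pow_succ']
    module

/-- Generalized eigenvectors for `z` and `-z` are orthogonal if `z ≠ 0`. -/
theorem IsSymmOdd.shift_pow_dotProduct_mirror (hP : IsSymmOdd P) {z : ℂ} (hz : z ≠ 0) {k : ℕ}
    {v : Fin 4 ⊕ Fin 4 → ℂ} (hv : (shift P z ^ (k + 1)) v = 0) (i j : ℕ) :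
    (shift P z ^ i) v ⬝ᵥ mirror ((shift P z ^ j) v) = 0 := by
  have hvanish : ∀ i, k + 1 ≤ i → (shift P z ^ i) v = 0 := by
    intro i hi
    rw [← Nat.sub_add_cancel hi, pow_add, Module.End.mul_apply, hv, map_zero]
  have hm0 : mirror (0 : Fin 4 ⊕ Fin 4 → ℂ) = 0 := by
    ext i; cases i <;> simp [mirror]
  -- Descending induction on `i + j`: beyond `2 k` one of the two vectors is zero, and moving `P`
  -- across the product expresses `2 z` times it through products with larger `i + j`.
  suffices h : ∀ d i j, 2 * k + 1 ≤ i + j + d →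
      (shift P z ^ i) v ⬝ᵥ mirror ((shift P z ^ j) v) = 0 from h (2 * k + 1) i j (by omega)
  intro d
  induction d with
  | zero =>
    intro i j hij
    rcases le_or_gt (k + 1) i with h | h
    · rw [hvanish i h, zero_dotProduct]
    · rw [hvanish j (by omega), hm0, dotProduct_zero]
  | succ d ih =>
    intro i j hij
    have h1 := ih (i + 1) j (by omega)
    have h2 := ih i (j + 1) (by omega)
    have h3 := hP.symm ((shift P z ^ i) v) (mirror ((shift P z ^ j) v))
    rw [hP.odd, mulVec_eq_shift z, mulVec_eq_shift z ((shift P z ^ j) v), ← Module.End.mul_apply,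
      ← Module.End.mul_apply, ← pow_succ', ← pow_succ', mirror_add, mirror_smul, add_dotProduct,
      dotProduct_neg, dotProduct_add, smul_dotProduct, dotProduct_smul, h1, h2, smul_eq_mul] at h3
    have h4 : z * ((shift P z ^ i) v ⬝ᵥ mirror ((shift P z ^ j) v)) = 0 := by
      linear_combination h3 / 2
    exact (mul_eq_zero.1 h4).resolve_left hz

theorem mirror_mem_span_range_sum_elim {m : ℕ} (u : Fin m → Fin 4 ⊕ Fin 4 → ℂ)
    (i : Fin m ⊕ Fin m) : mirror (Sum.elim u (fun k => mirror (u k)) i) ∈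
      Submodule.span ℂ (Set.range (Sum.elim u (fun k => mirror (u k)))) := by
  rcases i with i | i
  · exact Submodule.subset_span ⟨Sum.inr i, rfl⟩
  · exact Submodule.subset_span ⟨Sum.inl i, (mirror_mirror _).symm⟩

/-- Splitting off a pair of Jordan blocks exchanged by `mirror`. -/
theorem IsStableNondeg.exists_split_pair (hP : IsSymmOdd P) (hW : IsStableNondeg P W) {z : ℂ}
    {k : ℕ} {v : Fin 4 ⊕ Fin 4 → ℂ} (hvW : v ∈ W) (hv : (shift P z ^ (k + 1)) v = 0)
    (hne : v ⬝ᵥ (shift P z ^ k) v ≠ 0) (hcase : z ≠ 0 ∨ Odd k) :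
    ∃ u w, (PBlock.pair (k + 1) z).IsRealizedBy P u w ∧ ∃ W', IsStableNondeg P W' ∧
      W = Submodule.span ℂ (Set.range u ∪ Set.range w) ⊔ W' ∧
      Module.finrank ℂ W = (k + 1 + (k + 1)) + Module.finrank ℂ W' := by
  set q := shift P z with hq
  have hvanish : ∀ i, k + 1 ≤ i → (q ^ i) v = 0 := by
    intro i hi
    rw [← Nat.sub_add_cancel hi, pow_add, Module.End.mul_apply, hv, map_zero]
  let u : Fin (k + 1) → Fin 4 ⊕ Fin 4 → ℂ := fun i => (q ^ (k - i)) v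
  have hchain : IsJordanChain P z u := isJordanChain_shift_pow hv
  have hgram : ∀ i j : Fin (k + 1), u i ⬝ᵥ u j = v ⬝ᵥ (q ^ ((k - i) + (k - j))) v :=
    fun i j => hP.shift_pow_dotProduct_shift_pow z _ _ v v
  have hgram0 : ∀ i j : Fin (k + 1), i.1 + j < k → u i ⬝ᵥ u j = 0 := by
    intro i j hij
    rw [hgram, hvanish _ (by omega), dotProduct_zero]
  have hgram1 : ∀ i : Fin (k + 1), u i ⬝ᵥ u i.rev ≠ 0 := by
    intro i
    rw [hgram, Fin.val_rev]
    have : k - i.1 + (k - (k + 1 - (i.1 + 1))) = k := by omega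
    rwa [this]
  have hcross : ∀ i j : Fin (k + 1), i.1 + j ≤ k → u i ⬝ᵥ mirror (u j) = 0 := by
    intro i j hij
    by_cases hz : z = 0
    · subst hz
      have hodd : Odd k := hcase.resolve_left (by simp)
      have h1 : mirror (u j) = (-1 : ℂ) ^ (k - j : ℕ) • (q ^ (k - j : ℕ)) (mirror v) := by
        rw [hP.shift_zero_pow_mirror, smul_smul, ← mul_pow]
        simp [u, hq]
      rw [h1, dotProduct_smul, hP.shift_pow_dotProduct_shift_pow]
      rcases hij.lt_or_eq with h | h
      · rw [hP.shift_zero_pow_mirror, ← hq, hvanish _ (by omega), mirror_of_inHalf (h := true)]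
        · simp
        · intro i; rfl
      · have : k - i.1 + (k - j.1) = k := by omega
        rw [this]
        -- For odd `k` the reflection anticommutes with `qᵏ`, so the form `⟨x, qᵏ (mirror y)⟩` is
        -- alternating and vanishes at `(v, v)`.
        have h2 : v ⬝ᵥ (q ^ k) (mirror v) = -(v ⬝ᵥ (q ^ k) (mirror v)) := by
          conv_lhs => rw [hP.shift_zero_pow_mirror, hodd.neg_one_pow, neg_smul, one_smul,
            dotProduct_neg, ← mirror_dotProduct, dotProduct_comm, hP.shift_pow_dotProduct]
        rw [self_eq_neg.1 h2, smul_zero]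
    · exact hP.shift_pow_dotProduct_mirror hz hv _ _
  let e : Fin (k + 1) ⊕ Fin (k + 1) → Fin 4 ⊕ Fin 4 → ℂ := Sum.elim u (fun i => mirror (u i))
  have hmm : ∀ x y : Fin 4 ⊕ Fin 4 → ℂ, mirror x ⬝ᵥ mirror y = x ⬝ᵥ y := fun x y => by
    rw [mirror_dotProduct, mirror_mirror]
  have hspanu : ∀ i, P *ᵥ u i ∈ Submodule.span ℂ (Set.range e) := fun i =>
    Submodule.span_mono (by rintro _ ⟨i, rfl⟩; exact ⟨Sum.inl i, rfl⟩) (hchain.mulVec_mem_span i)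
  have hmirror : ∀ x ∈ Submodule.span ℂ (Set.range e), mirror x ∈ Submodule.span ℂ (Set.range e) := by
    intro x hx
    induction hx using Submodule.span_induction with
    | mem y hy => obtain ⟨i, rfl⟩ := hy; exact mirror_mem_span_range_sum_elim u i
    | zero =>
      rw [mirror_of_inHalf (h := true) (fun i => rfl)]
      simp
    | add y z _ _ hy hz => rw [mirror_add]; exact Submodule.add_mem _ hy hz
    | smul c y _ hy => rw [mirror_smul]; exact Submodule.smul_mem _ _ hy
  have heW : ∀ i, e i ∈ W := by
    rintro (i | i)
    · exact hW.shift_pow_mem _ _ hvW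
    · exact hW.mirror_mem _ (hW.shift_pow_mem _ _ hvW)
  have hPe : ∀ i, P *ᵥ e i ∈ Submodule.span ℂ (Set.range e) := by
    rintro (i | i)
    · exact hspanu i
    · change P *ᵥ mirror (u i) ∈ _
      rw [hP.odd]
      exact Submodule.neg_mem _ (hmirror _ (hspanu i))
  have hdiag : ∀ i, e i ⬝ᵥ e (Sum.map Fin.rev Fin.rev i) ≠ 0 := by
    rintro (i | i)
    · exact hgram1 i
    · change mirror (u i) ⬝ᵥ mirror (u i.rev) ≠ 0
      rw [hmm]
      exact hgram1 i
  -- Products of entries with index sum below `k` vanish, and those of a chain with its mirror also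
  -- at sum `k`. The Gram matrix is thus antitriangular for the chain index as level and index
  -- reversal as partner.
  let l : Fin (k + 1) ⊕ Fin (k + 1) → ℕ := Sum.elim (fun i => (i : ℕ)) (fun i => (i : ℕ))
  have hzero : ∀ i j, j ≠ i → l j ≤ l i → e j ⬝ᵥ e (Sum.map Fin.rev Fin.rev i) = 0 := by
    intro i j hij hle
    rcases i with i | i <;> rcases j with j | j <;>
      simp only [l, Sum.elim_inl, Sum.elim_inr] at hle
    · have h1 : j ≠ i := fun h => hij (by rw [h])
      have h2 : j.1 ≠ i.1 := fun h => h1 (Fin.ext h)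
      exact hgram0 _ _ (by rw [Fin.val_rev]; omega)
    · change mirror (u j) ⬝ᵥ u i.rev = 0
      rw [mirror_dotProduct]
      exact hcross _ _ (by rw [Fin.val_rev]; omega)
    · exact hcross _ _ (by rw [Fin.val_rev]; omega)
    · have h1 : j ≠ i := fun h => hij (by rw [h])
      have h2 : j.1 ≠ i.1 := fun h => h1 (Fin.ext h)
      change mirror (u j) ⬝ᵥ mirror (u i.rev) = 0
      rw [hmm]
      exact hgram0 _ _ (by rw [Fin.val_rev]; omega)
  obtain ⟨W', hW', hsup, hfin⟩ := hW.exists_split hP e heW hPe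
    (mirror_mem_span_range_sum_elim u) (Sum.map Fin.rev Fin.rev) l hdiag hzero
  refine ⟨u, fun i => mirror (u i), ⟨hchain, fun _ => rfl⟩, W', hW', ?_, ?_⟩
  · rw [hsup]
    congr 2
    exact Set.Sum.elim_range u _
  · rw [hfin, Fintype.card_sum, Fintype.card_fin]

theorem inHalf_of_mirror {h : Bool} {v : Fin 4 ⊕ Fin 4 → ℂ}
    (hv : mirror v = (if h then (1 : ℂ) else -1) • v) : InHalf h v := by
  cases h
  · intro i
    have := congrFun hv (Sum.inl i)
    simp [mirror] at this
    exact self_eq_neg.1 this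
  · intro i
    have := congrFun hv (Sum.inr i)
    simp [mirror] at this
    exact self_eq_neg.1 this.symm

/-- Splitting off a single string of odd length. -/
theorem IsStableNondeg.exists_split_string (hP : IsSymmOdd P) (hW : IsStableNondeg P W)
    {k : ℕ} (hk : Even k) {v : Fin 4 ⊕ Fin 4 → ℂ} (hvW : v ∈ W)
    (hv : (shift P 0 ^ (k + 1)) v = 0) (hne : v ⬝ᵥ (shift P 0 ^ k) v ≠ 0) {h : Bool}
    (hh : InHalf h v) :
    ∃ u w, (PBlock.degenerate h (k + 1) 0).IsRealizedBy P u w ∧ ∃ W', IsStableNondeg P W' ∧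
      W = Submodule.span ℂ (Set.range u ∪ Set.range w) ⊔ W' ∧
      Module.finrank ℂ W = (k + 1 + 0) + Module.finrank ℂ W' := by
  set q := shift P 0 with hq
  have hvanish : ∀ i, k + 1 ≤ i → (q ^ i) v = 0 := by
    intro i hi
    rw [← Nat.sub_add_cancel hi, pow_add, Module.End.mul_apply, hv, map_zero]
  let u : Fin (k + 1) → Fin 4 ⊕ Fin 4 → ℂ := fun i => (q ^ (k - i)) v
  have hchain : IsJordanChain P 0 u := isJordanChain_shift_pow hv
  have hgram : ∀ i j : Fin (k + 1), u i ⬝ᵥ u j = v ⬝ᵥ (q ^ ((k - i) + (k - j))) v :=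
    fun i j => hP.shift_pow_dotProduct_shift_pow 0 _ _ v v
  have hmu : ∀ i : Fin (k + 1),
      mirror (u i) = (if (if Even (i : ℕ) then h else !h) then (1 : ℂ) else -1) • u i := by
    intro i
    have h1 := hP.shift_zero_pow_mirror (k - i) v
    rw [mirror_of_inHalf hh, map_smul] at h1
    have h2 : mirror (u i) = (-1 : ℂ) ^ (k - i : ℕ) • (-1 : ℂ) ^ (k - i : ℕ) • mirror (u i) := by
      rw [smul_smul, ← mul_pow]; simp
    rw [h2, ← h1, smul_smul]
    congr 1
    -- Because `k` is even, the eigenvector end of the string lies in the same half as its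
    -- generator.
    have hpar : Even (k - i.1) ↔ Even i.1 := by
      rw [Nat.even_sub (by omega)]; simp [hk]
    by_cases hi : Even i.1
    · rw [(hpar.2 hi).neg_one_pow, if_pos hi, one_mul]
    · rw [(Nat.not_even_iff_odd.1 (fun hc => hi (hpar.1 hc))).neg_one_pow, if_neg hi]
      cases h <;> simp
  have hdiag : ∀ i : Fin (k + 1), u i ⬝ᵥ u i.rev ≠ 0 := by
    intro i
    rw [hgram, Fin.val_rev]
    have : k - i.1 + (k - (k + 1 - (i.1 + 1))) = k := by omega
    rwa [this]
  have hzero : ∀ i j : Fin (k + 1), j ≠ i → (j : ℕ) ≤ i → u j ⬝ᵥ u i.rev = 0 := by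
    intro i j hij hle
    have h2 : j.1 ≠ i.1 := fun h => hij (Fin.ext h)
    rw [hgram, Fin.val_rev, hvanish _ (by omega), dotProduct_zero]
  obtain ⟨W', hW', hsup, hfin⟩ := hW.exists_split hP u (fun i => hW.shift_pow_mem _ _ hvW)
    hchain.mulVec_mem_span
    (fun i => by rw [hmu]; exact Submodule.smul_mem _ _ (Submodule.subset_span ⟨i, rfl⟩)) Fin.rev
    (fun i => (i : ℕ)) hdiag hzero
  refine ⟨u, fun i : Fin 0 => i.elim0, ⟨hchain, ⟨fun i => i.elim0, fun i => i.elim0⟩,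
    fun i => inHalf_of_mirror (hmu i), fun i => i.elim0⟩, W', hW', ?_, ?_⟩
  · rw [hsup]
    congr 2
    refine (Set.union_empty _).symm.trans ?_
    congr 1
    exact (Set.range_eq_empty_iff.2 (inferInstanceAs (IsEmpty (Fin 0)))).symm
  · rw [hfin, Fintype.card_fin]

/-- In the exceptional case `z = 0`, `k` even, a vector and its mirror image need not be orthogonal
for the form. The values of the form at `v + mirror v` and `v - mirror v` add up to four times its
value at `v`, so one of these vectors, each lying in a half, generates a string. -/
theorem IsStableNondeg.exists_split_atom (hP : IsSymmOdd P) (hW : IsStableNondeg P W)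
    (hne : W ≠ ⊥) : ∃ B : PBlock, B.IsAtom ∧ ∃ u w, B.IsRealizedBy P u w ∧
      ∃ W', IsStableNondeg P W' ∧ W = Submodule.span ℂ (Set.range u ∪ Set.range w) ⊔ W' ∧
      Module.finrank ℂ W = (B.fstDim + B.sndDim) + Module.finrank ℂ W' ∧
      0 < B.fstDim + B.sndDim := by
  obtain ⟨z, hz, k, v, hvW, hv, hvk⟩ := hW.exists_generator hP hne
  by_cases hcase : z ≠ 0 ∨ Odd k
  · obtain ⟨u, w, hr, W', hW', hs, hf⟩ := hW.exists_split_pair hP hvW hv hvk hcase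
    exact ⟨.pair (k + 1) z, ⟨k.succ_ne_zero, hz⟩, u, w, hr, W', hW', hs, hf,
      Nat.add_pos_left k.succ_pos _⟩
  · push Not at hcase
    obtain ⟨rfl, hk⟩ := hcase
    rw [Nat.not_odd_iff_even] at hk
    have half : ∀ (h : Bool) (x : Fin 4 ⊕ Fin 4 → ℂ), x ∈ W → InHalf h x →
        (shift P 0 ^ (k + 1)) x = 0 → x ⬝ᵥ (shift P 0 ^ k) x ≠ 0 → ∃ B : PBlock, B.IsAtom ∧
        ∃ u w, B.IsRealizedBy P u w ∧
        ∃ W', IsStableNondeg P W' ∧ W = Submodule.span ℂ (Set.range u ∪ Set.range w) ⊔ W' ∧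
        Module.finrank ℂ W = (B.fstDim + B.sndDim) + Module.finrank ℂ W' ∧
        0 < B.fstDim + B.sndDim := by
      intro h x hxW hx hx0 hxk
      obtain ⟨u, w, hr, W', hW', hs, hf⟩ := hW.exists_split_string hP hk hxW hx0 hxk hx
      exact ⟨.degenerate h (k + 1) 0, ⟨hk.add_one, rfl⟩, u, w, hr, W', hW', hs, hf,
        Nat.add_pos_left k.succ_pos _⟩
    have hmv : (shift P 0 ^ (k + 1)) (mirror v) = 0 := by
      rw [hP.shift_zero_pow_mirror, hv, mirror_of_inHalf (h := true) (fun i => rfl)]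
      simp
    have hx : InHalf true (v + mirror v) := fun i => by simp [mirror]
    have hy : InHalf false (v - mirror v) := fun i => by simp [mirror]
    have hmW := hW.mirror_mem v hvW
    by_cases hx0 : (v + mirror v) ⬝ᵥ (shift P 0 ^ k) (v + mirror v) = 0
    · refine half false _ (W.sub_mem hvW hmW) hy (by rw [map_sub, hv, hmv, sub_zero]) ?_
      intro hy0
      have hmk : mirror v ⬝ᵥ (shift P 0 ^ k) (mirror v) = v ⬝ᵥ (shift P 0 ^ k) v := by
        rw [hP.shift_zero_pow_mirror, hk.neg_one_pow, one_smul, mirror_dotProduct, mirror_mirror]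
      rw [map_add, dotProduct_add, add_dotProduct, add_dotProduct, hmk] at hx0
      rw [map_sub, dotProduct_sub, sub_dotProduct, sub_dotProduct, hmk] at hy0
      exact hvk (by linear_combination (hx0 + hy0) / 4)
    · exact half true _ (W.add_mem hvW hmW) hx (by rw [map_add, hv, hmv, add_zero]) hx0

theorem IsStableNondeg.exists_decomp (hP : IsSymmOdd P) (hW : IsStableNondeg P W) :
    ∃ L : List PBlock, (∀ B ∈ L, B.IsAtom) ∧ Decomp P L W ∧ totalDim L = Module.finrank ℂ W := by
  induction hn : Module.finrank ℂ W using Nat.strong_induction_on generalizing W with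
  | _ n ih =>
    by_cases hne : W = ⊥
    · subst hne
      exact ⟨[], by simp, rfl, by simpa [totalDim] using hn⟩
    · obtain ⟨B, hB, u, w, hr, W', hW', hs, hf, hpos⟩ := hW.exists_split_atom hP hne
      obtain ⟨L, hL, hd, ht⟩ := ih _ (by omega) hW' rfl
      refine ⟨B :: L, ?_, ⟨u, w, hr, W', hd, hs⟩, ?_⟩
      · simpa using ⟨hB, hL⟩
      · rw [totalDim, List.map_cons, List.sum_cons, ← totalDim, ht, ← hn, hf]

end

section

variable {P : Matrix (Fin 4 ⊕ Fin 4) (Fin 4 ⊕ Fin 4) ℂ} {W : Submodule ℂ (Fin 4 ⊕ Fin 4 → ℂ)}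

/-! ### The two halves have the same dimension -/

/-- The sign of `mirror` on a half. -/
def halfSign (h : Bool) : ℤ := if h then 1 else -1

/-- The trace of `mirror` on the span of a realization of a block. -/
def PBlock.signature : PBlock → ℤ
  | .pair _ _ => 0
  | .degenerate h p q => ∑ k : Fin p, halfSign (if Even (k : ℕ) then h else !h) +
      ∑ k : Fin q, halfSign (if Even (k : ℕ) then !h else h)

theorem mirror_eq_halfSign {h : Bool} {v : Fin 4 ⊕ Fin 4 → ℂ} (hv : InHalf h v) :
    mirror v = (halfSign h : ℂ) • v := by
  rw [mirror_of_inHalf hv]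
  cases h <;> simp [halfSign]

/-- The trace of the reflection is `4 - 4 = 0` in the standard basis. In the basis of the
realization, mirrored pairs contribute nothing on the diagonal and string vectors contribute the
sign of their half. -/
theorem HasBlockStructure.sum_signature {L : List PBlock} (h : HasBlockStructure P L) :
    (L.map PBlock.signature).sum = 0 := by
  obtain ⟨u, w, hr, hli, hsp⟩ := h
  let b := Module.Basis.mk hli hsp.ge
  have hbu : ∀ i k, b ⟨i, Sum.inl k⟩ = u i k := fun i k => by simp [b]
  have hbw : ∀ i k, b ⟨i, Sum.inr k⟩ = w i k := fun i k => by simp [b]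
  have htr : LinearMap.trace ℂ _ (Matrix.toLin' matJ) = 0 := by
    rw [Matrix.trace_toLin'_eq]
    simp [matJ, Matrix.trace]
  rw [LinearMap.trace_eq_matrix_trace ℂ b, Matrix.trace, Fintype.sum_sigma] at htr
  simp only [Matrix.diag_apply, LinearMap.toMatrix_apply, Matrix.toLin'_apply, matJ_mulVec] at htr
  have key : ∀ i : Fin L.length, ∑ k, b.repr (mirror (b ⟨i, k⟩)) ⟨i, k⟩ =
      (((L.get i).signature : ℤ) : ℂ) := by
    intro i
    rw [Fintype.sum_sum_type]
    simp only [hbu, hbw]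
    have h1 := hr i
    have hu := hbu i
    have hw := hbw i
    have hx : ∀ k l : Fin (L.get i).fstDim ⊕ Fin (L.get i).sndDim,
        b.repr (b ⟨i, k⟩) ⟨i, l⟩ = if k = l then 1 else 0 := by
      intro k l
      rw [b.repr_self, Finsupp.single_apply]
      simp
    have hxu : ∀ k l, b.repr (u i k) ⟨i, l⟩ = if Sum.inl k = l then 1 else 0 := fun k l => by
      rw [← hu, hx]
    have hxw : ∀ k l, b.repr (w i k) ⟨i, l⟩ = if Sum.inr k = l then 1 else 0 := fun k l => by
      rw [← hw, hx]
    generalize hR : (fun (v : Fin 4 ⊕ Fin 4 → ℂ) (k : Fin (L.get i).fstDim ⊕ Fin (L.get i).sndDim) =>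
      b.repr v ⟨i, k⟩) = R
    have hRa : ∀ v k, b.repr v ⟨i, k⟩ = R v k := fun v k => by rw [← hR]
    have hsm : ∀ (c : ℂ) v k, R (c • v) k = c * R v k := fun c v k => by
      rw [← hRa, ← hRa, map_smul]; rfl
    simp only [hRa] at hxu hxw ⊢
    clear hx hRa hR hu hw
    generalize u i = a at *
    generalize w i = c at *
    generalize L.get i = B at *
    cases B with
    | pair m z =>
      obtain ⟨-, h2⟩ := h1
      change Fin m → Fin 4 ⊕ Fin 4 → ℂ at a c
      change (Fin 4 ⊕ Fin 4 → ℂ) → Fin m ⊕ Fin m → ℂ at R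
      change ∀ (k : Fin m) (l : Fin m ⊕ Fin m), _ at hxu hxw
      change ∀ k : Fin m, c k = mirror (a k) at h2
      change ∑ k : Fin m, R (mirror (a k)) (Sum.inl k) + ∑ k : Fin m,
          R (mirror (c k)) (Sum.inr k) = _
      simp only [← h2]
      simp only [h2, mirror_mirror]
      simp only [← h2, hxu, hxw]
      simp [PBlock.signature]
    | degenerate h p q =>
      obtain ⟨-, -, h3, h4⟩ := h1
      change Fin p → Fin 4 ⊕ Fin 4 → ℂ at a
      change Fin q → Fin 4 ⊕ Fin 4 → ℂ at c
      change (Fin 4 ⊕ Fin 4 → ℂ) → Fin p ⊕ Fin q → ℂ at R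
      change ∀ (k : Fin p) (l : Fin p ⊕ Fin q), _ at hxu
      change ∀ (k : Fin q) (l : Fin p ⊕ Fin q), _ at hxw
      change ∀ (c : ℂ) v (k : Fin p ⊕ Fin q), _ at hsm
      change ∑ k : Fin p, R (mirror (a k)) (Sum.inl k) + ∑ k : Fin q,
          R (mirror (c k)) (Sum.inr k) = _
      have e1 : ∀ k, R (mirror (a k)) (Sum.inl k) =
          halfSign (if Even (k : ℕ) then h else !h) := fun k => by
        rw [mirror_eq_halfSign (h3 k), hsm, hxu]
        exact (congrArg _ (if_pos rfl)).trans (mul_one _)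
      have e2 : ∀ k, R (mirror (c k)) (Sum.inr k) =
          halfSign (if Even (k : ℕ) then !h else h) := fun k => by
        rw [mirror_eq_halfSign (h4 k), hsm, hxw]
        exact (congrArg _ (if_pos rfl)).trans (mul_one _)
      simp only [e1, e2, PBlock.signature]
      push_cast
      rfl
  simp only [key] at htr
  rw [← Fin.sum_univ_fun_getElem]
  exact_mod_cast htr

theorem sum_alternating_halfSign {h : Bool} {p : ℕ} (hp : Odd p) :
    ∑ k : Fin p, halfSign (if Even (k : ℕ) then h else !h) = halfSign h := by
  obtain ⟨n, rfl⟩ := hp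
  rw [Fin.sum_univ_eq_sum_range (fun k => halfSign (if Even k then h else !h))]
  induction n with
  | zero => simp
  | succ n ih =>
    rw [show 2 * (n + 1) + 1 = 2 * n + 1 + 1 + 1 by ring, Finset.sum_range_succ,
      Finset.sum_range_succ, ih]
    have h1 : ¬ Even (2 * n + 1) := by simp
    have h2 : Even (2 * n + 1 + 1) := ⟨n + 1, by ring⟩
    rw [if_neg h1, if_pos h2]
    cases h <;> simp [halfSign]

theorem signature_string {h : Bool} {p : ℕ} (hp : Odd p) :
    (PBlock.degenerate h p 0).signature = halfSign h := by
  simp [PBlock.signature, sum_alternating_halfSign hp]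

/-! ### Pairing the strings -/

theorem Decomp.cons_of_imp {B : PBlock} {L L' : List PBlock}
    (h : ∀ W, Decomp P L W → Decomp P L' W) (hW : Decomp P (B :: L) W) : Decomp P (B :: L') W := by
  obtain ⟨u, w, hr, W', hW', rfl⟩ := hW
  exact ⟨u, w, hr, W', h _ hW', rfl⟩

theorem Decomp.split_strings {h : Bool} {p q : ℕ} {L : List PBlock}
    (hW : Decomp P (.degenerate h p q :: L) W) :
    Decomp P (.degenerate h p 0 :: .degenerate (!h) q 0 :: L) W := by
  obtain ⟨u, w, ⟨h1, h2, h3, h4⟩, W', hW', rfl⟩ := hW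
  refine ⟨u, fun i : Fin 0 => i.elim0, ⟨h1, ⟨fun i => i.elim0, fun i => i.elim0⟩, h3,
    fun i => i.elim0⟩, _, ⟨w, fun i : Fin 0 => i.elim0, ⟨h2, ⟨fun i => i.elim0, fun i => i.elim0⟩,
      by simpa using h4, fun i => i.elim0⟩, W', hW', rfl⟩, ?_⟩
  have h0 : Set.range (fun i : Fin 0 => (i.elim0 : Fin 4 ⊕ Fin 4 → ℂ)) = ∅ :=
    Set.range_eq_empty_iff.2 inferInstance
  have h1 : Set.range (α := Fin 4 ⊕ Fin 4 → ℂ)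
    (ι := Fin (PBlock.degenerate h p 0).sndDim) (fun i : Fin 0 => i.elim0) = ∅ := h0
  have h2 : Set.range (α := Fin 4 ⊕ Fin 4 → ℂ)
    (ι := Fin (PBlock.degenerate (!h) q 0).sndDim) (fun i : Fin 0 => i.elim0) = ∅ := h0
  rw [h1, h2, Set.union_empty, Set.union_empty, Submodule.span_union, sup_assoc]
  rfl

/-- Pairs with right eigenvalue and degenerated pairs of different odd lengths. -/
def PBlock.IsReduced : PBlock → Prop
  | .pair m z => m ≠ 0 ∧ IsRight z
  | .degenerate _ p q => Odd p ∧ Odd q ∧ q < p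

theorem isRight_zero : IsRight 0 := Or.inr ⟨rfl, le_rfl⟩

/-- Every string of odd length has the signature of its starting half. If no string starts in the
opposite half, nothing can cancel the contribution of this one. -/
theorem not_mem_string_of_signature {h : Bool} {L : List PBlock} (hL : ∀ B ∈ L, B.IsAtom)
    (hs : (L.map PBlock.signature).sum = 0) (hf : ¬ ∃ q, PBlock.degenerate (!h) q 0 ∈ L) (p : ℕ) :
    PBlock.degenerate h p 0 ∉ L := by
  intro hp
  have hnonneg : ∀ L' : List PBlock, (∀ B ∈ L', B ∈ L) →
      0 ≤ halfSign h * (L'.map PBlock.signature).sum := by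
    intro L' hL'
    induction L' with
    | nil => simp
    | cons B L' ih =>
      rw [List.map_cons, List.sum_cons, mul_add]
      refine add_nonneg ?_ (ih fun C hC => hL' C (List.mem_cons_of_mem _ hC))
      have hB := hL' B List.mem_cons_self
      rcases B with ⟨m, z⟩ | ⟨h', p', q'⟩
      · simp [PBlock.signature]
      · obtain ⟨hodd, rfl⟩ := hL _ hB
        have hh : h' = h := by
          by_contra hne
          exact hf ⟨p', by rwa [Bool.eq_not.2 hne] at hB⟩
        rw [signature_string hodd, hh]
        cases h <;> simp [halfSign]
  classical
  have h1 := List.perm_cons_erase hp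
  have h2 := hnonneg (L.erase (.degenerate h p 0)) fun B hB => List.mem_of_mem_erase hB
  rw [(h1.map _).sum_eq, List.map_cons, List.sum_cons, signature_string (hL _ hp).1] at hs
  generalize ((L.erase (PBlock.degenerate h p 0)).map PBlock.signature).sum = t at hs h2
  cases h <;> simp [halfSign] at hs h2 <;> omega

theorem exists_string_of_signature {L : List PBlock} (hL : ∀ B ∈ L, B.IsAtom)
    (hs : (L.map PBlock.signature).sum = 0) :
    (∀ B ∈ L, B.IsReduced) ∨ ∃ p q L', Odd p ∧ Odd q ∧
      L.Perm (.degenerate true p 0 :: .degenerate false q 0 :: L') := by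
  by_cases ht : ∃ p, PBlock.degenerate true p 0 ∈ L <;>
    by_cases hf : ∃ q, PBlock.degenerate false q 0 ∈ L
  · obtain ⟨p, hp⟩ := ht
    obtain ⟨q, hq⟩ := hf
    obtain ⟨L1, h1⟩ : ∃ L1, L.Perm (.degenerate true p 0 :: L1) := ⟨_, by
      classical exact List.perm_cons_erase hp⟩
    have hq1 : PBlock.degenerate false q 0 ∈ L1 := by
      simpa using h1.mem_iff.1 hq
    obtain ⟨L2, h2⟩ : ∃ L2, L1.Perm (.degenerate false q 0 :: L2) := ⟨_, by
      classical exact List.perm_cons_erase hq1⟩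
    exact Or.inr ⟨p, q, L2, (hL _ hp).1, (hL _ hq).1, h1.trans (h2.cons _)⟩
  · obtain ⟨p, hp⟩ := ht
    exact absurd hp (not_mem_string_of_signature (h := true) hL hs hf p)
  · obtain ⟨q, hq⟩ := hf
    exact absurd hq (not_mem_string_of_signature (h := false) hL hs ht q)
  · left
    rintro (⟨m, z⟩ | ⟨h, p, q⟩) hB
    · exact hL _ hB
    · obtain ⟨-, rfl⟩ := hL _ hB
      cases h
      · exact absurd ⟨p, hB⟩ hf
      · exact absurd ⟨p, hB⟩ ht

/-- While strings remain, two of them start in opposite halves. They are removed together: as an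
ordinary pair with eigenvalue zero if their lengths agree, otherwise as a degenerated pair with the
longer string first. -/
theorem Decomp.exists_reduced (n : ℕ) : ∀ L : List PBlock, L.length = n → (∀ B ∈ L, B.IsAtom) →
    (L.map PBlock.signature).sum = 0 → ∃ L' : List PBlock, (∀ B ∈ L', B.IsReduced) ∧
      totalDim L' = totalDim L ∧ ∀ W, Decomp P L W → Decomp P L' W := by
  induction n using Nat.strong_induction_on with
  | _ n ih =>
    intro L hn hL hs
    rcases exists_string_of_signature hL hs with h | ⟨p, q, L1, hp, hq, hperm⟩
    · exact ⟨L, h, rfl, fun W h => h⟩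
    · have hlen := hperm.length_eq
      have hs1 := (hperm.map PBlock.signature).sum_eq
      simp only [List.map_cons, List.sum_cons, signature_string hp, signature_string hq] at hs1
      obtain ⟨L2, h2, ht, hd⟩ := ih L1.length (by simp at hlen; omega) L1 rfl
        (fun B hB => hL B (hperm.mem_iff.2 (by simp [hB])))
        (by simp [halfSign] at hs1; omega)
      have htd := totalDim_perm hperm
      rcases lt_trichotomy p q with hpq | rfl | hpq
      · refine ⟨.degenerate false q p :: L2, ?_, ?_, fun W hW => ?_⟩
        · simpa using ⟨⟨hq, hp, hpq⟩, h2⟩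
        · rw [htd]
          simp [totalDim, PBlock.fstDim, PBlock.sndDim] at ht ⊢
          omega
        · exact Decomp.cons_of_imp hd (Decomp.merge_strings (h := false)
            ((hW.perm hperm).perm (List.Perm.swap _ _ _)))
      · refine ⟨.pair p 0 :: L2, ?_, ?_, fun W hW => ?_⟩
        · simpa using ⟨⟨hp.pos.ne', isRight_zero⟩, h2⟩
        · rw [htd]
          simp [totalDim, PBlock.fstDim, PBlock.sndDim] at ht ⊢
          omega
        · exact Decomp.cons_of_imp hd (Decomp.merge_strings_pair (h := true) (hW.perm hperm))
      · refine ⟨.degenerate true p q :: L2, ?_, ?_, fun W hW => ?_⟩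
        · simpa using ⟨⟨hp, hq, hpq⟩, h2⟩
        · rw [htd]
          simp [totalDim, PBlock.fstDim, PBlock.sndDim] at ht ⊢
          omega
        · exact Decomp.cons_of_imp hd (Decomp.merge_strings (h := true) (hW.perm hperm))

/-! ### The possible block structures -/

/-- The block structures of `8 × 8` matrices, up to the exchange of the two halves. -/
inductive IsStandard : List PBlock → Prop
  | family (F : Family) (hF : ∀ z ∈ F.eigenvalues, IsRight z) : IsStandard F.blocks
  | three_one (x y : ℂ) : IsStandard [.pair 1 x, .pair 1 y, .degenerate true 3 1]
  | five_one (x : ℂ) : IsStandard [.pair 1 x, .degenerate true 5 1]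

/-- Half of the dimension of a reduced block. -/
def PBlock.half (B : PBlock) : ℕ := (B.fstDim + B.sndDim) / 2

theorem PBlock.IsReduced.half_spec {B : PBlock} (h : B.IsReduced) :
    2 * B.half = B.fstDim + B.sndDim ∧ 0 < B.half := by
  rcases B with ⟨m, z⟩ | ⟨h', p, q⟩
  · have := Nat.pos_of_ne_zero h.1
    simp only [half, fstDim, sndDim]
    omega
  · obtain ⟨⟨a, rfl⟩, ⟨b, rfl⟩, h⟩ := h
    simp only [half, fstDim, sndDim]
    omega

theorem PBlock.IsReduced.cases {B : PBlock} (h : B.IsReduced) (h4 : B.half ≤ 4) :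
    (∃ z, IsRight z ∧ B = .pair B.half z) ∨
    (∃ b, B = .degenerate b 3 1 ∧ B.half = 2) ∨
    (∃ b, B = .degenerate b 5 1 ∧ B.half = 3) ∨
    (∃ b, B = .degenerate b 7 1 ∧ B.half = 4) ∨
    (∃ b, B = .degenerate b 5 3 ∧ B.half = 4) := by
  rcases B with ⟨m, z⟩ | ⟨h', p, q⟩
  · left
    refine ⟨z, h.2, ?_⟩
    simp only [half, fstDim, sndDim]
    congr 1
    omega
  · right
    obtain ⟨⟨a, rfl⟩, ⟨b, rfl⟩, h⟩ := h
    simp only [half, fstDim, sndDim] at h4 ⊢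
    -- For lengths `2 a + 1` and `2 b + 1` the half-dimension is `a + b + 1`, at most four, and `b <
    -- a`.
    have : (a = 1 ∧ b = 0) ∨ (a = 2 ∧ b = 0) ∨ (a = 3 ∧ b = 0) ∨ (a = 2 ∧ b = 1) := by omega
    rcases this with ⟨rfl, rfl⟩ | ⟨rfl, rfl⟩ | ⟨rfl, rfl⟩ | ⟨rfl, rfl⟩ <;> simp

end

/-! ### Enumeration of the reduced block lists of half-dimension four. -/

section

variable {P : Matrix (Fin 4 ⊕ Fin 4) (Fin 4 ⊕ Fin 4) ℂ} {W : Submodule ℂ (Fin 4 ⊕ Fin 4 → ℂ)}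

/-- Half of the total dimension of a list of blocks. -/
def totalHalf (L : List PBlock) : ℕ := (L.map PBlock.half).sum

theorem two_mul_totalHalf {L : List PBlock} (hL : ∀ B ∈ L, B.IsReduced) :
    2 * totalHalf L = totalDim L := by
  induction L with
  | nil => rfl
  | cons B L ih =>
    have h1 := ih fun C hC => hL C (List.mem_cons_of_mem _ hC)
    have h2 := (hL B List.mem_cons_self).half_spec.1
    simp only [totalHalf, totalDim, List.map_cons, List.sum_cons] at h1 ⊢
    omega

theorem eq_nil_of_totalHalf {L : List PBlock} (hL : ∀ B ∈ L, B.IsReduced) (h : totalHalf L = 0) :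
    L = [] := by
  cases L with
  | nil => rfl
  | cons B L =>
    have h2 := (hL B List.mem_cons_self).half_spec.2
    simp only [totalHalf, List.map_cons, List.sum_cons] at h
    omega

theorem exists_cons_of_totalHalf {L : List PBlock} (hL : ∀ B ∈ L, B.IsReduced) {n : ℕ}
    (h : totalHalf L = n + 1) : ∃ B L', L = B :: L' ∧ B.IsReduced ∧ (∀ C ∈ L', C.IsReduced) ∧
      B.half + totalHalf L' = n + 1 ∧ 0 < B.half := by
  cases L with
  | nil => simp [totalHalf] at h
  | cons B L =>
    exact ⟨B, L, rfl, hL B List.mem_cons_self, fun C hC => hL C (List.mem_cons_of_mem _ hC), h,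
      (hL B List.mem_cons_self).half_spec.2⟩

theorem reduced_of_totalHalf_eq_one {L : List PBlock} (hL : ∀ B ∈ L, B.IsReduced)
    (h : totalHalf L = 1) : ∃ z, IsRight z ∧ L = [.pair 1 z] := by
  obtain ⟨B, L', rfl, hB, hL', hs, hpos⟩ := exists_cons_of_totalHalf hL h
  have h1 : B.half = 1 := by omega
  obtain rfl := eq_nil_of_totalHalf hL' (by omega)
  rcases hB.cases (by omega) with ⟨z, hz, hB⟩ | ⟨b, -, h⟩ | ⟨b, -, h⟩ | ⟨b, -, h⟩ | ⟨b, -, h⟩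
  · exact ⟨z, hz, by rw [hB, h1]⟩
  all_goals omega

theorem reduced_of_totalHalf_eq_two {L : List PBlock} (hL : ∀ B ∈ L, B.IsReduced)
    (h : totalHalf L = 2) : (∃ x y, IsRight x ∧ IsRight y ∧ L = [.pair 1 x, .pair 1 y]) ∨
      (∃ z, IsRight z ∧ L = [.pair 2 z]) ∨ ∃ b, L = [.degenerate b 3 1] := by
  obtain ⟨B, L', rfl, hB, hL', hs, hpos⟩ := exists_cons_of_totalHalf hL h
  rcases hB.cases (by omega) with ⟨z, hz, hB⟩ | ⟨b, rfl, h⟩ | ⟨b, -, h⟩ | ⟨b, -, h⟩ | ⟨b, -, h⟩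
  · have h1 : B.half = 1 ∨ B.half = 2 := by omega
    rcases h1 with h1 | h1
    · obtain ⟨y, hy, rfl⟩ := reduced_of_totalHalf_eq_one hL' (by omega)
      exact Or.inl ⟨z, y, hz, hy, by rw [hB, h1]⟩
    · obtain rfl := eq_nil_of_totalHalf hL' (by omega)
      exact Or.inr (Or.inl ⟨z, hz, by rw [hB, h1]⟩)
  · obtain rfl := eq_nil_of_totalHalf hL' (by omega)
    exact Or.inr (Or.inr ⟨b, rfl⟩)
  all_goals omega

theorem reduced_of_totalHalf_eq_three {L : List PBlock} (hL : ∀ B ∈ L, B.IsReduced)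
    (h : totalHalf L = 3) :
    (∃ x y z, IsRight x ∧ IsRight y ∧ IsRight z ∧ L.Perm [.pair 1 x, .pair 1 y, .pair 1 z]) ∨
      (∃ x y, IsRight x ∧ IsRight y ∧ L.Perm [.pair 2 x, .pair 1 y]) ∨
      (∃ z, IsRight z ∧ L.Perm [.pair 3 z]) ∨
      (∃ x b, IsRight x ∧ L.Perm [.pair 1 x, .degenerate b 3 1]) ∨
      ∃ b, L.Perm [.degenerate b 5 1] := by
  obtain ⟨B, L', rfl, hB, hL', hs, hpos⟩ := exists_cons_of_totalHalf hL h
  rcases hB.cases (by omega) with ⟨z, hz, hB⟩ | ⟨b, rfl, h⟩ | ⟨b, rfl, h⟩ | ⟨b, -, h⟩ | ⟨b, -, h⟩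
  · have h1 : B.half = 1 ∨ B.half = 2 ∨ B.half = 3 := by omega
    rcases h1 with h1 | h1 | h1 <;> rw [h1] at hB <;> subst hB
    · rcases reduced_of_totalHalf_eq_two hL' (by omega) with
        ⟨x, y, hx, hy, rfl⟩ | ⟨x, hx, rfl⟩ | ⟨b, rfl⟩
      · exact Or.inl ⟨z, x, y, hz, hx, hy, .refl _⟩
      · exact Or.inr (Or.inl ⟨x, z, hx, hz, .swap _ _ _⟩)
      · exact Or.inr (Or.inr (Or.inr (Or.inl ⟨z, b, hz, .refl _⟩)))
    · obtain ⟨y, hy, rfl⟩ := reduced_of_totalHalf_eq_one hL' (by omega)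
      exact Or.inr (Or.inl ⟨z, y, hz, hy, .refl _⟩)
    · obtain rfl := eq_nil_of_totalHalf hL' (by omega)
      exact Or.inr (Or.inr (Or.inl ⟨z, hz, .refl _⟩))
  · obtain ⟨y, hy, rfl⟩ := reduced_of_totalHalf_eq_one hL' (by omega)
    exact Or.inr (Or.inr (Or.inr (Or.inl ⟨y, b, hy, .swap _ _ _⟩)))
  · obtain rfl := eq_nil_of_totalHalf hL' (by omega)
    exact Or.inr (Or.inr (Or.inr (Or.inr ⟨b, .refl _⟩)))
  all_goals omega

/-- Two degenerated pairs `3 ⊕ 1` of opposite types can be rearranged into ordinary pairs. -/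
theorem Decomp.three_one_three_one {h : Bool}
    (hW : Decomp P [.degenerate h 3 1, .degenerate (!h) 3 1] W) :
    Decomp P [.pair 3 0, .pair 1 0] W := by
  -- The two pairs fall apart into strings of lengths 3, 1, 3, 1; the opposite starting halves allow
  -- rematching 3 with 3 and 1 with 1.
  have h1 := Decomp.cons_of_imp (fun W => Decomp.cons_of_imp fun W => Decomp.split_strings)
    hW.split_strings
  rw [Bool.not_not] at h1
  exact Decomp.cons_of_imp (fun W => Decomp.merge_strings_pair)
    ((h1.perm ((List.Perm.swap _ _ _).cons _)).merge_strings_pair.perm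
      ((List.Perm.swap _ _ _).cons _))

/-- A case analysis over the partitions of four. The flipped alternative is needed because a
degenerated pair may start in either half, whereas the standard lists fix one choice. -/
theorem exists_isStandard {L : List PBlock} (hL : ∀ B ∈ L, B.IsReduced) (ht : totalDim L = 8)
    (hd : Decomp P L W) :
    ∃ L', IsStandard L' ∧ (Decomp P L' W ∨ Decomp P (L'.map PBlock.flip) W) := by
  have hh : totalHalf L = 4 := by have := two_mul_totalHalf hL; omega
  have fam : ∀ F : Family, (∀ z ∈ F.eigenvalues, IsRight z) → Decomp P F.blocks W →
      ∃ L', IsStandard L' ∧ (Decomp P L' W ∨ Decomp P (L'.map PBlock.flip) W) :=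
    fun F hF h => ⟨_, .family F hF, Or.inl h⟩
  have fam' : ∀ F : Family, (∀ z ∈ F.eigenvalues, IsRight z) →
      Decomp P (F.blocks.map PBlock.flip) W →
      ∃ L', IsStandard L' ∧ (Decomp P L' W ∨ Decomp P (L'.map PBlock.flip) W) :=
    fun F hF h => ⟨_, .family F hF, Or.inr h⟩
  obtain ⟨B, L', rfl, hB, hL', hs, hpos⟩ := exists_cons_of_totalHalf hL hh
  rcases hB.cases (by omega) with
    ⟨z, hz, hB⟩ | ⟨b, rfl, h⟩ | ⟨b, rfl, h⟩ | ⟨b, rfl, h⟩ | ⟨b, rfl, h⟩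
  · have h1 : B.half = 1 ∨ B.half = 2 ∨ B.half = 3 ∨ B.half = 4 := by omega
    rcases h1 with h1 | h1 | h1 | h1 <;> rw [h1] at hB <;> subst hB
    · rcases reduced_of_totalHalf_eq_three hL' (by omega) with
        ⟨a, b, c, ha, hb, hc, hp⟩ | ⟨a, b, ha, hb, hp⟩ | ⟨a, ha, hp⟩ | ⟨a, b, ha, hp⟩ | ⟨b, hp⟩ <;>
      replace hd := hd.perm (hp.cons _)
      · exact fam (.Gabcd z a b c) (by simp [Family.eigenvalues, *]) hd
      · exact fam (.Labc2 z b a) (by simp [Family.eigenvalues, *])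
          (hd.perm ((List.Perm.swap _ _ _).cons _))
      · exact fam (.Lab3 a z) (by simp [Family.eigenvalues, *]) (hd.perm (List.Perm.swap _ _ _))
      · cases b
        · exact ⟨_, .three_one z a, Or.inr hd⟩
        · exact ⟨_, .three_one z a, Or.inl hd⟩
      · cases b
        · exact ⟨_, .five_one z, Or.inr hd⟩
        · exact ⟨_, .five_one z, Or.inl hd⟩
    · rcases reduced_of_totalHalf_eq_two hL' (by omega) with
        ⟨x, y, hx, hy, rfl⟩ | ⟨x, hx, rfl⟩ | ⟨b, rfl⟩
      · exact fam (.Labc2 x y z) (by simp [Family.eigenvalues, *])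
          (hd.perm ((List.Perm.swap _ _ _).trans ((List.Perm.swap _ _ _).cons _)))
      · exact fam (.La2b2 z x) (by simp [Family.eigenvalues, *]) hd
      · cases b
        · exact fam' (.La2031 z) (by simp [Family.eigenvalues, isRight_zero, *]) hd
        · exact fam (.La2031 z) (by simp [Family.eigenvalues, isRight_zero, *]) hd
    · obtain ⟨y, hy, rfl⟩ := reduced_of_totalHalf_eq_one hL' (by omega)
      exact fam (.Lab3 z y) (by simp [Family.eigenvalues, *]) hd
    · obtain rfl := eq_nil_of_totalHalf hL' (by omega)
      exact fam (.La4 z) (by simp [Family.eigenvalues, *]) hd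
  · rcases reduced_of_totalHalf_eq_two hL' (by omega) with
      ⟨x, y, hx, hy, rfl⟩ | ⟨x, hx, rfl⟩ | ⟨b', rfl⟩
    · replace hd := hd.perm ((List.Perm.swap _ _ _).trans ((List.Perm.swap _ _ _).cons _))
      cases b
      · exact ⟨_, .three_one x y, Or.inr hd⟩
      · exact ⟨_, .three_one x y, Or.inl hd⟩
    · replace hd := hd.perm (List.Perm.swap _ _ _)
      cases b
      · exact fam' (.La2031 x) (by simp [Family.eigenvalues, isRight_zero, *]) hd
      · exact fam (.La2031 x) (by simp [Family.eigenvalues, isRight_zero, *]) hd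
    · rcases Bool.eq_or_eq_not b' b with rfl | rfl
      · cases b'
        · exact fam' .L031031 (by simp [Family.eigenvalues, isRight_zero]) hd
        · exact fam .L031031 (by simp [Family.eigenvalues, isRight_zero]) hd
      · exact fam (.Lab3 0 0) (by simp [Family.eigenvalues, isRight_zero]) hd.three_one_three_one
  · obtain ⟨y, hy, rfl⟩ := reduced_of_totalHalf_eq_one hL' (by omega)
    replace hd := hd.perm (List.Perm.swap _ _ _)
    cases b
    · exact ⟨_, .five_one y, Or.inr hd⟩
    · exact ⟨_, .five_one y, Or.inl hd⟩
  · obtain rfl := eq_nil_of_totalHalf hL' (by omega)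
    cases b
    · exact fam' .L071 (by simp [Family.eigenvalues, isRight_zero]) hd
    · exact fam .L071 (by simp [Family.eigenvalues, isRight_zero]) hd
  · obtain rfl := eq_nil_of_totalHalf hL' (by omega)
    cases b
    · exact fam .L053 (by simp [Family.eigenvalues, isRight_zero]) hd
    · exact fam' .L053 (by simp [Family.eigenvalues, isRight_zero]) hd

/-! ### Exchanging the two halves -/

/-- The permutation exchanging the first two qubits with the last two. -/
def pairSwap : Equiv.Perm (Fin 4) := Equiv.swap 0 2 * Equiv.swap 1 3

theorem stateMatrix_pairSwap (ψ : State) :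
    stateMatrix (permuteQubits pairSwap ψ) = (stateMatrix ψ)ᵀ := by
  refine matrix_fin_four_ext fun i j k l => ?_
  rw [Matrix.transpose_apply, stateMatrix_apply, stateMatrix_apply, permuteQubits]
  congr 1
  funext x
  fin_cases x <;> rfl

/-- Exchanging the pairs of qubits transposes the coordinate matrix. In the magic basis this reads
`R ↦ U Rᵀ U` for the symmetric involution `U = T Tᵀ`, and the antidiagonal matrix with blocks `U`
intertwines while interchanging the halves. -/
theorem exists_pairSwap_intertwiner (ψ : State) :
    ∃ D : Matrix (Fin 4 ⊕ Fin 4) (Fin 4 ⊕ Fin 4) ℂ, IsUnit D ∧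
      D * matP ψ = matP (permuteQubits pairSwap ψ) * D ∧ D * matJ = -(matJ * D) := by
  set U := magicT * magicTᵀ with hU
  have hUU : U * U = 1 := by
    rw [hU, ← Matrix.mul_assoc, Matrix.mul_assoc magicT, magicT_transpose_mul,
      magicT_mul_spinFlip_mul]
  have hUt : Uᵀ = U := by rw [hU, Matrix.transpose_mul, Matrix.transpose_transpose]
  have hR : matR (permuteQubits pairSwap ψ) = U * (matR ψ)ᵀ * U := by
    have h1 : magicTᵀ * (magicTᴴ)ᵀ = 1 := by
      rw [← Matrix.transpose_mul, conjTranspose_mul_magicT, Matrix.transpose_one]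
    calc _ = magicT * (stateMatrix ψ)ᵀ * magicTᴴ := by rw [matR, stateMatrix_pairSwap]
      _ = magicT * (magicTᵀ * (magicTᴴ)ᵀ) * (stateMatrix ψ)ᵀ *
          ((magicTᵀ * magicT) * magicTᵀ) := by
        rw [h1, Matrix.mul_one, magicT_transpose_mul, ← magicT_conjTranspose]
      _ = U * (matR ψ)ᵀ * U := by
        rw [hU, matR, Matrix.transpose_mul, Matrix.transpose_mul]
        simp only [Matrix.mul_assoc]
  refine ⟨Matrix.fromBlocks 0 U U 0, ?_, ?_, ?_⟩
  · refine IsUnit.of_mul_eq_one (Matrix.fromBlocks 0 U U 0) ?_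
    simp [Matrix.fromBlocks_multiply, hUU]
  · rw [matP, matP, hR]
    simp only [Matrix.fromBlocks_multiply, Matrix.transpose_mul, Matrix.transpose_transpose, hUt,
      Matrix.mul_zero, Matrix.zero_mul, add_zero, zero_add, Matrix.mul_assoc, hUU, Matrix.mul_one]
  · simp [matJ, Matrix.fromBlocks_multiply, Matrix.fromBlocks_neg]

theorem PBlock.flip_flip (B : PBlock) : B.flip.flip = B := by
  cases B <;> simp [PBlock.flip]

theorem Decomp.pairSwap {ψ : State} {L : List PBlock}
    (h : Decomp (matP ψ) (L.map PBlock.flip) ⊤) :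
    Decomp (matP (permuteQubits pairSwap ψ)) L ⊤ := by
  obtain ⟨D, hD, hP, hJ⟩ := exists_pairSwap_intertwiner ψ
  have h1 := Decomp.map_flip hP hJ h
  have h2 : Submodule.map (Matrix.toLin' D) ⊤ = ⊤ := by
    rw [Submodule.map_top, LinearMap.range_eq_top]
    apply LinearMap.injective_iff_surjective.1
    rw [Matrix.toLin'_apply']
    exact Matrix.mulVec_injective_iff_isUnit.2 hD
  rw [h2, List.map_map] at h1
  have h3 : PBlock.flip ∘ PBlock.flip = id := funext PBlock.flip_flip
  rwa [h3, List.map_id] at h1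

theorem IsStandard.totalDim_eq {L : List PBlock} (h : IsStandard L) : totalDim L = 8 := by
  cases h with
  | family F _ => cases F <;> rfl
  | three_one => rfl
  | five_one => rfl

/-- Every state is equivalent to one with a standard block structure. -/
theorem exists_equivalent_hasBlockStructure (ψ : State) :
    ∃ φ L, Equivalent ψ φ ∧ IsStandard L ∧ HasBlockStructure (matP φ) L := by
  obtain ⟨L, hL, hd, ht⟩ := (isStableNondeg_top (matP ψ)).exists_decomp (isSymmOdd_matP ψ)
  have ht8 : totalDim L = 8 := by rw [ht]; simp
  obtain ⟨L₁, hL₁, ht₁, hd₁⟩ := Decomp.exists_reduced (P := matP ψ) _ L rfl hL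
    (hd.hasBlockStructure ht8).sum_signature
  obtain ⟨L₂, hL₂, h | h⟩ := exists_isStandard hL₁ (ht₁.trans ht8) (hd₁ _ hd)
  · exact ⟨ψ, L₂, .refl ψ, hL₂, h.hasBlockStructure hL₂.totalDim_eq⟩
  · exact ⟨_, L₂, equivalent_permuteQubits pairSwap ψ, hL₂,
      h.pairSwap.hasBlockStructure hL₂.totalDim_eq⟩

end

section

/-! ### Block structures of explicit states -/

/-- The embedding of `ℂ⁴` as one of the halves. -/
def inj (h : Bool) (x : Fin 4 → ℂ) : Fin 4 ⊕ Fin 4 → ℂ :=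
  if h then Sum.elim x 0 else Sum.elim 0 x

/-- The adjoint with respect to the determinant form. -/
def flipAdj (M : Matrix (Fin 4) (Fin 4) ℂ) : Matrix (Fin 4) (Fin 4) ℂ := spinFlip * Mᵀ * spinFlip

/-- The component of `flipP M` on one of the halves. -/
def component (M : Matrix (Fin 4) (Fin 4) ℂ) (h : Bool) : Matrix (Fin 4) (Fin 4) ℂ :=
  if h then flipAdj M else M

theorem inHalf_inj (h : Bool) (x : Fin 4 → ℂ) : InHalf h (inj h x) := by
  cases h <;> exact fun i => rfl

theorem inj_add (h : Bool) (x y : Fin 4 → ℂ) : inj h (x + y) = inj h x + inj h y := by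
  ext i; cases h <;> cases i <;> simp [inj]

theorem inj_smul (h : Bool) (c : ℂ) (x : Fin 4 → ℂ) : inj h (c • x) = c • inj h x := by
  ext i; cases h <;> cases i <;> simp [inj]

theorem inj_zero (h : Bool) : inj h 0 = 0 := by
  ext i; cases h <;> cases i <;> simp [inj]

theorem flipP_mulVec_inj (M : Matrix (Fin 4) (Fin 4) ℂ) (h : Bool) (x : Fin 4 → ℂ) :
    flipP M *ᵥ inj h x = inj (!h) (component M h *ᵥ x) := by
  rw [flipP, Matrix.fromBlocks_mulVec]
  ext i; cases h <;> cases i <;> simp [inj, component, flipAdj]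

/-- The vectors in `T` lie in the sum of the spans of vectors realizing `L`. -/
def Covers (P : Matrix (Fin 4 ⊕ Fin 4) (Fin 4 ⊕ Fin 4) ℂ) (L : List PBlock)
    (T : Set (Fin 4 ⊕ Fin 4 → ℂ)) : Prop :=
  ∃ W : Submodule ℂ (Fin 4 ⊕ Fin 4 → ℂ), Decomp P L W ∧ T ⊆ W

theorem covers_nil (P : Matrix (Fin 4 ⊕ Fin 4) (Fin 4 ⊕ Fin 4) ℂ) : Covers P [] ∅ :=
  ⟨⊥, rfl, Set.empty_subset _⟩

variable {M : Matrix (Fin 4) (Fin 4) ℂ} {L : List PBlock} {T : Set (Fin 4 ⊕ Fin 4 → ℂ)}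

/-- A common chain `f` of `M` and its adjoint gives the chain `(f, f)` of the block matrix with
mirror image `(f, -f)`; together they span the copies of `f` in both halves. -/
theorem Covers.pair (hT : Covers (flipP M) L T) {m : ℕ} {z : ℂ} {f : Fin m → Fin 4 → ℂ}
    (h1 : IsJordanChain M z f) (h2 : IsJordanChain (flipAdj M) z f) :
    Covers (flipP M) (.pair m z :: L) ({v | ∃ h k, v = inj h (f k)} ∪ T) := by
  obtain ⟨W, hW, hTW⟩ := hT
  have hc : ∀ h, IsJordanChain (component M h) z f := by
    rintro (_ | _)
    · exact h1
    · exact h2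
  have hch : ∀ h (k : Fin m), (k : ℕ) = 0 → flipP M *ᵥ inj h (f k) =
      z • inj (!h) (f k) := fun h k hk => by
    rw [flipP_mulVec_inj, (hc h).1 k hk, inj_smul]
  have hch' : ∀ h (j k : Fin m), (k : ℕ) = j + 1 → flipP M *ᵥ inj h (f k) =
      z • inj (!h) (f k) + inj (!h) (f j) := fun h j k hk => by
    rw [flipP_mulVec_inj, (hc h).2 j k hk, inj_add, inj_smul]
  have hm : ∀ x, mirror (inj true x + inj false x) = inj true x - inj false x := fun x => by
    ext i; cases i <;> simp [mirror, inj]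
  let u : Fin m → Fin 4 ⊕ Fin 4 → ℂ := fun k => inj true (f k) + inj false (f k)
  let w : Fin m → Fin 4 ⊕ Fin 4 → ℂ := fun k => mirror (u k)
  refine ⟨Submodule.span ℂ (Set.range u ∪ Set.range w) ⊔ W,
    ⟨u, w, ⟨⟨fun k hk => ?_, fun j k hk => ?_⟩, fun k => rfl⟩, W, hW, rfl⟩, ?_⟩
  · simp only [u, Matrix.mulVec_add, hch _ k hk, Bool.not_true, Bool.not_false]
    module
  · simp only [u, Matrix.mulVec_add, hch' _ j k hk, Bool.not_true, Bool.not_false]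
    module
  · rintro _ (⟨h, k, rfl⟩ | hv)
    · refine (le_sup_left : _ ≤ Submodule.span ℂ (Set.range u ∪ Set.range w) ⊔ W) ?_
      have hu : u k ∈ Submodule.span ℂ (Set.range u ∪ Set.range w) :=
        Submodule.subset_span (Or.inl ⟨k, rfl⟩)
      have hw : w k ∈ Submodule.span ℂ (Set.range u ∪ Set.range w) :=
        Submodule.subset_span (Or.inr ⟨k, rfl⟩)
      have hwk : w k = inj true (f k) - inj false (f k) := hm _
      cases h
      · have : inj false (f k) = (1 / 2 : ℂ) • (u k - w k) := by
          rw [hwk]; simp only [u]; module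
        rw [this]
        exact Submodule.smul_mem _ _ (Submodule.sub_mem _ hu hw)
      · have : inj true (f k) = (1 / 2 : ℂ) • (u k + w k) := by
          rw [hwk]; simp only [u]; module
        rw [this]
        exact Submodule.smul_mem _ _ (Submodule.add_mem _ hu hw)
    · exact (le_sup_right : W ≤ _) (hTW hv)

/-- The half containing the `k`-th vector of a string. -/
def stringHalf (h : Bool) (k : ℕ) : Bool := if Even k then h else !h

theorem stringHalf_succ (h : Bool) (k : ℕ) : stringHalf h (k + 1) = !stringHalf h k := by
  by_cases hk : Even k <;> simp [stringHalf, hk, Nat.even_add_one]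

/-- The vectors `x 0, x 1, …` taken alternately from the two halves form a Jordan chain of
`flipP M` with eigenvalue `0`. -/
def IsString (M : Matrix (Fin 4) (Fin 4) ℂ) (h : Bool) {m : ℕ} (x : Fin (m + 1) → Fin 4 → ℂ) :
    Prop :=
  component M h *ᵥ x 0 = 0 ∧
    ∀ k : Fin m, component M (stringHalf h (k + 1)) *ᵥ x k.succ = x k.castSucc

theorem IsString.isJordanChain {h : Bool} {m : ℕ} {x : Fin (m + 1) → Fin 4 → ℂ}
    (hx : IsString M h x) :
    IsJordanChain (flipP M) 0 (fun k => inj (stringHalf h k) (x k)) := by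
  refine ⟨fun k hk => ?_, fun j k hk => ?_⟩
  · obtain rfl : k = 0 := Fin.ext hk
    rw [flipP_mulVec_inj, zero_smul]
    have : component M (stringHalf h ((0 : Fin (m + 1)) : ℕ)) *ᵥ x 0 = 0 := by
      simpa [stringHalf] using hx.1
    rw [this, inj_zero]
  · obtain ⟨i, rfl⟩ : ∃ i : Fin m, k = i.succ := Fin.exists_succ_eq.2 (by
      rintro rfl; simp at hk) |>.imp fun _ h => h.symm
    obtain rfl : j = i.castSucc := Fin.ext (by simpa using hk.symm)
    rw [flipP_mulVec_inj, zero_smul, zero_add, Fin.val_succ, hx.2 i, stringHalf_succ, Bool.not_not]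
    rfl

theorem Covers.degenerate (hT : Covers (flipP M) L T) {h : Bool} {p q : ℕ}
    {x : Fin (p + 1) → Fin 4 → ℂ} {y : Fin (q + 1) → Fin 4 → ℂ} (hx : IsString M h x)
    (hy : IsString M (!h) y) :
    Covers (flipP M) (.degenerate h (p + 1) (q + 1) :: L)
      ({v | ∃ k : Fin (p + 1), v = inj (stringHalf h k) (x k)} ∪
        {v | ∃ k : Fin (q + 1), v = inj (stringHalf (!h) k) (y k)} ∪ T) := by
  obtain ⟨W, hW, hTW⟩ := hT
  refine ⟨_, ⟨_, _, ⟨hx.isJordanChain, hy.isJordanChain, fun k => inHalf_inj _ _, fun k => ?_⟩, W,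
    hW, rfl⟩, ?_⟩
  · have := inHalf_inj (stringHalf (!h) k) (y k)
    simpa only [stringHalf, Bool.not_not] using this
  · rintro v ((⟨k, rfl⟩ | ⟨k, rfl⟩) | hv)
    · exact Submodule.mem_sup_left (Submodule.subset_span (Or.inl ⟨k, rfl⟩))
    · exact Submodule.mem_sup_left (Submodule.subset_span (Or.inr ⟨k, rfl⟩))
    · exact Submodule.mem_sup_right (hTW hv)

/-- Completeness of a list of chains is reduced to two `4 × 4` determinants, one for the covered
vectors in each half. -/
theorem Covers.decomp {ψ : State} (hM : stateMatrix ψ = M)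
    (hT : Covers (flipP M) L T) (f : Bool → Matrix (Fin 4) (Fin 4) ℂ)
    (hf : ∀ h, (f h).det ≠ 0) (hfT : ∀ h i, inj h (f h i) ∈ T) :
    Decomp (flipP (stateMatrix ψ)) L ⊤ := by
  obtain ⟨W, hW, hTW⟩ := hT
  have hmem : ∀ h x, inj h x ∈ W := by
    intro h x
    have hsurj : ∃ c, c ᵥ* f h = x := by
      refine ⟨x ᵥ* (f h)⁻¹, ?_⟩
      rw [Matrix.vecMul_vecMul, Matrix.nonsing_inv_mul _ (isUnit_iff_ne_zero.2 (hf h)),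
        Matrix.vecMul_one]
    obtain ⟨c, rfl⟩ := hsurj
    have : c ᵥ* f h = ∑ i, c i • f h i := by
      ext j
      simp [Matrix.vecMul, dotProduct]
    rw [this, Fin.sum_univ_four]
    simp only [inj_add, inj_smul]
    exact W.add_mem (W.add_mem (W.add_mem (W.smul_mem _ (hTW (hfT h 0)))
      (W.smul_mem _ (hTW (hfT h 1)))) (W.smul_mem _ (hTW (hfT h 2))))
      (W.smul_mem _ (hTW (hfT h 3)))
  have htop : W = ⊤ := by
    rw [eq_top_iff]
    rintro v -
    have : v = inj true (fun i => v (Sum.inl i)) + inj false (fun i => v (Sum.inr i)) := by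
      ext i; cases i <;> simp [inj]
    rw [this]
    exact W.add_mem (hmem _ _) (hmem _ _)
  subst htop hM
  exact hW

theorem flipAdj_of (a b c d e f g h i j k l m n o p : ℂ) :
    flipAdj !![a, b, c, d; e, f, g, h; i, j, k, l; m, n, o, p] =
      !![p, -l, -h, d; -o, k, g, -c; -n, j, f, -b; m, -i, -e, a] := by
  ext r s
  simp only [flipAdj, Matrix.mul_apply, Fin.sum_univ_four, Matrix.transpose_apply]
  fin_cases r <;> fin_cases s <;> simp [spinFlip]

theorem ket_apply (i j k l a b c d : Fin 2) :
    ket i j k l ![a, b, c, d] = if a = i ∧ b = j ∧ c = k ∧ d = l then 1 else 0 := by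
  rw [ket, Pi.single_apply]
  congr 1
  rw [eq_iff_iff]
  constructor
  · intro h
    exact ⟨congrFun h 0, congrFun h 1, congrFun h 2, congrFun h 3⟩
  · rintro ⟨rfl, rfl, rfl, rfl⟩
    rfl

theorem stateMatrix_eq_iff (ψ : State) (M : Matrix (Fin 4) (Fin 4) ℂ) :
    stateMatrix ψ = M ↔ ∀ i j k l : Fin 2,
      ψ ![i, j, k, l] = M (finProdFinEquiv (i, j)) (finProdFinEquiv (k, l)) := by
  constructor
  · rintro rfl i j k l
    rw [stateMatrix_apply]
  · intro h
    exact matrix_fin_four_ext fun i j k l => by rw [stateMatrix_apply, h]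

theorem isJordanChain_succ {n : Type} [Fintype n] {P : Matrix n n ℂ} {z : ℂ} {m : ℕ}
    {v : Fin (m + 1) → n → ℂ} (h0 : P *ᵥ v 0 = z • v 0)
    (hs : ∀ k : Fin m, P *ᵥ v k.succ = z • v k.succ + v k.castSucc) : IsJordanChain P z v := by
  refine ⟨fun k hk => ?_, fun j k hk => ?_⟩
  · obtain rfl : k = 0 := Fin.ext hk
    exact h0
  · obtain ⟨i, rfl⟩ : ∃ i : Fin m, k = i.succ := Fin.exists_succ_eq.2 (by
      rintro rfl; simp at hk) |>.imp fun _ h => h.symm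
    obtain rfl : j = i.castSucc := Fin.ext (by simpa using hk.symm)
    exact hs i

end

/-! ### Coordinate matrices of the nine families. -/

theorem stateMatrix_Gabcd (a b c d : ℂ) : stateMatrix (Family.Gabcd a b c d).state =
    !![(a + d) / 2, 0, 0, (a - d) / 2; 0, (b + c) / 2, (b - c) / 2, 0;
      0, (b - c) / 2, (b + c) / 2, 0; (a - d) / 2, 0, 0, (a + d) / 2] := by
  rw [stateMatrix_eq_iff]
  intro i j k l
  fin_cases i <;> fin_cases j <;> fin_cases k <;> fin_cases l <;>
    simp [Family.state, ket_apply, finProdFinEquiv]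

theorem stateMatrix_Labc2 (a b c : ℂ) : stateMatrix (Family.Labc2 a b c).state =
    !![(a + b) / 2, 0, 0, (a - b) / 2; 0, c, 1, 0; 0, 0, c, 0; (a - b) / 2, 0, 0, (a + b) / 2] := by
  rw [stateMatrix_eq_iff]
  intro i j k l
  fin_cases i <;> fin_cases j <;> fin_cases k <;> fin_cases l <;>
    simp [Family.state, ket_apply, finProdFinEquiv]

theorem stateMatrix_La2b2 (a b : ℂ) : stateMatrix (Family.La2b2 a b).state =
    !![a, 0, 0, 1; 0, b, 1, 0; 0, 0, b, 0; 0, 0, 0, a] := by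
  rw [stateMatrix_eq_iff]
  intro i j k l
  fin_cases i <;> fin_cases j <;> fin_cases k <;> fin_cases l <;>
    simp [Family.state, ket_apply, finProdFinEquiv]

theorem stateMatrix_Lab3 (a b : ℂ) : stateMatrix (Family.Lab3 a b).state =
    !![a, Complex.I / ((Real.sqrt 2 : ℝ) : ℂ), Complex.I / ((Real.sqrt 2 : ℝ) : ℂ), 0;
      0, (a + b) / 2, (a - b) / 2, -(Complex.I / ((Real.sqrt 2 : ℝ) : ℂ));
      0, (a - b) / 2, (a + b) / 2, -(Complex.I / ((Real.sqrt 2 : ℝ) : ℂ));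
      0, 0, 0, a] := by
  rw [stateMatrix_eq_iff]
  intro i j k l
  fin_cases i <;> fin_cases j <;> fin_cases k <;> fin_cases l <;>
    simp [Family.state, ket_apply, finProdFinEquiv]

theorem stateMatrix_La4 (a : ℂ) : stateMatrix (Family.La4 a).state =
    !![a, Complex.I, 0, 0; 0, a, 1, 0; 0, 0, a, -Complex.I; 0, 0, 0, a] := by
  rw [stateMatrix_eq_iff]
  intro i j k l
  fin_cases i <;> fin_cases j <;> fin_cases k <;> fin_cases l <;>
    simp [Family.state, ket_apply, finProdFinEquiv]

theorem stateMatrix_La2031 (a : ℂ) : stateMatrix (Family.La2031 a).state =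
    !![a, 0, 0, 1; 0, 1, 1, 0; 0, 0, 0, 0; 0, 0, 0, a] := by
  rw [stateMatrix_eq_iff]
  intro i j k l
  fin_cases i <;> fin_cases j <;> fin_cases k <;> fin_cases l <;>
    simp [Family.state, ket_apply, finProdFinEquiv]

theorem stateMatrix_L053 : stateMatrix Family.L053.state =
    !![1, 0, 0, 0; 0, 1, 0, 0; 1, 0, 0, 0; 0, 0, 1, 0] := by
  rw [stateMatrix_eq_iff]
  intro i j k l
  fin_cases i <;> fin_cases j <;> fin_cases k <;> fin_cases l <;>
    simp [Family.state, ket_apply, finProdFinEquiv]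

theorem stateMatrix_L071 : stateMatrix Family.L071.state =
    !![1, 0, 0, 0; 0, 0, 0, 0; 0, 0, 0, 1; 0, 1, 1, 0] := by
  rw [stateMatrix_eq_iff]
  intro i j k l
  fin_cases i <;> fin_cases j <;> fin_cases k <;> fin_cases l <;>
    simp [Family.state, ket_apply, finProdFinEquiv]

theorem stateMatrix_L031031 : stateMatrix Family.L031031.state =
    !![1, 0, 0, 0; 0, 0, 0, 1; 0, 0, 0, 0; 0, 0, 0, 0] := by
  rw [stateMatrix_eq_iff]
  intro i j k l
  fin_cases i <;> fin_cases j <;> fin_cases k <;> fin_cases l <;>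
    simp [Family.state, ket_apply, finProdFinEquiv]

/-! ### Explicit Jordan bases of the nine families. -/

/-- The families without degenerated pairs have coordinate matrices that are self-adjoint for the
determinant form, so an ordinary `4 × 4` Jordan chain suffices. -/
theorem Covers.pair_self {M : Matrix (Fin 4) (Fin 4) ℂ} {L : List PBlock}
    {T : Set (Fin 4 ⊕ Fin 4 → ℂ)} (hT : Covers (flipP M) L T) (hM : flipAdj M = M) {m : ℕ} {z : ℂ}
    {f : Fin m → Fin 4 → ℂ} (h : IsJordanChain M z f) :
    Covers (flipP M) (.pair m z :: L) ({v | ∃ h k, v = inj h (f k)} ∪ T) :=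
  hT.pair h (by rwa [hM])

theorem decomp_Gabcd (a b c d : ℂ) :
    Decomp (flipP (stateMatrix (Family.Gabcd a b c d).state)) (Family.Gabcd a b c d).blocks ⊤ := by
  -- The eigenvectors are the Bell vectors. Blocks are added from the end of the list, so the vector
  -- for `d` comes first.
  refine Covers.decomp (stateMatrix_Gabcd a b c d)
    (((((covers_nil _).pair_self ?_ (f := ![![1, 0, 0, -1]]) ?_).pair_self ?_
      (f := ![![0, 1, -1, 0]]) ?_).pair_self ?_ (f := ![![0, 1, 1, 0]]) ?_).pair_self ?_
      (f := ![![1, 0, 0, 1]]) ?_)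
    (fun _ => !![1, 0, 0, 1; 0, 1, 1, 0; 0, 1, -1, 0; 1, 0, 0, -1]) ?_ ?_
  · simp [flipAdj_of]
  · refine isJordanChain_succ ?_ (fun k => ?_)
    · ext i; fin_cases i <;> simp [Matrix.mulVec, dotProduct, Fin.sum_univ_four] <;> ring
    · fin_cases k
  · simp [flipAdj_of]
  · refine isJordanChain_succ ?_ (fun k => ?_)
    · ext i; fin_cases i <;> simp [Matrix.mulVec, dotProduct, Fin.sum_univ_four] <;> ring
    · fin_cases k
  · simp [flipAdj_of]
  · refine isJordanChain_succ ?_ (fun k => ?_)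
    · ext i; fin_cases i <;> simp [Matrix.mulVec, dotProduct, Fin.sum_univ_four] <;> ring
    · fin_cases k
  · simp [flipAdj_of]
  · refine isJordanChain_succ ?_ (fun k => ?_)
    · ext i; fin_cases i <;> simp [Matrix.mulVec, dotProduct, Fin.sum_univ_four] <;> ring
    · fin_cases k
  · intro h
    simp [Matrix.det_succ_row_zero, Fin.sum_univ_succ, Fin.succAbove]
    norm_num
  · intro h i
    fin_cases i
    · exact Or.inl ⟨h, 0, rfl⟩
    · exact Or.inr (Or.inl ⟨h, 0, rfl⟩)
    · exact Or.inr (Or.inr (Or.inl ⟨h, 0, rfl⟩))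
    · exact Or.inr (Or.inr (Or.inr (Or.inl ⟨h, 0, rfl⟩)))

theorem decomp_L071 :
    Decomp (flipP (stateMatrix Family.L071.state)) Family.L071.blocks ⊤ := by
  -- The string is generated by its last vector: each other one is the image of its successor. The
  -- two matrices collect the vectors of each half, those of the second half listed first.
  refine Covers.decomp stateMatrix_L071
    ((covers_nil _).degenerate (p := 6) (q := 0) (h := true)
      (x := ![![0, 0, 2, 0], ![0, 0, 0, 2], ![0, 0, 0, 2], ![0, 1, 1, 0], ![-1, 0, 0, 0],
        ![-1, 0, 0, 0], ![0, 1, 0, 0]]) (y := ![![0, 1, -1, 0]]) ⟨?_, fun k => ?_⟩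
            ⟨?_, fun k => ?_⟩)
    (Bool.rec !![0, 0, 0, 2; 0, 1, 1, 0; -1, 0, 0, 0; 0, 1, -1, 0]
      !![0, 0, 2, 0; 0, 0, 0, 2; -1, 0, 0, 0; 0, 1, 0, 0]) ?_ ?_
  · ext i
    fin_cases i <;> simp [component, flipAdj_of, Matrix.mulVec, dotProduct, Fin.sum_univ_four]
  · ext i
    fin_cases k <;> fin_cases i <;>
      simp [component, stringHalf, Nat.even_iff, one_add_one_eq_two, flipAdj_of, Matrix.mulVec,
        dotProduct, Fin.sum_univ_four]
  · ext i
    fin_cases i <;> simp [component, Matrix.mulVec, dotProduct, Fin.sum_univ_four]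
  · fin_cases k
  · rintro (_ | _) <;> simp [Matrix.det_succ_row_zero, Fin.sum_univ_succ, Fin.succAbove]
  · rintro (_ | _) i <;> fin_cases i
    · exact Or.inl (Or.inl ⟨1, rfl⟩)
    · exact Or.inl (Or.inl ⟨3, rfl⟩)
    · exact Or.inl (Or.inl ⟨5, rfl⟩)
    · exact Or.inl (Or.inr ⟨0, rfl⟩)
    · exact Or.inl (Or.inl ⟨0, rfl⟩)
    · exact Or.inl (Or.inl ⟨2, rfl⟩)
    · exact Or.inl (Or.inl ⟨4, rfl⟩)
    · exact Or.inl (Or.inl ⟨6, rfl⟩)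

theorem decomp_Labc2 (a b c : ℂ) :
    Decomp (flipP (stateMatrix (Family.Labc2 a b c).state)) (Family.Labc2 a b c).blocks ⊤ := by
  refine Covers.decomp (stateMatrix_Labc2 a b c)
      ((((covers_nil _).pair_self ?_
        (f := ![![0, 1, 0, 0], ![0, 0, 1, 0]]) ?_).pair_self ?_
        (f := ![![1, 0, 0, -1]]) ?_).pair_self ?_
        (f := ![![1, 0, 0, 1]]) ?_)
      (Bool.rec !![1, 0, 0, 1; 1, 0, 0, -1; 0, 1, 0, 0; 0, 0, 1, 0]
        !![1, 0, 0, 1; 1, 0, 0, -1; 0, 1, 0, 0; 0, 0, 1, 0]) ?_ ?_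
  · simp [flipAdj_of]
  · refine isJordanChain_succ ?_ (fun k => ?_)
    · ext i; fin_cases i <;> simp [Matrix.mulVec, dotProduct, Fin.sum_univ_four]
    · ext i
      fin_cases k <;> fin_cases i <;> simp [Matrix.mulVec, dotProduct, Fin.sum_univ_four]
  · simp [flipAdj_of]
  · refine isJordanChain_succ ?_ (fun k => k.elim0)
    ext i; fin_cases i <;> simp [Matrix.mulVec, dotProduct, Fin.sum_univ_four] <;> ring
  · simp [flipAdj_of]
  · refine isJordanChain_succ ?_ (fun k => k.elim0)
    ext i; fin_cases i <;> simp [Matrix.mulVec, dotProduct, Fin.sum_univ_four] <;> ring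
  · rintro (_ | _) <;> simp [Matrix.det_succ_row_zero, Fin.sum_univ_succ, Fin.succAbove] <;>
      norm_num
  · rintro (_ | _) i <;> fin_cases i
    · exact Or.inl ⟨false, 0, rfl⟩
    · exact Or.inr (Or.inl ⟨false, 0, rfl⟩)
    · exact Or.inr (Or.inr (Or.inl ⟨false, 0, rfl⟩))
    · exact Or.inr (Or.inr (Or.inl ⟨false, 1, rfl⟩))
    · exact Or.inl ⟨true, 0, rfl⟩
    · exact Or.inr (Or.inl ⟨true, 0, rfl⟩)
    · exact Or.inr (Or.inr (Or.inl ⟨true, 0, rfl⟩))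
    · exact Or.inr (Or.inr (Or.inl ⟨true, 1, rfl⟩))

theorem decomp_La2b2 (a b : ℂ) :
    Decomp (flipP (stateMatrix (Family.La2b2 a b).state)) (Family.La2b2 a b).blocks ⊤ := by
  refine Covers.decomp (stateMatrix_La2b2 a b)
      (((covers_nil _).pair_self ?_
        (f := ![![0, 1, 0, 0], ![0, 0, 1, 0]]) ?_).pair_self ?_
        (f := ![![1, 0, 0, 0], ![0, 0, 0, 1]]) ?_)
      (Bool.rec !![1, 0, 0, 0; 0, 0, 0, 1; 0, 1, 0, 0; 0, 0, 1, 0]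
        !![1, 0, 0, 0; 0, 0, 0, 1; 0, 1, 0, 0; 0, 0, 1, 0]) ?_ ?_
  · simp [flipAdj_of]
  · refine isJordanChain_succ ?_ (fun k => ?_)
    · ext i; fin_cases i <;> simp [Matrix.mulVec, dotProduct, Fin.sum_univ_four]
    · ext i
      fin_cases k <;> fin_cases i <;> simp [Matrix.mulVec, dotProduct, Fin.sum_univ_four]
  · simp [flipAdj_of]
  · refine isJordanChain_succ ?_ (fun k => ?_)
    · ext i; fin_cases i <;> simp [Matrix.mulVec, dotProduct, Fin.sum_univ_four]
    · ext i
      fin_cases k <;> fin_cases i <;> simp [Matrix.mulVec, dotProduct, Fin.sum_univ_four]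
  · rintro (_ | _) <;> simp [Matrix.det_succ_row_zero, Fin.sum_univ_succ, Fin.succAbove]
  · rintro (_ | _) i <;> fin_cases i
    · exact Or.inl ⟨false, 0, rfl⟩
    · exact Or.inl ⟨false, 1, rfl⟩
    · exact Or.inr (Or.inl ⟨false, 0, rfl⟩)
    · exact Or.inr (Or.inl ⟨false, 1, rfl⟩)
    · exact Or.inl ⟨true, 0, rfl⟩
    · exact Or.inl ⟨true, 1, rfl⟩
    · exact Or.inr (Or.inl ⟨true, 0, rfl⟩)
    · exact Or.inr (Or.inl ⟨true, 1, rfl⟩)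

theorem decomp_Lab3 (a b : ℂ) :
    Decomp (flipP (stateMatrix (Family.Lab3 a b).state)) (Family.Lab3 a b).blocks ⊤ := by
  refine Covers.decomp (stateMatrix_Lab3 a b)
      (((covers_nil _).pair_self ?_
        (f := ![![0, 1, -1, 0]]) ?_).pair_self ?_
        (f := ![![1, 0, 0, 0], ![0, -(Complex.I / ((Real.sqrt 2 : ℝ) : ℂ)),
          -(Complex.I / ((Real.sqrt 2 : ℝ) : ℂ)), 0], ![0, 0, 0, 1]]) ?_)
      (Bool.rec !![1, 0, 0, 0; 0, 0, 0, 1; 0, -(Complex.I / ((Real.sqrt 2 : ℝ) : ℂ)),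
          -(Complex.I / ((Real.sqrt 2 : ℝ) : ℂ)), 0; 0, 1, -1, 0]
        !![1, 0, 0, 0; 0, 0, 0, 1; 0, -(Complex.I / ((Real.sqrt 2 : ℝ) : ℂ)),
          -(Complex.I / ((Real.sqrt 2 : ℝ) : ℂ)), 0; 0, 1, -1, 0]) ?_ ?_
  · simp [flipAdj_of]
  · refine isJordanChain_succ ?_ (fun k => k.elim0)
    ext i; fin_cases i <;> simp [Matrix.mulVec, dotProduct, Fin.sum_univ_four] <;> ring
  · simp [flipAdj_of]
  · refine isJordanChain_succ ?_ (fun k => ?_)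
    · ext i; fin_cases i <;> simp [Matrix.mulVec, dotProduct, Fin.sum_univ_four]
    · ext i
      fin_cases k <;> fin_cases i <;> simp [Matrix.mulVec, dotProduct, Fin.sum_univ_four] <;>
          ring_nf
      -- For `κ = i / √2` the link from the middle vector to the eigenvector has coefficient `-2 κ²
      -- = 1`.
      rw [inv_pow, ← Complex.ofReal_pow, Real.sq_sqrt zero_le_two, Complex.I_sq]
      simp
  · rintro (_ | _) <;> simp [Matrix.det_succ_row_zero, Fin.sum_univ_succ, Fin.succAbove]
  · rintro (_ | _) i <;> fin_cases i
    · exact Or.inl ⟨false, 0, rfl⟩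
    · exact Or.inl ⟨false, 2, rfl⟩
    · exact Or.inl ⟨false, 1, rfl⟩
    · exact Or.inr (Or.inl ⟨false, 0, rfl⟩)
    · exact Or.inl ⟨true, 0, rfl⟩
    · exact Or.inl ⟨true, 2, rfl⟩
    · exact Or.inl ⟨true, 1, rfl⟩
    · exact Or.inr (Or.inl ⟨true, 0, rfl⟩)

theorem decomp_La4 (a : ℂ) :
    Decomp (flipP (stateMatrix (Family.La4 a).state)) (Family.La4 a).blocks ⊤ := by
  refine Covers.decomp (stateMatrix_La4 a)
      ((covers_nil _).pair_self ?_
        (f := ![![1, 0, 0, 0], ![0, -Complex.I, 0, 0], ![0, 0, -Complex.I, 0], ![0, 0, 0, 1]]) ?_)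
      (Bool.rec !![1, 0, 0, 0; 0, -Complex.I, 0, 0; 0, 0, -Complex.I, 0; 0, 0, 0, 1]
        !![1, 0, 0, 0; 0, -Complex.I, 0, 0; 0, 0, -Complex.I, 0; 0, 0, 0, 1]) ?_ ?_
  · simp [flipAdj_of]
  · refine isJordanChain_succ ?_ (fun k => ?_)
    · ext i; fin_cases i <;> simp [Matrix.mulVec, dotProduct, Fin.sum_univ_four]
    · ext i
      fin_cases k <;> fin_cases i <;> simp [Matrix.mulVec, dotProduct, Fin.sum_univ_four]
  · rintro (_ | _) <;> simp [Matrix.det_succ_row_zero, Fin.sum_univ_succ, Fin.succAbove]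
  · rintro (_ | _) i <;> fin_cases i
    · exact Or.inl ⟨false, 0, rfl⟩
    · exact Or.inl ⟨false, 1, rfl⟩
    · exact Or.inl ⟨false, 2, rfl⟩
    · exact Or.inl ⟨false, 3, rfl⟩
    · exact Or.inl ⟨true, 0, rfl⟩
    · exact Or.inl ⟨true, 1, rfl⟩
    · exact Or.inl ⟨true, 2, rfl⟩
    · exact Or.inl ⟨true, 3, rfl⟩

theorem decomp_La2031 (a : ℂ) :
    Decomp (flipP (stateMatrix (Family.La2031 a).state)) (Family.La2031 a).blocks ⊤ := by
  refine Covers.decomp (stateMatrix_La2031 a)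
      (((covers_nil _).degenerate (p := 2) (q := 0) (h := true)
        (x := ![![0, 2, 0, 0], ![0, 1, 1, 0], ![0, 0, 1, 0]])
        (y := ![![0, 1, -1, 0]]) ⟨?_, fun k => ?_⟩ ⟨?_, fun k => ?_⟩).pair
        (f := ![![1, 0, 0, 0], ![0, 0, 0, 1]]) ?_ ?_)
      (Bool.rec !![1, 0, 0, 0; 0, 0, 0, 1; 0, 1, 1, 0; 0, 1, -1, 0]
        !![1, 0, 0, 0; 0, 0, 0, 1; 0, 2, 0, 0; 0, 0, 1, 0]) ?_ ?_
  · ext i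
    fin_cases i <;> simp [component, flipAdj_of, Matrix.mulVec, dotProduct, Fin.sum_univ_four]
  · ext i
    fin_cases k <;> fin_cases i <;>
      simp [component, stringHalf, Nat.even_iff, one_add_one_eq_two, flipAdj_of, Matrix.mulVec,
        dotProduct,
        Fin.sum_univ_four]
  · ext i
    fin_cases i <;> simp [component, Matrix.mulVec, dotProduct, Fin.sum_univ_four]
  · exact k.elim0
  · refine isJordanChain_succ ?_ (fun k => ?_)
    · ext i; fin_cases i <;> simp [Matrix.mulVec, dotProduct, Fin.sum_univ_four]
    · ext i
      fin_cases k <;> fin_cases i <;> simp [Matrix.mulVec, dotProduct, Fin.sum_univ_four]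
  · refine isJordanChain_succ ?_ (fun k => ?_)
    · ext i; fin_cases i <;> simp [flipAdj_of, Matrix.mulVec, dotProduct, Fin.sum_univ_four]
    · ext i
      fin_cases k <;> fin_cases i <;> simp [flipAdj_of, Matrix.mulVec, dotProduct,
          Fin.sum_univ_four]
  · rintro (_ | _) <;> simp [Matrix.det_succ_row_zero, Fin.sum_univ_succ, Fin.succAbove]
  · rintro (_ | _) i <;> fin_cases i
    · exact Or.inl ⟨false, 0, rfl⟩
    · exact Or.inl ⟨false, 1, rfl⟩
    · exact Or.inr (Or.inl (Or.inl ⟨1, rfl⟩))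
    · exact Or.inr (Or.inl (Or.inr ⟨0, rfl⟩))
    · exact Or.inl ⟨true, 0, rfl⟩
    · exact Or.inl ⟨true, 1, rfl⟩
    · exact Or.inr (Or.inl (Or.inl ⟨0, rfl⟩))
    · exact Or.inr (Or.inl (Or.inl ⟨2, rfl⟩))

theorem decomp_L053 :
    Decomp (flipP (stateMatrix Family.L053.state)) Family.L053.blocks ⊤ := by
  -- The vector `(1, 0, 0, 0)` of the second half generates the string of length five; `(1, 0, -1,
  -- 0)` in the first half is killed after exactly three steps.
  refine Covers.decomp stateMatrix_L053
      ((covers_nil _).degenerate (p := 4) (q := 2) (h := false)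
        (x := ![![0, 0, 0, 2], ![0, -1, 0, 1], ![0, -1, 1, 0], ![1, 0, 1, 0], ![1, 0, 0, 0]])
        (y := ![![0, -1, 0, -1], ![0, -1, -1, 0], ![1, 0, -1, 0]]) ⟨?_, fun k => ?_⟩
            ⟨?_, fun k => ?_⟩)
      (Bool.rec !![0, 0, 0, 2; 0, -1, 1, 0; 1, 0, 0, 0; 0, -1, -1, 0]
        !![0, -1, 0, 1; 1, 0, 1, 0; 0, -1, 0, -1; 1, 0, -1, 0]) ?_ ?_
  · ext i
    fin_cases i <;> simp [component, Matrix.mulVec, dotProduct, Fin.sum_univ_four]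
  · ext i
    fin_cases k <;> fin_cases i <;>
      simp [component, stringHalf, Nat.even_iff, one_add_one_eq_two, flipAdj_of, Matrix.mulVec,
        dotProduct,
        Fin.sum_univ_four]
  · ext i
    fin_cases i <;> simp [component, flipAdj_of, Matrix.mulVec, dotProduct, Fin.sum_univ_four]
  · ext i
    fin_cases k <;> fin_cases i <;>
      simp [component, stringHalf, Nat.even_iff, one_add_one_eq_two, flipAdj_of, Matrix.mulVec,
        dotProduct,
        Fin.sum_univ_four]
  · rintro (_ | _) <;> simp [Matrix.det_succ_row_zero, Fin.sum_univ_succ, Fin.succAbove] <;>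
      norm_num
  · rintro (_ | _) i <;> fin_cases i
    · exact Or.inl (Or.inl ⟨0, rfl⟩)
    · exact Or.inl (Or.inl ⟨2, rfl⟩)
    · exact Or.inl (Or.inl ⟨4, rfl⟩)
    · exact Or.inl (Or.inr ⟨1, rfl⟩)
    · exact Or.inl (Or.inl ⟨1, rfl⟩)
    · exact Or.inl (Or.inl ⟨3, rfl⟩)
    · exact Or.inl (Or.inr ⟨0, rfl⟩)
    · exact Or.inl (Or.inr ⟨2, rfl⟩)

theorem decomp_L031031 :
    Decomp (flipP (stateMatrix Family.L031031.state)) Family.L031031.blocks ⊤ := by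
  refine Covers.decomp stateMatrix_L031031
      (((covers_nil _).degenerate (p := 2) (q := 0) (h := true)
        (x := ![![-1, 0, 0, 0], ![-1, 0, 0, 0], ![0, 0, 1, 0]])
        (y := ![![0, 0, 1, 0]]) ⟨?_, fun k => ?_⟩ ⟨?_, fun k => ?_⟩).degenerate (p := 2) (q := 0) (h := true)
        (x := ![![0, 1, 0, 0], ![0, 0, 0, 1], ![0, 0, 0, 1]])
        (y := ![![0, 1, 0, 0]]) ⟨?_, fun k => ?_⟩ ⟨?_, fun k => ?_⟩)
      (Bool.rec !![0, 0, 0, 1; 0, 1, 0, 0; -1, 0, 0, 0; 0, 0, 1, 0]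
        !![0, 1, 0, 0; 0, 0, 0, 1; -1, 0, 0, 0; 0, 0, 1, 0]) ?_ ?_
  · ext i
    fin_cases i <;> simp [component, flipAdj_of, Matrix.mulVec, dotProduct, Fin.sum_univ_four]
  · ext i
    fin_cases k <;> fin_cases i <;>
      simp [component, stringHalf, Nat.even_iff, one_add_one_eq_two, flipAdj_of, Matrix.mulVec,
        dotProduct,
        Fin.sum_univ_four]
  · ext i
    fin_cases i <;> simp [component, Matrix.mulVec, dotProduct, Fin.sum_univ_four]
  · exact k.elim0
  · ext i
    fin_cases i <;> simp [component, flipAdj_of, Matrix.mulVec, dotProduct, Fin.sum_univ_four]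
  · ext i
    fin_cases k <;> fin_cases i <;>
      simp [component, stringHalf, Nat.even_iff, one_add_one_eq_two, flipAdj_of, Matrix.mulVec,
        dotProduct,
        Fin.sum_univ_four]
  · ext i
    fin_cases i <;> simp [component, Matrix.mulVec, dotProduct, Fin.sum_univ_four]
  · exact k.elim0
  · rintro (_ | _) <;> simp [Matrix.det_succ_row_zero, Fin.sum_univ_succ, Fin.succAbove]
  · rintro (_ | _) i <;> fin_cases i
    · exact Or.inl (Or.inl ⟨1, rfl⟩)
    · exact Or.inl (Or.inr ⟨0, rfl⟩)
    · exact Or.inr (Or.inl (Or.inl ⟨1, rfl⟩))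
    · exact Or.inr (Or.inl (Or.inr ⟨0, rfl⟩))
    · exact Or.inl (Or.inl ⟨0, rfl⟩)
    · exact Or.inl (Or.inl ⟨2, rfl⟩)
    · exact Or.inr (Or.inl (Or.inl ⟨0, rfl⟩))
    · exact Or.inr (Or.inl (Or.inl ⟨2, rfl⟩))

/-! ### The two exceptional structures, from exchanging the middle qubits. -/

theorem permuteQubits_swap_apply (ψ : State) (i j k l : Fin 2) :
    permuteQubits (Equiv.swap 1 2) ψ ![i, j, k, l] = ψ ![i, k, j, l] := by
  rw [permuteQubits]
  congr 1
  ext m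
  fin_cases m <;> rfl

theorem stateMatrix_permuteQubits_La2b2 (a b : ℂ) :
    stateMatrix (permuteQubits (Equiv.swap 1 2) (Family.La2b2 a b).state) =
      !![a, 0, 0, b; 0, 1, 1, 0; 0, 0, 0, 0; b, 0, 0, a] := by
  rw [stateMatrix_eq_iff]
  intro i j k l
  rw [permuteQubits_swap_apply]
  fin_cases i <;> fin_cases j <;> fin_cases k <;> fin_cases l <;>
    simp [Family.state, ket_apply, finProdFinEquiv]

theorem stateMatrix_permuteQubits_La4 (a : ℂ) :
    stateMatrix (permuteQubits (Equiv.swap 1 2) (Family.La4 a).state) =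
      !![a, Complex.I, 0, a; 0, 0, 1, 0; 0, 0, 0, 0; a, -Complex.I, 0, a] := by
  rw [stateMatrix_eq_iff]
  intro i j k l
  rw [permuteQubits_swap_apply]
  fin_cases i <;> fin_cases j <;> fin_cases k <;> fin_cases l <;>
    simp [Family.state, ket_apply, finProdFinEquiv]

/-- This realizes the exceptional structure with two simple pairs and `3 ⊕ 1̄`. The eigenvalues `a +
b` and `a - b` can be prescribed arbitrarily. -/
theorem decomp_permuteQubits_La2b2 (a b : ℂ) :
    Decomp (flipP (stateMatrix (permuteQubits (Equiv.swap 1 2) (Family.La2b2 a b).state)))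
        [.pair 1 (a + b), .pair 1 (a - b), .degenerate true 3 1] ⊤ := by
  refine Covers.decomp (stateMatrix_permuteQubits_La2b2 a b)
      ((((covers_nil _).degenerate (p := 2) (q := 0) (h := true)
        (x := ![![0, 2, 0, 0], ![0, 1, 1, 0], ![0, 0, 1, 0]])
        (y := ![![0, 1, -1, 0]]) ⟨?_, fun k => ?_⟩ ⟨?_, fun k => ?_⟩).pair
        (f := ![![1, 0, 0, -1]]) ?_ ?_).pair
        (f := ![![1, 0, 0, 1]]) ?_ ?_)
      (Bool.rec !![1, 0, 0, 1; 1, 0, 0, -1; 0, 1, 1, 0; 0, 1, -1, 0]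
        !![1, 0, 0, 1; 1, 0, 0, -1; 0, 2, 0, 0; 0, 0, 1, 0]) ?_ ?_
  · ext i
    fin_cases i <;> simp [component, flipAdj_of, Matrix.mulVec, dotProduct, Fin.sum_univ_four]
  · ext i
    fin_cases k <;> fin_cases i <;>
      simp [component, stringHalf, Nat.even_iff, one_add_one_eq_two, flipAdj_of, Matrix.mulVec,
        dotProduct,
        Fin.sum_univ_four]
  · ext i
    fin_cases i <;> simp [component, Matrix.mulVec, dotProduct, Fin.sum_univ_four]
  · exact k.elim0
  · refine isJordanChain_succ ?_ (fun k => k.elim0)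
    ext i; fin_cases i <;> simp [Matrix.mulVec, dotProduct, Fin.sum_univ_four] <;> ring
  · refine isJordanChain_succ ?_ (fun k => k.elim0)
    ext i; fin_cases i <;> simp [flipAdj_of, Matrix.mulVec, dotProduct, Fin.sum_univ_four] <;> ring
  · refine isJordanChain_succ ?_ (fun k => k.elim0)
    ext i; fin_cases i <;> simp [Matrix.mulVec, dotProduct, Fin.sum_univ_four] <;> ring
  · refine isJordanChain_succ ?_ (fun k => k.elim0)
    ext i; fin_cases i <;> simp [flipAdj_of, Matrix.mulVec, dotProduct, Fin.sum_univ_four] <;> ring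
  · rintro (_ | _) <;> simp [Matrix.det_succ_row_zero, Fin.sum_univ_succ, Fin.succAbove] <;>
      norm_num
  · rintro (_ | _) i <;> fin_cases i
    · exact Or.inl ⟨false, 0, rfl⟩
    · exact Or.inr (Or.inl ⟨false, 0, rfl⟩)
    · exact Or.inr (Or.inr (Or.inl (Or.inl ⟨1, rfl⟩)))
    · exact Or.inr (Or.inr (Or.inl (Or.inr ⟨0, rfl⟩)))
    · exact Or.inl ⟨true, 0, rfl⟩
    · exact Or.inr (Or.inl ⟨true, 0, rfl⟩)
    · exact Or.inr (Or.inr (Or.inl (Or.inl ⟨0, rfl⟩)))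
    · exact Or.inr (Or.inr (Or.inl (Or.inl ⟨2, rfl⟩)))

/-- This realizes the exceptional structure with one simple pair and `5 ⊕ 1̄`, for any eigenvalue `2
a`. -/
theorem decomp_permuteQubits_La4 (a : ℂ) :
    Decomp (flipP (stateMatrix (permuteQubits (Equiv.swap 1 2) (Family.La4 a).state)))
        [.pair 1 (2 * a), .degenerate true 5 1] ⊤ := by
  refine Covers.decomp (stateMatrix_permuteQubits_La4 a)
      (((covers_nil _).degenerate (p := 4) (q := 0) (h := true)
        (x := ![![0, -2, 0, 0], ![0, 0, -2, 0], ![Complex.I, 0, 0, -Complex.I], ![0, 1, 0, 0],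
            ![0, 0, 1, 0]])
        (y := ![![1, 0, 0, -1]]) ⟨?_, fun k => ?_⟩ ⟨?_, fun k => ?_⟩).pair
        (f := ![![1, 0, 0, 1]]) ?_ ?_)
      (Bool.rec !![1, 0, 0, 1; 0, 0, -2, 0; 0, 1, 0, 0; 1, 0, 0, -1]
        !![1, 0, 0, 1; 0, -2, 0, 0; Complex.I, 0, 0, -Complex.I; 0, 0, 1, 0]) ?_ ?_
  · ext i
    fin_cases i <;> simp [component, flipAdj_of, Matrix.mulVec, dotProduct, Fin.sum_univ_four]
  · ext i
    fin_cases k <;> fin_cases i <;>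
      simp [component, stringHalf, Nat.even_iff, one_add_one_eq_two, flipAdj_of, Matrix.mulVec,
        dotProduct,
        Fin.sum_univ_four]
    norm_num
  · ext i
    fin_cases i <;> simp [component, Matrix.mulVec, dotProduct, Fin.sum_univ_four]
  · exact k.elim0
  · refine isJordanChain_succ ?_ (fun k => k.elim0)
    ext i; fin_cases i <;> simp [Matrix.mulVec, dotProduct, Fin.sum_univ_four] <;> ring
  · refine isJordanChain_succ ?_ (fun k => k.elim0)
    ext i; fin_cases i <;> simp [flipAdj_of, Matrix.mulVec, dotProduct, Fin.sum_univ_four] <;> ring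
  · rintro (_ | _) <;> simp [Matrix.det_succ_row_zero, Fin.sum_univ_succ, Fin.succAbove] <;>
      norm_num
  · rintro (_ | _) i <;> fin_cases i
    · exact Or.inl ⟨false, 0, rfl⟩
    · exact Or.inr (Or.inl (Or.inl ⟨1, rfl⟩))
    · exact Or.inr (Or.inl (Or.inl ⟨3, rfl⟩))
    · exact Or.inr (Or.inl (Or.inr ⟨0, rfl⟩))
    · exact Or.inl ⟨true, 0, rfl⟩
    · exact Or.inr (Or.inl (Or.inl ⟨0, rfl⟩))
    · exact Or.inr (Or.inl (Or.inl ⟨2, rfl⟩))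
    · exact Or.inr (Or.inl (Or.inl ⟨4, rfl⟩))

/-! ### The spectrum -/

/-- The characteristic matrix is made block triangular by right multiplication with `[[1, M], [0,
X]]`. Both sides then carry the factor `det X`, a power of the variable, which can be cancelled. -/
theorem charpoly_fromBlocks_zero_zero {n R : Type*} [Fintype n] [DecidableEq n] [CommRing R]
    (M N : Matrix n n R) :
    (Matrix.fromBlocks 0 M N 0).charpoly = (N * M).charpoly.comp (Polynomial.X ^ 2) := by
  set Mp : Matrix n n (Polynomial R) := M.map Polynomial.C with hM
  set Np : Matrix n n (Polynomial R) := N.map Polynomial.C with hN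
  set x : Matrix n n (Polynomial R) := Matrix.scalar n Polynomial.X with hx
  have h1 : (Matrix.fromBlocks 0 M N 0).charmatrix = Matrix.fromBlocks x (-Mp) (-Np) x := by
    rw [Matrix.charmatrix_fromBlocks]
    simp [Matrix.charmatrix, hM, hN, hx]
  have h2 : (N * M).charpoly.comp (Polynomial.X ^ 2) = (x * x - Np * Mp).det := by
    rw [Matrix.charpoly, ← Polynomial.coe_compRingHom_apply, RingHom.map_det]
    congr 1
    rw [hM, hN, ← Matrix.map_mul]
    generalize N * M = K
    ext1 i j
    by_cases hij : i = j
    · subst hij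
      simp [Matrix.charmatrix, hx, sq]
    · simp [Matrix.charmatrix, hx, hij]
  have h3 : Matrix.fromBlocks x (-Mp) (-Np) x * Matrix.fromBlocks 1 Mp 0 x =
      Matrix.fromBlocks x 0 (-Np) (x * x - Np * Mp) := by
    have hc : x * Mp = Mp * x :=
      (Matrix.scalar_commute Polynomial.X (fun _ => Commute.all _ _) Mp).eq
    clear_value x Mp Np
    rw [Matrix.fromBlocks_multiply, hc, Matrix.mul_one, Matrix.mul_zero, add_zero, Matrix.mul_one,
      Matrix.mul_zero, add_zero, Matrix.neg_mul, Matrix.neg_mul, add_neg_cancel, neg_add_eq_sub]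
  have h4 : (Matrix.fromBlocks x (-Mp) (-Np) x).det * (Matrix.fromBlocks 1 Mp 0 x).det =
      (Matrix.fromBlocks x 0 (-Np) (x * x - Np * Mp)).det := by
    rw [← Matrix.det_mul, h3]
  rw [Matrix.det_fromBlocks_zero₂₁, Matrix.det_fromBlocks_zero₁₂, Matrix.det_one,
    one_mul, mul_comm] at h4
  have hxd : IsLeftRegular x.det := by
    have : x.det = Polynomial.X ^ Fintype.card n := by simp [hx]
    rw [this]
    exact (Polynomial.monic_X_pow _).isRegular.left
  rw [Matrix.charpoly, h1, h2]
  exact hxd h4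

theorem eval_charpoly_flipP (M : Matrix (Fin 4) (Fin 4) ℂ) (t : ℂ) :
    (flipP M).charpoly.eval t = (Matrix.scalar (Fin 4) (t ^ 2) - flipAdj M * M).det := by
  rw [flipP, charpoly_fromBlocks_zero_zero, Polynomial.eval_comp, Polynomial.eval_pow,
    Polynomial.eval_X, Matrix.eval_charpoly, flipAdj]

theorem roots_prod_X_sub_C_mul_X_add_C (s : Multiset ℂ) :
    ((s.map fun z => (Polynomial.X - Polynomial.C z) *
      (Polynomial.X + Polynomial.C z)).prod).roots = s + s.map Neg.neg := by
  have hm : ∀ z : ℂ, ((Polynomial.X - Polynomial.C z) * (Polynomial.X + Polynomial.C z)).Monic :=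
    fun z => (Polynomial.monic_X_sub_C z).mul (Polynomial.monic_X_add_C z)
  induction s using Multiset.induction_on with
  | empty => simp
  | cons z s ih =>
    rw [Multiset.map_cons, Multiset.prod_cons, Polynomial.roots_mul
      ((hm z).mul (Polynomial.monic_multiset_prod_of_monic _ _ fun z _ => hm z)).ne_zero, ih,
      Polynomial.roots_mul (hm z).ne_zero, Polynomial.roots_X_sub_C, Polynomial.roots_X_add_C,
      Multiset.map_cons, ← Multiset.singleton_add z s, ← Multiset.singleton_add (-z)]
    abel

theorem eq_zero_of_isRight_neg {z : ℂ} (h : IsRight z) (h' : IsRight (-z)) : z = 0 := by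
  simp only [IsRight, Complex.neg_re, Complex.neg_im] at h h'
  refine Complex.ext ?_ ?_ <;> simp only [Complex.zero_re, Complex.zero_im] <;>
    rcases h with h | ⟨h, _⟩ <;> rcases h' with h' | ⟨h', _⟩ <;> linarith

/-- For `z ≠ 0` only one of `z`, `-z` is admitted, so its multiplicity can be read off from the
union with the negatives; the multiplicity of `0` is merely doubled. -/
theorem eq_of_add_map_neg_eq {s t : Multiset ℂ} (hs : ∀ z ∈ s, IsRight z)
    (ht : ∀ z ∈ t, IsRight z) (h : s + s.map Neg.neg = t + t.map Neg.neg) : s = t := by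
  have hc : ∀ (u : Multiset ℂ) z, (u + u.map Neg.neg).count z = u.count z + u.count (-z) := by
    intro u z
    rw [Multiset.count_add]
    congr 1
    conv_lhs => rw [← neg_neg z]
    exact Multiset.count_map_eq_count' _ _ neg_injective _
  ext z
  have hz := congrArg (Multiset.count z) h
  rw [hc, hc] at hz
  by_cases h0 : z = 0
  · subst h0
    rw [neg_zero] at hz
    omega
  have key : ∀ u : Multiset ℂ, (∀ z ∈ u, IsRight z) → ∀ w, ¬ IsRight w → u.count w = 0 :=
    fun u hu w hw => Multiset.count_eq_zero.2 fun hmem => hw (hu w hmem)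
  by_cases hr : IsRight z
  · have hr' : ¬ IsRight (-z) := fun h' => h0 (eq_zero_of_isRight_neg hr h')
    rw [key s hs _ hr', key t ht _ hr'] at hz
    simpa using hz
  · rw [key s hs _ hr, key t ht _ hr]

theorem isRightSpectrum_iff {P : Matrix (Fin 4 ⊕ Fin 4) (Fin 4 ⊕ Fin 4) ℂ} {e : Multiset ℂ}
    (he : ∀ z ∈ e, IsRight z) (hP : P.charpoly =
      (e.map fun z => (Polynomial.X - Polynomial.C z) * (Polynomial.X + Polynomial.C z)).prod)
    (s : Multiset ℂ) : IsRightSpectrum P s ↔ s = e := by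
  constructor
  · rintro ⟨hs, h⟩
    refine eq_of_add_map_neg_eq hs he ?_
    rw [← roots_prod_X_sub_C_mul_X_add_C, ← roots_prod_X_sub_C_mul_X_add_C, ← h, ← hP]
  · rintro rfl
    exact ⟨he, hP⟩

theorem eval_charpoly_of (a b c d e f g h i j k l m n o p t : ℂ) :
    (flipP !![a, b, c, d; e, f, g, h; i, j, k, l; m, n, o, p]).charpoly.eval t =
      (!![t ^ 2 - (p * a - l * e - h * i + d * m), -(p * b - l * f - h * j + d * n),
          -(p * c - l * g - h * k + d * o), -(p * d - l * h - h * l + d * p);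
        -(-o * a + k * e + g * i - c * m), t ^ 2 - (-o * b + k * f + g * j - c * n),
          -(-o * c + k * g + g * k - c * o), -(-o * d + k * h + g * l - c * p);
        -(-n * a + j * e + f * i - b * m), -(-n * b + j * f + f * j - b * n),
          t ^ 2 - (-n * c + j * g + f * k - b * o), -(-n * d + j * h + f * l - b * p);
        -(m * a - i * e - e * i + a * m), -(m * b - i * f - e * j + a * n),
          -(m * c - i * g - e * k + a * o), t ^ 2 - (m * d - i * h - e * l + a * p)]).det := by
  rw [eval_charpoly_flipP, flipAdj_of]
  congr 1
  ext r s
  fin_cases r <;> fin_cases s <;> simp <;> ring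

/-- Two complex polynomials agree once their values do, so each family needs one `4 × 4`
determinant; the identity holds without restriction on the parameters. -/
theorem charpoly_matP_state (F : Family) : (matP F.state).charpoly =
    (F.eigenvalues.map fun z =>
      (Polynomial.X - Polynomial.C z) * (Polynomial.X + Polynomial.C z)).prod := by
  rw [← (gradedSimilar_flipP_matP _).charpoly_eq]
  refine Polynomial.funext fun t => ?_
  cases F with
  | Gabcd a b c d =>
    rw [stateMatrix_Gabcd, eval_charpoly_of]
    simp [Family.eigenvalues, Matrix.det_succ_row_zero, Fin.sum_univ_succ, Fin.succAbove]
    ring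
  | Labc2 a b c =>
    rw [stateMatrix_Labc2, eval_charpoly_of]
    simp [Family.eigenvalues, Matrix.det_succ_row_zero, Fin.sum_univ_succ, Fin.succAbove]
    ring
  | La2b2 a b =>
    rw [stateMatrix_La2b2, eval_charpoly_of]
    simp [Family.eigenvalues, Matrix.det_succ_row_zero, Fin.sum_univ_succ, Fin.succAbove]
    ring
  | Lab3 a b =>
    rw [stateMatrix_Lab3, eval_charpoly_of]
    -- The determinant does not depend on this coefficient, so its value plays no role.
    generalize Complex.I / ((Real.sqrt 2 : ℝ) : ℂ) = κ
    simp [Family.eigenvalues, Matrix.det_succ_row_zero, Fin.sum_univ_succ, Fin.succAbove]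
    ring
  | La4 a =>
    rw [stateMatrix_La4, eval_charpoly_of]
    simp [Family.eigenvalues, Matrix.det_succ_row_zero, Fin.sum_univ_succ, Fin.succAbove]
    ring
  | La2031 a =>
    rw [stateMatrix_La2031, eval_charpoly_of]
    simp [Family.eigenvalues, Matrix.det_succ_row_zero, Fin.sum_univ_succ, Fin.succAbove]
    ring
  | L053 =>
    rw [stateMatrix_L053, eval_charpoly_of]
    simp [Family.eigenvalues, Matrix.det_succ_row_zero, Fin.sum_univ_succ, Fin.succAbove]
    ring
  | L071 =>
    rw [stateMatrix_L071, eval_charpoly_of]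
    simp [Family.eigenvalues, Matrix.det_succ_row_zero, Fin.sum_univ_succ, Fin.succAbove]
    ring
  | L031031 =>
    rw [stateMatrix_L031031, eval_charpoly_of]
    simp [Family.eigenvalues, Matrix.det_succ_row_zero, Fin.sum_univ_succ, Fin.succAbove]
    ring

/-! ### The classification -/

theorem decomp_state (F : Family) : Decomp (flipP (stateMatrix F.state)) F.blocks ⊤ := by
  cases F with
  | Gabcd a b c d => exact decomp_Gabcd a b c d
  | Labc2 a b c => exact decomp_Labc2 a b c
  | La2b2 a b => exact decomp_La2b2 a b
  | Lab3 a b => exact decomp_Lab3 a b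
  | La4 a => exact decomp_La4 a
  | La2031 a => exact decomp_La2031 a
  | L053 => exact decomp_L053
  | L071 => exact decomp_L071
  | L031031 => exact decomp_L031031

theorem Decomp.hasBlockStructure_matP {ψ : State} {L : List PBlock}
    (h : Decomp (flipP (stateMatrix ψ)) L ⊤) (hL : totalDim L = 8) :
    HasBlockStructure (matP ψ) L :=
  (gradedSimilar_flipP_matP ψ).hasBlockStructure (h.hasBlockStructure hL)

theorem hasBlockStructure_state (F : Family) : HasBlockStructure (matP F.state) F.blocks :=
  (decomp_state F).hasBlockStructure_matP (by cases F <;> rfl)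

theorem flipP_mulVec_mirror (M : Matrix (Fin 4) (Fin 4) ℂ) (v : Fin 4 ⊕ Fin 4 → ℂ) :
    flipP M *ᵥ mirror v = -mirror (flipP M *ᵥ v) := by
  ext i
  cases i <;> simp [flipP, mirror, Matrix.mulVec, dotProduct]

/-- The half sum and half difference of admissible eigenvalues may leave the half-plane. Changing
the sign of either parameter preserves the block structure, hence the equivalence class. -/
theorem exists_isRight_La2b2 (a b : ℂ) : ∃ a' b', IsRight a' ∧ IsRight b' ∧
    Equivalent (Family.La2b2 a b).state (Family.La2b2 a' b').state := by
  have key : ∀ (M : Matrix (Fin 4) (Fin 4) ℂ) (x : ℂ) (L : List PBlock),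
      Decomp (flipP M) (.pair 2 x :: L) ⊤ →
        ∃ x', IsRight x' ∧ Decomp (flipP M) (.pair 2 x' :: L) ⊤ := fun M x L h =>
    (isRight_or_isRight_neg x).elim (fun hx => ⟨x, hx, h⟩)
      fun hx => ⟨-x, hx, h.pair_neg (flipP_mulVec_mirror M)⟩
  obtain ⟨a', ha, h1⟩ := key _ _ _ (decomp_La2b2 a b)
  obtain ⟨b', hb, h2⟩ := key _ _ _ (h1.perm (.swap _ _ _))
  exact ⟨a', b', ha, hb, equivalent_of_hasBlockStructure
    ((h2.perm (.swap _ _ _)).hasBlockStructure_matP rfl) (hasBlockStructure_state (.La2b2 a' b'))⟩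

theorem exists_isRight_La4 (a : ℂ) : ∃ a', IsRight a' ∧
    Equivalent (Family.La4 a).state (Family.La4 a').state := by
  rcases isRight_or_isRight_neg a with ha | ha
  · exact ⟨a, ha, .refl _⟩
  · exact ⟨-a, ha, equivalent_of_hasBlockStructure (Decomp.hasBlockStructure_matP
      ((decomp_La4 a).pair_neg (flipP_mulVec_mirror _)) rfl) (hasBlockStructure_state (.La4 (-a)))⟩

/-- Every state is equivalent to a member of one of the nine families. -/
theorem exists_equivalent_state (ψ : State) :
    ∃ F : Family, (∀ z ∈ F.eigenvalues, IsRight z) ∧ Equivalent ψ F.state := by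
  obtain ⟨φ, L, hφ, hL, h⟩ := exists_equivalent_hasBlockStructure ψ
  cases hL with
  | family F hF =>
    exact ⟨F, hF, hφ.trans (equivalent_of_hasBlockStructure h (hasBlockStructure_state F))⟩
  | three_one x y =>
    -- The parameters solve `a + b = x`, `a - b = y`.
    have h1 := (decomp_permuteQubits_La2b2 ((x + y) / 2) ((x - y) / 2)).hasBlockStructure_matP rfl
    have hx : (x + y) / 2 + (x - y) / 2 = x := by ring
    have hy : (x + y) / 2 - (x - y) / 2 = y := by ring
    rw [hx, hy] at h1
    obtain ⟨a, b, ha, hb, hab⟩ := exists_isRight_La2b2 ((x + y) / 2) ((x - y) / 2)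
    refine ⟨.La2b2 a b, ?_, ((hφ.trans (equivalent_of_hasBlockStructure h h1)).trans
      (equivalent_permuteQubits _ _).symm).trans hab⟩
    simp [Family.eigenvalues, ha, hb]
  | five_one x =>
    have h1 := (decomp_permuteQubits_La4 (x / 2)).hasBlockStructure_matP rfl
    have hx : 2 * (x / 2) = x := by ring
    rw [hx] at h1
    obtain ⟨a, ha, hab⟩ := exists_isRight_La4 (x / 2)
    refine ⟨.La4 a, ?_, ((hφ.trans (equivalent_of_hasBlockStructure h h1)).trans
      (equivalent_permuteQubits _ _).symm).trans hab⟩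
    simp [Family.eigenvalues, ha]

end FourQubits

end

open FourQubits in
theorem theorem2 :
    (∀ ψ : State, ∃ (σ : Equiv.Perm (Fin 4)) (A : Fin 4 → Matrix.SpecialLinearGroup (Fin 2) ℂ)
      (F : Family),
        slocc A (permuteQubits σ ψ) = F.state ∧
        (∀ s : Multiset ℂ,
          IsRightSpectrum (matP (permuteQubits σ ψ)) s ↔ s = F.eigenvalues) ∧
        HasBlockStructure (matP (permuteQubits σ ψ)) F.blocks) ∧
    (∀ F : Family, HasBlockStructure (matP F.state) F.blocks ∧
      ((∀ z ∈ F.eigenvalues, IsRight z) →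
        ∀ s : Multiset ℂ, IsRightSpectrum (matP F.state) s ↔ s = F.eigenvalues)) := by
  refine ⟨fun ψ => ?_, fun F => ⟨hasBlockStructure_state F,
    fun hF => isRightSpectrum_iff hF (charpoly_matP_state F)⟩⟩
  obtain ⟨F, hF, σ, A, h⟩ := exists_equivalent_state ψ
  -- Only the local operation is undone: a qubit permutation may change `P`, so spectrum and blocks
  -- are those of the permuted state.
  have hsim := gradedSimilar_slocc A (permuteQubits σ ψ)
  rw [h] at hsim
  exact ⟨σ, A, F, h, isRightSpectrum_iff hF (hsim.charpoly_eq.trans (charpoly_matP_state F)),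
    hsim.symm.hasBlockStructure (hasBlockStructure_state F)⟩
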